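/- **Setting.** Let $n\ge 2$ and let $N$ be a smooth $(n+1)$-manifold with a locally flat projective structure $[\nabla]$ (a class of torsion-free connections, $\nabla'_XY=\nabla_XY+p(X)Y+p(Y)X$). Put $\mathcal E(w)=|\Lambda^{n+1}T^*N|^{-w/(n+2)}$. A scale is a positive section $\tau$ of $\mathcal E(1)$; it determines the connection $\nabla=\nabla^\tau\in[\nabla]$ with $\nabla\tau=0$. With $R_{ij}{}^k{}_l$ its curvature, let $P_{ij}=\frac1n R_{ki}{}^k{}_j$; local flatness means $R_{ij}{}^k{}_l=\delta_i{}^kP_{jl}-\delta_j{}^kP_{il}$. In the scale $\tau$ all densities are identified with functions. The projective tractor bundle $\widetilde{\mathcal E}^I$ is $TN\oplus\mathbb R\ni(\nu^i,\lambda)$, with the connection $\nabla^{\rm proj}_i(\nu^j,\lambda)=(\nabla_i\nu^j+\lambda\delta_i{}^j,\ \nabla_i\lambda-P_{ik}\nu^k)$. Let $\widetilde N\subset\mathcal E(-1)$ be the $\mathbb R_+$-bundle of positive elements $t\tau^{-1}(x)$; tractor fields are the vector fields $\lambda\,\partial_t+t^{-1}\nu^i\partial_i$ on $\widetilde N$ that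 are homogeneous of degree $-1$. Let $M\subset N$ be a hypersurface with a defining density $\mathbf r=\tau^2\rho\in\mathcal E(2)$ ($M=\{\mathbf r=0\}$, $d\mathbf r\ne0$ on $M$), strictly convex: $\nabla_i\nabla_j\rho$ is positive definite on $TM$. Let $$\tilde g_{IJ}=D_ID_J\mathbf r=\begin{pmatrix}2\rho&\nabla_j\rho\\ \nabla_i\rho&\nabla_i\nabla_j\rho+2\rho P_{ij}\end{pmatrix},$$ viewed as the homogeneous metric on $\widetilde N$ with value $\tilde g_{IJ}\nu^I\nu'^J$ on tractor fields, and let $\mathbf r$ be a Fefferman defining density: along $M$, $\det(D_ID_J\mathbf r)=-1+O(\mathbf r^\infty)$ if $n$ is odd and $=-1+O(\mathbf r^{n/2+1})$ if $n$ is even, the determinant being taken in frames unimodular for $\tau^{-(n+2)}$. Let $\widetilde\nabla$ be the Levi-Civita connection of the ambient metric $\tilde g$, near $M$. For the scale $\tau$, let $\xi$ be the affine normal along $M$, i.e. the field with $d\rho(\xi)>0$ such that, in $\nabla_XY=\nabla^\xi_XY-h(X,Y)\xi$ and $\nabla_X\xi=S(X)+\eta(X)\xi$ ($X,Y$ tangent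 to $M$), one has $\eta=0$ and $(\xi\lrcorner\,\tau^{-(n+2)})|_{TM}=vol_h$. Let $\nabla^h$ be the Levi-Civita connection of $h$, $A_{\alpha\beta}{}^\gamma=\nabla^h-\nabla^\xi$ the Fubini–Pick form (indices are moved with $h$), $(\delta A)_{\alpha\beta}=\nabla^h_\gamma A_{\alpha\beta}{}^\gamma$, $J'=\frac{1}{2(n-1)}(\mathrm{scal}_h-|A|^2)$, and $$P^h_{\alpha\beta}=\tfrac1{n-2}\Bigl(\mathrm{Ric}^h_{\alpha\beta}-\tfrac{\mathrm{scal}_h}{2(n-1)}h_{\alpha\beta}\Bigr)\ (n\ge3),\qquad P^h_{\alpha\beta}=\mathrm{tf}\,S_{\alpha\beta}-\tfrac12(\delta A)_{\alpha\beta}+\tfrac14\mathrm{scal}_h h_{\alpha\beta}\ (n=2).$$ The conformal tractor bundle $\mathcal E^I=\mathbb R\oplus TM\oplus\mathbb R\ni(\sigma,\mu^\alpha,\varphi)$ carries the tractor metric $h_{IJ}U^IU'^J=h_{\alpha\beta}\mu^\alpha\mu'^\beta+\sigma\varphi'+\varphi\sigma'$ and the conformal (Möbius, if $n=2$) tractor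 connection $$\nabla_\alpha(\sigma,\mu^\beta,\varphi)=(\nabla_\alpha\sigma-\mu_\alpha,\ \nabla^h_\alpha\mu^\beta+\delta_\alpha{}^\beta\varphi+P^h_\alpha{}^\beta\sigma,\ \nabla_\alpha\varphi-P^h_{\alpha\gamma}\mu^\gamma).$$ Define $\Phi:\mathcal E^I\to\widetilde{\mathcal E}^I|_M$ by $\Phi(\sigma,\mu,\varphi)=\bigl(\mu+\sigma\xi,\ \varphi-\tfrac1n(\mathrm{tr}S-J')\sigma\bigr)$, and $$\widetilde A_\alpha(\sigma,\mu^\beta,\varphi)=(0,\ E_\alpha{}^\beta\sigma+A_{\alpha\gamma}{}^\beta\mu^\gamma,\ F_\alpha\sigma+G_{\alpha\gamma}\mu^\gamma),$$ where $E_{\alpha\beta}=-\mathrm{tf}\,S_{\alpha\beta}-\frac1nJ'h_{\alpha\beta}+P^h_{\alpha\beta}$, $G_{\alpha\beta}=P_{\alpha\beta}+\frac1n(\mathrm{tr}S-J')h_{\alpha\beta}-P^h_{\alpha\beta}$, $F_\alpha=P_{ij}\,(\partial_\alpha)^i\xi^j+\frac1n\nabla_\alpha(\mathrm{tr}S-J')$.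 Let $\widetilde A''_{\alpha JK}=\widetilde A_{\alpha[JK]}$ be its skew part with respect to $h_{IJ}$. **Proposition.** For every scale $\tau$, the affine normal exists, $\Phi$ is an isomorphism, and $\Phi^{-1}\circ\nabla^{\rm proj}_\alpha\circ\Phi=\nabla_\alpha-\widetilde A_\alpha$. The ambient metric is nondegenerate over $M$, and the restriction $\widetilde\nabla_\alpha$ of its Levi-Civita connection to $M$ is well defined: for a tractor field $\nu$ near $x\in M$, a tangent vector $X\in T_xM$, and any lift of $X$ to a tangent vector of $\widetilde N$ over $x$, the derivative of $\nu$ by $\widetilde\nabla$ along the lift is a tractor at $x$ that depends only on $X$ and $\nu|_M$. It satisfies $$\Phi^{-1}\circ\widetilde\nabla_\alpha\circ\Phi=\nabla_\alpha-\widetilde A''_\alpha .$$ In particular $\Phi^{-1}\circ\widetilde\nabla_\alpha\circ\Phi=\nabla_\alpha$ if and only if $A_{\alpha\beta\gamma}=0$ (and this holds at each point of $M$ separately). -/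

import Mathlib

open scoped Manifold ContDiff Topology Matrix

namespace ConfCodazzi

noncomputable section

/-! ### Tensor calculus in coordinates -/

/-- Coordinate space of dimension `m`. -/
abbrev Coord (m : ℕ) : Type := EuclideanSpace ℝ (Fin m)

/-- The partial derivative `∂ᵢ f` at `x`. -/
def pd {m : ℕ} {G : Type*} [NormedAddCommGroup G] [NormedSpace ℝ G] (i : Fin m)
    (f : Coord m → G) (x : Coord m) : G :=
  fderiv ℝ f x (EuclideanSpace.single i 1)

/-- Connection coefficients on a coordinate domain, `Γ x i j k = Γ_{ij}^k(x)`, where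
`∇_{∂ᵢ} ∂ⱼ = Γ_{ij}^k ∂ₖ`. -/
abbrev Coeffs (m : ℕ) : Type := Coord m → Fin m → Fin m → Fin m → ℝ

/-- The curvature `R_{ij}{}^k{}_l`, with `(∇ᵢ∇ⱼ - ∇ⱼ∇ᵢ) X^k = R_{ij}{}^k{}_l X^l`. -/
def curv {m : ℕ} (Γ : Coeffs m) (x : Coord m) (i j k l : Fin m) : ℝ :=
  pd i (fun z => Γ z j l k) x - pd j (fun z => Γ z i l k) x
    + ∑ q, (Γ x i q k * Γ x j l q - Γ x j q k * Γ x i l q)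

/-- The Ricci tensor `Ric_{jl} = R_{ij}{}^i{}_l`. -/
def ricci {m : ℕ} (Γ : Coeffs m) (x : Coord m) (j l : Fin m) : ℝ :=
  ∑ i, curv Γ x i j i l

/-- The Christoffel symbols
`Γ_{ij}^k = ½ g^{kl} (∂ᵢ g_{jl} + ∂ⱼ g_{il} - ∂_l g_{ij})` of the Levi-Civita connection of a
(pseudo-)Riemannian metric `g`. -/
def leviCivita {m : ℕ} (g : Coord m → Matrix (Fin m) (Fin m) ℝ) : Coeffs m :=
  fun x i j k => (1 / 2) * ∑ l, (g x)⁻¹ k l *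
    (pd i (fun z => g z j l) x + pd j (fun z => g z i l) x - pd l (fun z => g z i j) x)

/-- The covariant derivative `∇_w V` at `z`. -/
def covDeriv {m : ℕ} (Γ : Coeffs m) (V : Coord m → Coord m) (z w : Coord m) : Coord m :=
  fderiv ℝ V z w + WithLp.toLp 2 (fun k => ∑ i, ∑ j, Γ z i j k * w i * V z j)

/-- The covariant derivative `∇_{∂_α} V` of a vector field `V` along a map `F` (the pullback
connection). -/
def covAlong {n m : ℕ} (Γ : Coeffs m) (F V : Coord n → Coord m) (y : Coord n) (α : Fin n) :
    Coord m :=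
  pd α V y + WithLp.toLp 2 (fun k => ∑ i, ∑ j, Γ (F y) i j k * (pd α F y) i * V y j)

/-- The Hessian `∇ᵢ∇ⱼ f`. -/
def hess {m : ℕ} (Γ : Coeffs m) (f : Coord m → ℝ) (x : Coord m) (i j : Fin m) : ℝ :=
  pd i (pd j f) x - ∑ k, Γ x i j k * pd k f x

/-! ### Projective tractors in a coordinate domain and a projective scale

The dimension is `n + 1`. In a scale `τ` all densities are trivialized by powers of `τ`. A
projective tractor `(ν^i, λ)` is stored as the vector with entries `v 0 = λ`, `v i.succ = ν^i`, and
a cotractor `(σ, μ_i)` as `u 0 = σ`, `u i.succ = μ_i`. -/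

/-- The projective Schouten tensor `P_{ij} = Ric_{ij} / n`. -/
def projSchouten {n : ℕ} (Γ : Coeffs (n + 1)) (x : Coord (n + 1)) (i j : Fin (n + 1)) : ℝ :=
  ricci Γ x i j / n

/-- The projective Weyl tensor
`C_{ij}{}^k{}_l = R_{ij}{}^k{}_l - (δᵢ^k P_{jl} - δⱼ^k P_{il})`. -/
def projWeyl {n : ℕ} (Γ : Coeffs (n + 1)) (x : Coord (n + 1)) (i j k l : Fin (n + 1)) : ℝ :=
  curv Γ x i j k l - ((if i = k then projSchouten Γ x j l else 0)
    - (if j = k then projSchouten Γ x i l else 0))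

/-- The tractor `D`-operator `D_I f = (w f, ∇ᵢ f)` on densities of weight `w`. -/
def tractorD {n : ℕ} (w : ℝ) (f : Coord (n + 1) → ℝ) (x : Coord (n + 1)) : Fin (n + 2) → ℝ :=
  Matrix.vecCons (w * f x) (fun i => pd i f x)

/-- The tractor connection on cotractors,
`∇ᵢ (σ, μ_j) = (∇ᵢ σ - μᵢ, ∇ᵢ μ_j + P_{ij} σ)`. -/
def cotractorConn {n : ℕ} (Γ : Coeffs (n + 1)) (u : Coord (n + 1) → Fin (n + 2) → ℝ)
    (x : Coord (n + 1)) (i : Fin (n + 1)) : Fin (n + 2) → ℝ :=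
  Matrix.vecCons (pd i (fun z => u z 0) x - u x i.succ)
    (fun j => pd i (fun z => u z j.succ) x - ∑ k, Γ x i j k * u x k.succ
      + projSchouten Γ x i j * u x 0)

/-- The tractor `D`-operator `D_I u_J = (w u_J, ∇ᵢ u_J)` on cotractors of weight `w`. -/
def tractorDCotractor {n : ℕ} (Γ : Coeffs (n + 1)) (w : ℝ) (u : Coord (n + 1) → Fin (n + 2) → ℝ)
    (x : Coord (n + 1)) : Matrix (Fin (n + 2)) (Fin (n + 2)) ℝ :=
  Matrix.of (Matrix.vecCons (w • u x) (fun i => cotractorConn Γ u x i))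

/-- `D_I D_J 𝐫` for a density `𝐫 = τ² ρ` of weight `2`. -/
def preAmbient {n : ℕ} (Γ : Coeffs (n + 1)) (ρ : Coord (n + 1) → ℝ) (x : Coord (n + 1)) :
    Matrix (Fin (n + 2)) (Fin (n + 2)) ℝ :=
  tractorDCotractor Γ 1 (tractorD 2 ρ) x

/-- The Monge–Ampère operator `𝒥[𝐫] = det (D_I D_J 𝐫)`. The determinant is taken in a frame which is
unimodular for the volume `τ^{-(n+2)} = vol |dx|`; in the coordinate frame this is division by
`vol²`. -/
def mongeAmpere {n : ℕ} (Γ : Coeffs (n + 1)) (vol ρ : Coord (n + 1) → ℝ) (x : Coord (n + 1)) : ℝ :=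
  (preAmbient Γ ρ x).det / vol x ^ 2

/-! ### The ambient space

The scale trivializes the `ℝ₊`-bundle `Ñ` of positive elements of `ℰ(-1)`: the element
`t τ^{-1}(x)` has coordinates `z = (t, x)`, with `z 0 = t > 0`. The tractors at `x` are the vector
fields along the fibre that are homogeneous of degree `-1`; the tractor `(ν^i, λ)` is
`λ ∂_t + t^{-1} ν^i ∂ᵢ`. -/

/-- The point `(t, x)` of `Ñ`, or the tangent vector `t ∂_t + x^i ∂ᵢ`. -/
def ambPoint {n : ℕ} (t : ℝ) (x : Coord (n + 1)) : Coord (n + 2) :=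
  WithLp.toLp 2 (Matrix.vecCons t (fun i => x i))

/-- The projection `Ñ → N`. -/
def ambBase {n : ℕ} (z : Coord (n + 2)) : Coord (n + 1) :=
  WithLp.toLp 2 (fun i => z i.succ)

/-- The tangent vector of `Ñ` at height `t` that represents a tractor. -/
def homLift {n : ℕ} (t : ℝ) (v : Coord (n + 2)) : Coord (n + 2) :=
  WithLp.toLp 2 (Matrix.vecCons (v 0) (fun i : Fin (n + 1) => t⁻¹ * v i.succ))

/-- The homogeneous vector field on `Ñ` of degree `-1` that represents a tractor field. -/
def homField {n : ℕ} (v : Coord (n + 1) → Coord (n + 2)) (z : Coord (n + 2)) : Coord (n + 2) :=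
  homLift (z 0) (v (ambBase z))

/-- `g̃_{IJ} = D_I D_J 𝐫` as a metric on `Ñ`, homogeneous of degree `2`. -/
def ambientMetric {n : ℕ} (Γ : Coeffs (n + 1)) (ρ : Coord (n + 1) → ℝ) (z : Coord (n + 2)) :
    Matrix (Fin (n + 2)) (Fin (n + 2)) ℝ :=
  Matrix.of fun I J => Matrix.vecCons 1 (fun _ : Fin (n + 1) => z 0) I
    * Matrix.vecCons 1 (fun _ : Fin (n + 1) => z 0) J * preAmbient Γ ρ (ambBase z) I J

/-! ### Geometry of a hypersurface in coordinates -/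

/-- Coordinate expressions, in a chart of `N`, a chart of `M` and a projective scale `τ`:
the coefficients `Γ` of the representative `∇` of the projective structure with `∇ τ = 0`, the
component `vol` of `τ^{-(n+2)}`, a function `ρ` (for `𝐫 = τ² ρ`), the inclusion `F` of `M`, and a
vector field `ξ` along `M`. -/
structure LocalData (n : ℕ) where
  Γ : Coeffs (n + 1)
  vol : Coord (n + 1) → ℝ
  ρ : Coord (n + 1) → ℝ
  F : Coord n → Coord (n + 1)
  ξ : Coord n → Coord (n + 1)

/-- Conformal tractors `(σ, μ^α, φ)` in a conformal scale. -/
abbrev ConfTractor (n : ℕ) : Type := ℝ × (Fin n → ℝ) × ℝ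

namespace LocalData

variable {n : ℕ} (D : LocalData n)

/-- The matrix with columns `∂₁F, …, ∂ₙF, ξ`. -/
def frame (y : Coord n) : Matrix (Fin (n + 1)) (Fin (n + 1)) ℝ :=
  Matrix.of fun i j =>
    (Fin.snoc (α := fun _ => Coord (n + 1)) (fun α => pd α D.F y) (D.ξ y) j) i

/-- Coefficients of a vector in the frame `∂₁F, …, ∂ₙF, ξ`. -/
def decomp (y : Coord n) (v : Coord (n + 1)) : Fin (n + 1) → ℝ :=
  (D.frame y)⁻¹ *ᵥ (fun i => v i)

/-- The induced connection `∇^ξ`: the tangential part of `∇_X Y = ∇^ξ_X Y - h(X,Y) ξ`. -/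
def indConn : Coeffs n :=
  fun y α β γ => D.decomp y (covAlong D.Γ D.F (pd β D.F) y α) γ.castSucc

/-- The affine metric `h`: the transverse part of `∇_X Y = ∇^ξ_X Y - h(X,Y) ξ`. -/
def h (y : Coord n) : Matrix (Fin n) (Fin n) ℝ :=
  Matrix.of fun α β => -D.decomp y (covAlong D.Γ D.F (pd β D.F) y α) (Fin.last n)

/-- The shape operator `S_α{}^γ`: the tangential part of `∇_X ξ = S(X) + η(X) ξ`. -/
def shape (y : Coord n) (α γ : Fin n) : ℝ :=
  D.decomp y (covAlong D.Γ D.F D.ξ y α) γ.castSucc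

/-- The form `η_α`: the transverse part of `∇_X ξ = S(X) + η(X) ξ`. -/
def eta (y : Coord n) (α : Fin n) : ℝ :=
  D.decomp y (covAlong D.Γ D.F D.ξ y α) (Fin.last n)

/-- `ξ` is the affine normal field on `W`: it is smooth, `dρ(ξ) > 0`, `ξ ⌟ τ^{-(n+2)}` restricts to
the volume element of `h`, and `η = 0`. -/
structure IsAffineNormal (W : Set (Coord n)) : Prop where
  smooth : ContDiffOn ℝ ∞ D.ξ W
  pos : ∀ y ∈ W, 0 < fderiv ℝ D.ρ (D.F y) (D.ξ y)
  volume : ∀ y ∈ W, D.vol (D.F y) * |(D.frame y).det| = √(D.h y).det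
  eta_eq_zero : ∀ y ∈ W, ∀ α, D.eta y α = 0

/-- The Levi-Civita connection `∇^h` of the affine metric. -/
def connH : Coeffs n := leviCivita D.h

/-- The inverse metric `h^{αβ}`. -/
def hInv (y : Coord n) (α β : Fin n) : ℝ := (D.h y)⁻¹ α β

/-- The Fubini–Pick form `A_{αβ}{}^γ`, `A = ∇^h - ∇^ξ`. -/
def A (y : Coord n) (α β γ : Fin n) : ℝ := D.connH y α β γ - D.indConn y α β γ

/-- The Fubini–Pick form with lowered indices `A_{αβγ}`. -/
def ALow (y : Coord n) (α β γ : Fin n) : ℝ := ∑ δ, D.A y α β δ * D.h y δ γ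

/-- `|A|² = A_{αβγ} A^{αβγ}`. -/
def normSqA (y : Coord n) : ℝ :=
  ∑ α, ∑ β, ∑ γ, ∑ α', ∑ β', ∑ γ', D.ALow y α β γ * D.ALow y α' β' γ'
    * D.hInv y α α' * D.hInv y β β' * D.hInv y γ γ'

/-- `(δA)_{αβ} = ∇^h_γ A_{αβ}{}^γ`. -/
def divA (y : Coord n) (α β : Fin n) : ℝ :=
  ∑ γ, (pd γ (fun z => D.A z α β γ) y
    + ∑ δ, (D.connH y γ δ γ * D.A y α β δ - D.connH y γ α δ * D.A y δ β γ
      - D.connH y γ β δ * D.A y α δ γ))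

/-- The scalar curvature of `h`. -/
def scal (y : Coord n) : ℝ := ∑ α, ∑ β, D.hInv y α β * ricci D.connH y α β

/-- `tr S`. -/
def trS (y : Coord n) : ℝ := ∑ α, D.shape y α α

/-- The trace-free part of `S_{αβ} = S_α{}^γ h_{γβ}`. -/
def tfS (y : Coord n) (α β : Fin n) : ℝ :=
  (∑ γ, D.shape y α γ * D.h y γ β) - (D.trS y / n) * D.h y α β

/-- `J' = (scal_h - |A|²) / (2(n-1))`. -/
def J' (y : Coord n) : ℝ := (D.scal y - D.normSqA y) / (2 * ((n : ℝ) - 1))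

/-- `P^h_{αβ}`: the conformal Schouten tensor of `h` if `n ≥ 3`, and the representative
`tf S_{αβ} - ½ (δA)_{αβ} + ¼ scal_h h_{αβ}` of the Möbius structure if `n = 2`. -/
def P (y : Coord n) (α β : Fin n) : ℝ :=
  if n = 2 then D.tfS y α β - (1 / 2) * D.divA y α β + (1 / 4) * D.scal y * D.h y α β
  else (1 / ((n : ℝ) - 2)) *
    (ricci D.connH y α β - D.scal y / (2 * ((n : ℝ) - 1)) * D.h y α β)

/-- `(tr S - J') / n`. -/
def c (y : Coord n) : ℝ := (D.trS y - D.J' y) / n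

/-- The projective Schouten tensor `P_{ij} v^i w^j` of `∇` at a point of `M`. -/
def projP (y : Coord n) (v w : Coord (n + 1)) : ℝ :=
  ∑ i, ∑ j, projSchouten D.Γ (D.F y) i j * v i * w j

/-! #### Conformal tractors -/

/-- The tractor metric `h_{αβ} μ^α μ'^β + σ φ' + φ σ'`. -/
def tractorMetric (y : Coord n) (U V : ConfTractor n) : ℝ :=
  (∑ α, ∑ β, D.h y α β * U.2.1 α * V.2.1 β) + U.1 * V.2.2 + U.2.2 * V.1

/-- Raising an index with the tractor metric: the tractor `R` with `tractorMetric R V = ℓ V` for a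
linear form `ℓ`. -/
def raise (y : Coord n) (ℓ : ConfTractor n → ℝ) : ConfTractor n :=
  (ℓ (0, 0, 1), fun α => ∑ β, D.hInv y α β * ℓ (0, Pi.single β 1, 0), ℓ (1, 0, 0))

/-- The conformal (Möbius if `n = 2`) tractor connection `∇_α U`. -/
def confConn (U : Coord n → ConfTractor n) (y : Coord n) (α : Fin n) : ConfTractor n :=
  (pd α (fun z => (U z).1) y - ∑ γ, D.h y α γ * (U y).2.1 γ,
   fun β => pd α (fun z => (U z).2.1 β) y + ∑ γ, D.connH y α γ β * (U y).2.1 γ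
     + (if α = β then (U y).2.2 else 0) + (∑ γ, D.P y α γ * D.hInv y γ β) * (U y).1,
   pd α (fun z => (U z).2.2) y - ∑ γ, D.P y α γ * (U y).2.1 γ)

/-- `E_{αβ} = - tf S_{αβ} - (1/n) J' h_{αβ} + P^h_{αβ}`. -/
def E (y : Coord n) (α β : Fin n) : ℝ :=
  -D.tfS y α β - (1 / n) * D.J' y * D.h y α β + D.P y α β

/-- `G_{αβ} = P_{αβ} + (1/n)(tr S - J') h_{αβ} - P^h_{αβ}`. -/
def G (y : Coord n) (α β : Fin n) : ℝ :=
  D.projP y (pd α D.F y) (pd β D.F y) + D.c y * D.h y α β - D.P y α β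

/-- `F_α = P_{α∞} + (1/n) ∇_α (tr S - J')`. -/
def Fform (y : Coord n) (α : Fin n) : ℝ :=
  D.projP y (pd α D.F y) (D.ξ y) + pd α D.c y

/-- The endomorphism `Ã_α`:
`(σ, μ^β, φ) ↦ (0, E_α{}^β σ + A_{αγ}{}^β μ^γ, F_α σ + G_{αγ} μ^γ)`. -/
def Atilde (y : Coord n) (α : Fin n) (U : ConfTractor n) : ConfTractor n :=
  (0, fun β => (∑ γ, D.E y α γ * D.hInv y γ β) * U.1 + ∑ γ, D.A y α γ β * U.2.1 γ,
   D.Fform y α * U.1 + ∑ γ, D.G y α γ * U.2.1 γ)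

/-- The skew part `Ã''_α`, with `Ã''_{αJK} = Ã_{α[JK]} = ½ (Ã_{αJK} - Ã_{αKJ})`. -/
def AtildeSkew (y : Coord n) (α : Fin n) (U : ConfTractor n) : ConfTractor n :=
  D.raise y fun V => (1 / 2) *
    (D.tractorMetric y (D.Atilde y α U) V - D.tractorMetric y (D.Atilde y α V) U)

/-! #### The isomorphism `Φ` and the connections on projective tractors along `M` -/

/-- `Φ (σ, μ^α, φ) = (μ^α ∂_αF + σ ξ, φ - (1/n)(tr S - J') σ)`, in the scale `τ`. -/
def Phi (y : Coord n) (U : ConfTractor n) : Coord (n + 2) :=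
  ambPoint (U.2.2 - D.c y * U.1) ((∑ α, U.2.1 α • pd α D.F y) + U.1 • D.ξ y)

/-- The projective tractor connection along `M`:
`∇_α (ν^j, λ) = (∇_α ν^j + λ (∂_αF)^j, ∂_α λ - P(∂_αF, ν))`. -/
def projConn (v : Coord n → Coord (n + 2)) (y : Coord n) (α : Fin n) : Coord (n + 2) :=
  ambPoint (pd α (fun z => v z 0) y - D.projP y (pd α D.F y) (ambBase (v y)))
    (covAlong D.Γ D.F (fun z => ambBase (v z)) y α + v y 0 • pd α D.F y)

/-- The Levi-Civita connection `∇̃` of the ambient metric on `Ñ`. -/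
def ambientConn : Coeffs (n + 2) := leviCivita (ambientMetric D.Γ D.ρ)

/-- The restriction of `∇̃` to projective tractor fields along `M`: the covariant derivative along
`y ↦ (1, F y)`, that is, along `M` placed in `Ñ` by the section `τ^{-1}`. -/
def ambientConnM (v : Coord n → Coord (n + 2)) (y : Coord n) (α : Fin n) : Coord (n + 2) :=
  covAlong D.ambientConn (fun z => ambPoint 1 (D.F z)) v y α

end LocalData

/-! ### Densities, scales and projective structures on a manifold -/

section Manifold

variable {n : ℕ} {N : Type*} [TopologicalSpace N] [ChartedSpace (Coord (n + 1)) N]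

/-- The smooth charts of `N`. -/
abbrev smoothCharts (m : ℕ) (N : Type*) [TopologicalSpace N] [ChartedSpace (Coord m) N] :
    Set (OpenPartialHomeomorph N (Coord m)) :=
  IsManifold.maximalAtlas 𝓘(ℝ, Coord m) ∞ N

/-- A smooth section of the density bundle `ℰ(w) = |Λ^{n+1} T*N|^{-w/(n+2)}`, given by its
components `f_e` in the charts `e`: the density is `f_e |dx|^{-w/(n+2)}`. -/
structure Density (n : ℕ) (N : Type*) [TopologicalSpace N] [ChartedSpace (Coord (n + 1)) N]
    (w : ℝ) where
  comp : OpenPartialHomeomorph N (Coord (n + 1)) → Coord (n + 1) → ℝ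
  contDiffOn_comp : ∀ e ∈ smoothCharts (n + 1) N, ContDiffOn ℝ ∞ (comp e) e.target
  comp_eq : ∀ e ∈ smoothCharts (n + 1) N, ∀ e' ∈ smoothCharts (n + 1) N,
    ∀ x ∈ (e.symm.trans e').source,
      comp e x = |(fderiv ℝ (e.symm.trans e') x).det| ^ (-w / (n + 2)) * comp e' (e' (e.symm x))

/-- A projective scale is a positive density of weight `1`. -/
def IsScale (τ : Density n N 1) : Prop :=
  ∀ e ∈ smoothCharts (n + 1) N, ∀ x ∈ e.target, 0 < τ.comp e x

/-- The component of the volume density `τ^{-(n+2)}` in a chart. -/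
def scaleVolume (τ : Density n N 1) (e : OpenPartialHomeomorph N (Coord (n + 1)))
    (x : Coord (n + 1)) : ℝ :=
  (τ.comp e x ^ (n + 2))⁻¹

/-- The function `ρ = τ^{-2} 𝐫` in a chart, for a density `𝐫` of weight `2`. -/
def scaleFun (τ : Density n N 1) (r : Density n N 2) (e : OpenPartialHomeomorph N (Coord (n + 1)))
    (x : Coord (n + 1)) : ℝ :=
  r.comp e x / τ.comp e x ^ 2

/-- An affine connection on `N`. -/
abbrev AffineConn (n : ℕ) (N : Type*) [TopologicalSpace N] [ChartedSpace (Coord (n + 1)) N]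
    [IsManifold 𝓘(ℝ, Coord (n + 1)) ∞ N] :=
  CovariantDerivative 𝓘(ℝ, Coord (n + 1)) (Coord (n + 1))
    (TangentSpace 𝓘(ℝ, Coord (n + 1)) : N → Type _)

/-- The coordinate vector field `∂ⱼ` of a chart. -/
def coordField (e : OpenPartialHomeomorph N (Coord (n + 1))) (j : Fin (n + 1)) (p : N) :
    TangentSpace 𝓘(ℝ, Coord (n + 1)) p :=
  VectorField.mpullback 𝓘(ℝ, Coord (n + 1)) 𝓘(ℝ, Coord (n + 1)) e
    (fun _ => (EuclideanSpace.single j 1 : Coord (n + 1))) p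

variable [IsManifold 𝓘(ℝ, Coord (n + 1)) ∞ N]

/-- The connection coefficients of an affine connection in a chart:
`∇_{∂ᵢ} ∂ⱼ = Γ_{ij}^k ∂ₖ`. -/
def christoffel (cov : AffineConn n N) (e : OpenPartialHomeomorph N (Coord (n + 1))) :
    Coeffs (n + 1) :=
  fun x i j k =>
    let v : Coord (n + 1) := mfderiv 𝓘(ℝ, Coord (n + 1)) 𝓘(ℝ, Coord (n + 1)) e (e.symm x)
      (cov (coordField e j) (e.symm x) (coordField e i (e.symm x)))
    v k

/-- The `1`-form `p` for which the connection `∇ + p` of the projective class of `∇` satisfies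
`(∇ + p) τ = 0`. Here `∇_i τ` has the component `∂ᵢ τ + (n+2)^{-1} Γ_{il}^l τ`, and
`∇ ↦ ∇ + p` changes `∇_i τ` to `∇_i τ + pᵢ τ`. -/
def scaleForm (cov : AffineConn n N) (τ : Density n N 1)
    (e : OpenPartialHomeomorph N (Coord (n + 1))) (x : Coord (n + 1)) (i : Fin (n + 1)) : ℝ :=
  -(pd i (τ.comp e) x / τ.comp e x + (∑ l, christoffel cov e x i l l) / (n + 2))

/-- The coefficients of the representative `∇^τ = ∇ + p`, that is,
`∇^τ_X Y = ∇_X Y + p(X) Y + p(Y) X`, of the projective class `[∇]` with `∇^τ τ = 0`. -/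
def scaleConn (cov : AffineConn n N) (τ : Density n N 1)
    (e : OpenPartialHomeomorph N (Coord (n + 1))) : Coeffs (n + 1) :=
  fun x i j k => christoffel cov e x i j k + (if j = k then scaleForm cov τ e x i else 0)
    + (if i = k then scaleForm cov τ e x j else 0)

/-- The projective structure `[∇]` is locally flat: its projective Weyl tensor vanishes. (The Weyl
tensor does not depend on the scale.) -/
def IsLocallyFlat (cov : AffineConn n N) : Prop :=
  ∀ τ : Density n N 1, IsScale τ → ∀ e ∈ smoothCharts (n + 1) N, ∀ x ∈ e.target,
    ∀ i j k l, projWeyl (scaleConn cov τ e) x i j k l = 0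

/-- `𝐫` is a defining density of the hypersurface `S`: `S` is its zero set, and `d𝐫 ≠ 0` on `S`.
(The domain bounded by `S` is `{𝐫 < 0}`.) -/
def IsDefiningDensity (r : Density n N 2) (S : Set N) : Prop :=
  (∀ p, p ∈ S ↔ ∀ e ∈ smoothCharts (n + 1) N, p ∈ e.source → r.comp e (e p) = 0) ∧
  ∀ e ∈ smoothCharts (n + 1) N, ∀ x ∈ e.target, r.comp e x = 0 → fderiv ℝ (r.comp e) x ≠ 0

/-- The zero set of the defining density `𝐫` is strictly convex: on its tangent spaces, the Hessian
of the defining function `ρ = τ^{-2} 𝐫` is positive definite. (This does not depend on the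
scale.) -/
def IsStrictlyConvex (cov : AffineConn n N) (r : Density n N 2) : Prop :=
  ∀ τ : Density n N 1, IsScale τ → ∀ e ∈ smoothCharts (n + 1) N, ∀ x ∈ e.target,
    r.comp e x = 0 → ∀ v : Coord (n + 1), v ≠ 0 → fderiv ℝ (scaleFun τ r e) x v = 0 →
      0 < ∑ i, ∑ j, hess (scaleConn cov τ e) (scaleFun τ r e) x i j * v i * v j

/-- `𝐫` solves the Monge–Ampère equation approximately: along its zero set,
`𝒥[𝐫] = -1 + O(𝐫^∞)` if `n` is odd and `𝒥[𝐫] = -1 + O(𝐫^{n/2+1})` if `n` is even. (`𝒥[𝐫]` does not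
depend on the scale.) A defining density with this property is a Fefferman defining density. -/
def IsFefferman (cov : AffineConn n N) (r : Density n N 2) : Prop :=
  ∀ τ : Density n N 1, IsScale τ → ∀ e ∈ smoothCharts (n + 1) N, ∀ x ∈ e.target,
    r.comp e x = 0 → ∀ k : ℕ, (Even n → k ≤ n / 2 + 1) →
      (fun z => mongeAmpere (scaleConn cov τ e) (scaleVolume τ e) (scaleFun τ r e) z + 1)
        =O[𝓝 x] (fun z => scaleFun τ r e z ^ k)

variable {M : Type*} [TopologicalSpace M] [ChartedSpace (Coord n) M]

/-- The part of the range of a chart `c` of `M` on which `e ∘ ι ∘ c⁻¹` is defined. -/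
def patchDomain (ι : M → N) (e : OpenPartialHomeomorph N (Coord (n + 1)))
    (c : OpenPartialHomeomorph M (Coord n)) : Set (Coord n) :=
  {y | y ∈ c.target ∧ ι (c.symm y) ∈ e.source}

/-- The coordinate expressions of the projective structure `[∇]`, the density `𝐫` and the hypersurface
`ι : M → N` in the charts `e` and `c` and the scale `τ`, with a field `ξ` along `M`. -/
def localData (cov : AffineConn n N) (r : Density n N 2) (ι : M → N) (τ : Density n N 1)
    (e : OpenPartialHomeomorph N (Coord (n + 1))) (c : OpenPartialHomeomorph M (Coord n))
    (ξ : Coord n → Coord (n + 1)) : LocalData n where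
  Γ := scaleConn cov τ e
  vol := scaleVolume τ e
  ρ := scaleFun τ r e
  F := fun y => e (ι (c.symm y))
  ξ := ξ

end Manifold

end

end ConfCodazzi

open ConfCodazzi

namespace ConfCodazzi

noncomputable section

/-! ### Charts, coordinate fields and immersions. -/

section ManifoldFacts

variable {n : ℕ} {N : Type*} [TopologicalSpace N] [ChartedSpace (Coord (n + 1)) N]
  [IsManifold 𝓘(ℝ, Coord (n + 1)) ∞ N]

/-! Everything is read off from the tractor covariant derivative of `g̃ = D D 𝐫`. The form of the
operator `D` forces its components in the Euler direction to vanish, so it is a cubic form `C` on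
`TN` (`pd_preAmbient`). Along `M`, flatness makes `C` totally symmetric (`cubic_symm_left`), since
the curvature produced by commuting derivatives of `ρ` is exactly what the Schouten terms in `C`
compensate. The Monge–Ampère equation, used to second order in `ρ`, makes `C` trace-free for `g̃⁻¹`
(`sum_inv_mul_cubic`). Total symmetry collapses the Koszul formula, and along `M` the Levi-Civita
connection of `g̃` becomes `∇̃ = ∇^proj + ½ g̃⁻¹ C` (`ambientConn_succ_succ`, `amb_ambientConnM`).

Because the Monge–Ampère determinant equals `-1` on `M`, the affine normal is characterized by
`dρ(ξ) = 1` and `Hess ρ (TM, ξ) = 0`; this yields existence, and `h` is the Hessian of `ρ` on `TM`.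
Differentiating the values of `Hess ρ` in the frame `∂₁F, …, ∂ₙF, ξ` gives the components of `C`:
they are `2A`, then `P + Hess ρ(ξ,ξ) h - S`, then `2 P(·,ξ) + d(Hess ρ(ξ,ξ))`. Trace-freeness of `C`
says that `A` is trace-free and that `n Hess ρ(ξ,ξ) = tr S - tr P`.

The Gauss equation for `∇^ξ`, compared with the curvature of `∇^h = ∇^ξ + A`, expresses `δA` and
`Ric^h` through `S`, `P` and `A` (`divA_eq`, `ricci_connH`). Hence `J' = ½ (tr S + tr P)` and `(tr S
- J')/n = ½ Hess ρ(ξ,ξ)` (`c_eq`): the correction term in `Φ` makes the image of `(1, 0, 0)` null,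
and `Φ` is an isometry (`amb_Phi`).

The formula `∇^proj = ∇ - Ã` under `Φ` is then the Gauss and Weingarten formulas (`projConn_Phi`).
Pulled back by `Φ`, the form `C` has the blocks `2A`, `E + G`, `2F`, that is, twice the symmetric
part of `Ã`; adding half of `C` to `∇ - Ã` therefore leaves `∇ - Ã''` (`ambientConnM_Phi`). Finally
`Ã''` is made of `E - G = 2P^h - S - P`, in which `S` and `P` cancel. What remains is quadratic in
`A`, with trace a positive multiple of `|A|²`, so it vanishes exactly when `A` does. -/

lemma smoothCharts_contMDiffAt {m : ℕ} {N : Type*} [TopologicalSpace N] [ChartedSpace (Coord m) N]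
    [IsManifold 𝓘(ℝ, Coord m) ∞ N]
    {e : OpenPartialHomeomorph N (Coord m)} (he : e ∈ smoothCharts m N)
    {p : N} (hp : p ∈ e.source) :
    ContMDiffAt 𝓘(ℝ, Coord m) 𝓘(ℝ, Coord m) ∞ e p :=
  contMDiffAt_of_mem_maximalAtlas he hp

lemma smoothCharts_mdifferentiable {m : ℕ} {N : Type*} [TopologicalSpace N]
    [ChartedSpace (Coord m) N] [IsManifold 𝓘(ℝ, Coord m) ∞ N]
    {e : OpenPartialHomeomorph N (Coord m)} (he : e ∈ smoothCharts m N) :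
    e.MDifferentiable 𝓘(ℝ, Coord m) 𝓘(ℝ, Coord m) :=
  ⟨(contMDiffOn_of_mem_maximalAtlas he).mdifferentiableOn (by simp),
    (contMDiffOn_symm_of_mem_maximalAtlas he).mdifferentiableOn (by simp)⟩

lemma coordField_contMDiffAt {e : OpenPartialHomeomorph N (Coord (n + 1))}
    (he : e ∈ smoothCharts (n + 1) N) (j : Fin (n + 1)) {p : N} (hp : p ∈ e.source) :
    ContMDiffAt 𝓘(ℝ, Coord (n + 1)) (𝓘(ℝ, Coord (n + 1)).prod 𝓘(ℝ, Coord (n + 1))) ∞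
      (fun q => (⟨q, coordField e j q⟩ : TangentBundle 𝓘(ℝ, Coord (n + 1)) N)) p := by
  have hm := smoothCharts_mdifferentiable he
  refine ContMDiffAt.mpullback_vectorField_preimage (n := ∞) ?_
    (smoothCharts_contMDiffAt he hp) ?_ (by simp)
  · exact contMDiffAt_vectorSpace_iff_contDiffAt.2 contDiffAt_const
  · exact ⟨hm.mfderiv hp, rfl⟩

/-- Smoothness of a covariant derivative is a statement about global sections, whereas `∂ⱼ` lives on
one chart. A bump function that is `1` near the point extends it, and locality of the connection
shows that nothing changes there. -/
lemma christoffel_contDiffOn [T2Space N] (cov : AffineConn n N)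
    [CovariantDerivative.ContMDiffCovariantDerivative cov ∞]
    {e : OpenPartialHomeomorph N (Coord (n + 1))} (he : e ∈ smoothCharts (n + 1) N)
    (i j k : Fin (n + 1)) :
    ContDiffOn ℝ ∞ (fun x => christoffel cov e x i j k) e.target := by
  intro x hx
  refine ContDiffAt.contDiffWithinAt ?_
  have hm := smoothCharts_mdifferentiable he
  set p := e.symm x with hp
  have hps : p ∈ e.source := e.map_target hx
  obtain ⟨χ, -, hχ⟩ := (SmoothBumpFunction.nhds_basis_tsupport (I := 𝓘(ℝ, Coord (n + 1))) p).mem_iff.1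
    (e.open_source.mem_nhds hps)
  have hσ : ContMDiff 𝓘(ℝ, Coord (n + 1)) (𝓘(ℝ, Coord (n + 1)).prod 𝓘(ℝ, Coord (n + 1))) ∞
      (fun q => (⟨q, ((χ : N → ℝ) • coordField e j) q⟩ : TangentBundle 𝓘(ℝ, Coord (n + 1)) N)) :=
    ContMDiffOn.smul_section_of_tsupport χ.contMDiff.contMDiffOn e.open_source hχ
      fun q hq => (coordField_contMDiffAt he j hq).contMDiffWithinAt
  have hcov := (CovariantDerivative.ContMDiffCovariantDerivative.contMDiff (cov := cov)
    (k := ∞)).contMDiff (σ := (χ : N → ℝ) • coordField e j) hσ.contMDiffOn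
  have hcov' := (hcov p (Set.mem_univ _)).contMDiffAt Filter.univ_mem
  have hs := ContMDiffAt.clm_bundle_apply hcov' (coordField_contMDiffAt he i hps)
  let v : Coord (n + 1) → Coord (n + 1) :=
    VectorField.mpullback 𝓘(ℝ, Coord (n + 1)) 𝓘(ℝ, Coord (n + 1))
      e.symm (fun q => cov.toFun ((χ : N → ℝ) • coordField e j) q (coordField e i q))
  have hV : ContDiffAt ℝ ∞ v x := by
    refine contMDiffAt_vectorSpace_iff_contDiffAt.1 ?_
    refine ContMDiffAt.mpullback_vectorField_preimage (n := ∞) hs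
      (contMDiffAt_symm_of_mem_maximalAtlas he hx) ?_ (by simp)
    exact ⟨hm.symm.mfderiv hx, rfl⟩
  have hk : ContDiffAt ℝ ∞ (fun z => v z k) x :=
    (contDiff_euclidean.1 contDiff_id k).contDiffAt.comp x hV
  refine hk.congr_of_eventuallyEq ?_
  have hev : ∀ᶠ z in 𝓝 x, z ∈ e.target ∧ (χ : N → ℝ) =ᶠ[𝓝 (e.symm z)] 1 := by
    refine Filter.Eventually.and (e.open_target.mem_nhds hx) ?_
    exact (e.symm.continuousAt hx).eventually (eventually_eventuallyEq_nhds.2 χ.eventuallyEq_one)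
  filter_upwards [hev] with z hz
  obtain ⟨hz, hz1⟩ := hz
  have hzs : e.symm z ∈ e.source := e.map_target hz
  have h1 : cov.toFun (coordField e j) (e.symm z)
      = cov.toFun ((χ : N → ℝ) • coordField e j) (e.symm z) := by
    refine cov.isCovariantDerivativeOnUniv.congr_of_eventuallyEq
      ((coordField_contMDiffAt he j hzs).mdifferentiableAt (by simp))
      (hσ.mdifferentiableAt (by simp)) Filter.univ_mem ?_
    filter_upwards [hz1] with q hq
    simp [hq]
  -- The pullback of a vector field along `e.symm` involves the inverse of its differential, which
  -- is the differential of `e` appearing in `christoffel`.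
  have h2 : (mfderiv 𝓘(ℝ, Coord (n + 1)) 𝓘(ℝ, Coord (n + 1)) e.symm z).inverse
      = mfderiv 𝓘(ℝ, Coord (n + 1)) 𝓘(ℝ, Coord (n + 1)) e (e.symm z) := by
    refine ContinuousLinearMap.inverse_eq ?_ ?_
    · have h := hm.symm_comp_deriv hzs
      rwa [e.right_inv hz] at h
    · exact hm.symm.symm_comp_deriv hz
  simp only [christoffel, v, VectorField.mpullback_apply, h1, h2]
  rfl

/-- Without torsion, the skew part of `∇_{∂ᵢ} ∂ⱼ` is the bracket `[∂ᵢ, ∂ⱼ]`. It vanishes because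
coordinate fields are pullbacks of constant fields and pullback commutes with brackets. -/
lemma christoffel_symm (cov : AffineConn n N) (htor : cov.torsion = 0)
    {e : OpenPartialHomeomorph N (Coord (n + 1))} (he : e ∈ smoothCharts (n + 1) N)
    {x : Coord (n + 1)} (hx : x ∈ e.target) (i j k : Fin (n + 1)) :
    christoffel cov e x i j k = christoffel cov e x j i k := by
  have hps : e.symm x ∈ e.source := e.map_target hx
  have hd : ∀ j, MDifferentiableAt 𝓘(ℝ, Coord (n + 1)) (𝓘(ℝ, Coord (n + 1)).prod 𝓘(ℝ, Coord (n + 1)))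
      (fun q => (⟨q, coordField e j q⟩ : TangentBundle 𝓘(ℝ, Coord (n + 1)) N)) (e.symm x) :=
    fun j => (coordField_contMDiffAt he j hps).mdifferentiableAt (by simp)
  have h := (CovariantDerivative.torsion_eq_zero_iff cov).1 htor (hd i) (hd j)
  have hb : VectorField.mlieBracket 𝓘(ℝ, Coord (n + 1)) (coordField e i) (coordField e j) (e.symm x)
      = 0 := by
    have h2 : minSmoothness ℝ 2 ≤ (∞ : WithTop ℕ∞) := by
      rw [minSmoothness_of_isRCLikeNormedField]
      exact ENat.LEInfty.out
    have : IsManifold 𝓘(ℝ, Coord (n + 1)) (minSmoothness ℝ 2) N := IsManifold.of_le h2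
    let V : Fin (n + 1) → (x : Coord (n + 1)) → TangentSpace 𝓘(ℝ, Coord (n + 1)) x :=
      fun l _ => (EuclideanSpace.single l 1 : Coord (n + 1))
    have hV : ∀ l, ContMDiffAt 𝓘(ℝ, Coord (n + 1))
        (𝓘(ℝ, Coord (n + 1)).prod 𝓘(ℝ, Coord (n + 1))) ∞
        (fun z => (⟨z, V l z⟩ : TangentBundle 𝓘(ℝ, Coord (n + 1)) (Coord (n + 1))))
        (e (e.symm x)) :=
      fun l => contMDiffAt_vectorSpace_iff_contDiffAt.2 contDiffAt_const
    have := VectorField.mpullback_mlieBracket (n := ∞) ((hV i).mdifferentiableAt (by simp))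
      ((hV j).mdifferentiableAt (by simp)) (smoothCharts_contMDiffAt he hps) h2
    refine this.symm.trans ?_
    rw [VectorField.mpullback_apply]
    have h0 : VectorField.mlieBracket 𝓘(ℝ, Coord (n + 1)) (V i) (V j) (e (e.symm x)) = 0 := by
      rw [← VectorField.mlieBracketWithin_univ, VectorField.mlieBracketWithin_eq_lieBracketWithin]
      simp [VectorField.lieBracketWithin, V]
      rfl
    rw [h0, map_zero]
  rw [hb, sub_eq_zero] at h
  simp only [christoffel]
  have := congrArg (mfderiv 𝓘(ℝ, Coord (n + 1)) 𝓘(ℝ, Coord (n + 1)) e (e.symm x)) h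
  exact congrArg (fun v : Coord (n + 1) => v k) this

/-- In the charts adapted to the immersion, `ι` is a linear inclusion with a complement. Projecting
the complement away gives a smooth local left inverse `ℓ` of `e ∘ ι ∘ c⁻¹`, and the chain rule turns
it into a left inverse of the differential. -/
lemma injective_fderiv_of_isImmersion {m : ℕ} {M : Type*} [TopologicalSpace M]
    [ChartedSpace (Coord m) M] [IsManifold 𝓘(ℝ, Coord m) ∞ M]
    {ι : M → N} (hι : Manifold.IsImmersion 𝓘(ℝ, Coord m) 𝓘(ℝ, Coord (n + 1)) ∞ ι)
    {e : OpenPartialHomeomorph N (Coord (n + 1))} (he : e ∈ smoothCharts (n + 1) N)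
    {c : OpenPartialHomeomorph M (Coord m)} (hc : c ∈ smoothCharts m M)
    {y : Coord m} (hy : y ∈ c.target) (hye : ι (c.symm y) ∈ e.source) :
    ContDiffAt ℝ ∞ (fun y => e (ι (c.symm y))) y ∧
      Function.Injective (fderiv ℝ (fun y => e (ι (c.symm y))) y) := by
  have hcs : ContMDiffAt 𝓘(ℝ, Coord m) 𝓘(ℝ, Coord m) ∞ c.symm y :=
    contMDiffAt_symm_of_mem_maximalAtlas hc hy
  have hιc : ContMDiffAt 𝓘(ℝ, Coord m) 𝓘(ℝ, Coord (n + 1)) ∞ (ι ∘ c.symm) y :=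
    (hι.contMDiff _).comp _ hcs
  have hF : ContDiffAt ℝ ∞ (fun y => e (ι (c.symm y))) y :=
    contMDiffAt_iff_contDiffAt.1
      (ContMDiffAt.comp (g := e) (f := ι ∘ c.symm) y (smoothCharts_contMDiffAt he hye) hιc)
  refine ⟨hF, ?_⟩
  obtain ⟨K, _, _, hK⟩ := hι
  obtain ⟨φ, ψ, L, hφs, hψs, hφ, hψ, hw⟩ : ∃ (φ : OpenPartialHomeomorph M (Coord m))
      (ψ : OpenPartialHomeomorph N (Coord (n + 1))) (L : (Coord m × K) ≃L[ℝ] Coord (n + 1)),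
      c.symm y ∈ φ.source ∧ ι (c.symm y) ∈ ψ.source ∧ φ ∈ smoothCharts m M ∧
      ψ ∈ smoothCharts (n + 1) N ∧
      ∀ p ∈ φ.source, ψ (ι p) = L (φ p, 0) := by
    have hK := hK (c.symm y)
    refine ⟨hK.domChart, hK.codChart, hK.equiv, hK.mem_domChart_source, hK.mem_codChart_source,
      hK.domChart_mem_maximalAtlas, hK.codChart_mem_maximalAtlas, fun p hp => ?_⟩
    have hw := hK.writtenInCharts
      (show hK.domChart p ∈ (hK.domChart.extend 𝓘(ℝ, Coord m)).target by
        simpa using hK.domChart.map_source hp)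
    simpa [hK.domChart.left_inv hp] using hw
  let ℓ : Coord (n + 1) → Coord m := fun x =>
    c (φ.symm (L.symm (ψ (e.symm x))).1)
  have hcomp : ∀ᶠ z in 𝓝 y, ℓ (e (ι (c.symm z))) = z := by
    have h1 := (c.symm.continuousAt hy).preimage_mem_nhds (φ.open_source.mem_nhds hφs)
    have h2 := hιc.continuousAt.preimage_mem_nhds (e.open_source.mem_nhds hye)
    filter_upwards [h1, h2, c.open_target.mem_nhds hy] with z hz1 hz2 hz
    have hz2' : e.symm (e (ι (c.symm z))) = ι (c.symm z) := e.left_inv hz2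
    simp only [ℓ, hz2', hw _ hz1, ContinuousLinearEquiv.symm_apply_apply]
    rw [φ.left_inv hz1, c.right_inv hz]
  have hwy : L.symm (ψ (ι (c.symm y))) = (φ (c.symm y), 0) := by
    rw [ContinuousLinearEquiv.symm_apply_eq, hw _ hφs]
  have hℓ : DifferentiableAt ℝ ℓ (e (ι (c.symm y))) := by
    have a1 : ContMDiffAt 𝓘(ℝ, Coord (n + 1)) 𝓘(ℝ, Coord (n + 1)) ∞ (ψ ∘ e.symm)
        (e (ι (c.symm y))) := by
      refine ContMDiffAt.comp _ ?_ (contMDiffAt_symm_of_mem_maximalAtlas he (e.map_source hye))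
      rw [e.left_inv hye]
      exact contMDiffAt_of_mem_maximalAtlas hψ hψs
    have a2 : ContMDiffAt 𝓘(ℝ, Coord m) 𝓘(ℝ, Coord m) ∞ (c ∘ φ.symm) (φ (c.symm y)) := by
      refine ContMDiffAt.comp _ ?_ (contMDiffAt_symm_of_mem_maximalAtlas hφ
        (φ.map_source hφs))
      rw [φ.left_inv hφs]
      exact contMDiffAt_of_mem_maximalAtlas hc (c.map_target hy)
    have b1 := (contMDiffAt_iff_contDiffAt.1 a1).differentiableAt (by simp)
    have b2 := (contMDiffAt_iff_contDiffAt.1 a2).differentiableAt (by simp)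
    have b3 : DifferentiableAt ℝ (fun x => (L.symm (ψ (e.symm x))).1)
        (e (ι (c.symm y))) :=
      (L.symm.differentiableAt.comp _ b1).fst
    have b4 : (L.symm (ψ (e.symm (e (ι (c.symm y)))))).1 = φ (c.symm y) := by
      simp [e.left_inv hye, hwy]
    exact DifferentiableAt.comp (g := c ∘ φ.symm) _ (b4.symm ▸ b2) b3
  have hd := hF.differentiableAt (by simp)
  have hid : (fderiv ℝ ℓ (e (ι (c.symm y)))).comp (fderiv ℝ (fun y => e (ι (c.symm y))) y)
      = ContinuousLinearMap.id ℝ _ := by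
    rw [← fderiv_comp y hℓ hd]
    have : (ℓ ∘ fun y => e (ι (c.symm y))) =ᶠ[𝓝 y] id := hcomp
    rw [this.fderiv_eq, fderiv_id]
  intro u v huv
  have hu := congrArg (fun L => L u) hid
  have hv := congrArg (fun L => L v) hid
  simp only [ContinuousLinearMap.comp_apply, ContinuousLinearMap.id_apply] at hu hv
  rw [← hu, ← hv, huv]

end ManifoldFacts

/-! ### Calculus of partial derivatives and determinants. -/

section PartialDerivatives

variable {m : ℕ} {f g : Coord m → ℝ} {x : Coord m} {U : Set (Coord m)}

lemma pd_add (i : Fin m) (hf : DifferentiableAt ℝ f x) (hg : DifferentiableAt ℝ g x) :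
    pd i (fun z => f z + g z) x = pd i f x + pd i g x := by
  simp only [pd, fderiv_fun_add hf hg, add_apply]

lemma pd_sub (i : Fin m) (hf : DifferentiableAt ℝ f x) (hg : DifferentiableAt ℝ g x) :
    pd i (fun z => f z - g z) x = pd i f x - pd i g x := by
  simp only [pd, fderiv_fun_sub hf hg, sub_apply]

lemma pd_neg (i : Fin m) : pd i (fun z => -f z) x = -pd i f x := by
  simp only [pd, fderiv_fun_neg, neg_apply]

lemma pd_mul (i : Fin m) (hf : DifferentiableAt ℝ f x) (hg : DifferentiableAt ℝ g x) :
    pd i (fun z => f z * g z) x = pd i f x * g x + f x * pd i g x := by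
  simp only [pd, fderiv_fun_mul hf hg, add_apply,
    smul_apply, smul_eq_mul]
  ring

lemma pd_const_mul (i : Fin m) (a : ℝ) (hf : DifferentiableAt ℝ f x) :
    pd i (fun z => a * f z) x = a * pd i f x := by
  simp only [pd, fderiv_const_mul hf, smul_apply, smul_eq_mul]

lemma pd_const {G : Type*} [NormedAddCommGroup G] [NormedSpace ℝ G] (i : Fin m) (a : G) :
    pd i (fun _ : Coord m => a) x = 0 := by
  simp [pd]

lemma pd_sum (i : Fin m) {ι : Type*} (s : Finset ι) {f : ι → Coord m → ℝ}
    (hf : ∀ a ∈ s, DifferentiableAt ℝ (f a) x) :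
    pd i (fun z => ∑ a ∈ s, f a z) x = ∑ a ∈ s, pd i (f a) x := by
  simp only [pd, fderiv_fun_sum hf, sum_apply]

lemma pd_congr {G : Type*} [NormedAddCommGroup G] [NormedSpace ℝ G] {f g : Coord m → G} (i : Fin m)
    (h : f =ᶠ[𝓝 x] g) : pd i f x = pd i g x := by
  simp only [pd, h.fderiv_eq]

lemma pd_congr_of_isOpen {G : Type*} [NormedAddCommGroup G] [NormedSpace ℝ G] {f g : Coord m → G}
    (i : Fin m) (hU : IsOpen U) (hx : x ∈ U) (h : ∀ z ∈ U, f z = g z) : pd i f x = pd i g x :=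
  pd_congr i (Filter.eventuallyEq_of_mem (hU.mem_nhds hx) h)

lemma pd_euclidean {k : ℕ} (i : Fin m) {F : Coord m → Coord k} (hF : DifferentiableAt ℝ F x)
    (j : Fin k) : (pd i F x) j = pd i (fun z => F z j) x := by
  have h := ((EuclideanSpace.proj (𝕜 := ℝ) j).hasFDerivAt.comp x hF.hasFDerivAt).fderiv
  have h' : fderiv ℝ (fun z => F z j) x = (EuclideanSpace.proj (𝕜 := ℝ) j).comp (fderiv ℝ F x) := h
  simp [pd, h']

lemma fderiv_eq_sum_pd {G : Type*} [NormedAddCommGroup G] [NormedSpace ℝ G] (f : Coord m → G)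
    (x w : Coord m) : fderiv ℝ f x w = ∑ i, w i • pd i f x := by
  have hw : w = ∑ i, w i • (EuclideanSpace.single i (1 : ℝ) : Coord m) := by
    ext j
    simp [Finset.sum_apply, Pi.single_apply]
  conv_lhs => rw [hw]
  simp [pd]

lemma pd_comp {k : ℕ} (i : Fin m) {f : Coord k → ℝ} {F : Coord m → Coord k}
    (hf : DifferentiableAt ℝ f (F x)) (hF : DifferentiableAt ℝ F x) :
    pd i (fun z => f (F z)) x = ∑ j, (pd i F x) j * pd j f (F x) := by
  have h : fderiv ℝ (fun z => f (F z)) x = (fderiv ℝ f (F x)).comp (fderiv ℝ F x) :=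
    fderiv_comp x hf hF
  simp only [pd, h, ContinuousLinearMap.comp_apply]
  rw [fderiv_eq_sum_pd]
  simp [pd]

lemma _root_.ContDiffOn.pd {G : Type*} [NormedAddCommGroup G] [NormedSpace ℝ G] {f : Coord m → G}
    (hf : ContDiffOn ℝ ∞ f U) (hU : IsOpen U) (i : Fin m) : ContDiffOn ℝ ∞ (pd i f) U :=
  (hf.fderiv_of_isOpen hU (m := ∞) (by simp)).clm_apply contDiffOn_const

lemma _root_.ContDiffOn.diffAt {G : Type*} [NormedAddCommGroup G] [NormedSpace ℝ G]
    {f : Coord m → G} (hf : ContDiffOn ℝ ∞ f U) (hU : IsOpen U) (hx : x ∈ U) :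
    DifferentiableAt ℝ f x :=
  (hf.contDiffAt (hU.mem_nhds hx)).differentiableAt (by simp)

lemma pd_comm {G : Type*} [NormedAddCommGroup G] [NormedSpace ℝ G] {f : Coord m → G}
    (hf : ContDiffOn ℝ ∞ f U) (hU : IsOpen U) (hx : x ∈ U) (i j : Fin m) :
    pd i (pd j f) x = pd j (pd i f) x := by
  have hd : DifferentiableAt ℝ (fderiv ℝ f) x :=
    (hf.fderiv_of_isOpen hU (m := ∞) (by simp)).diffAt hU hx
  have h : ∀ i j : Fin m, pd i (pd j f) x
      = fderiv ℝ (fderiv ℝ f) x (EuclideanSpace.single i 1) (EuclideanSpace.single j 1) := by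
    intro i j
    have := (hd.hasFDerivAt.clm_apply (hasFDerivAt_const (EuclideanSpace.single j (1 : ℝ)) x)).fderiv
    change fderiv ℝ (fun z => fderiv ℝ f z (EuclideanSpace.single j 1)) x _ = _
    rw [this]
    simp
  rw [h, h]
  have hs : IsSymmSndFDerivAt ℝ f x := by
    refine (hf.contDiffAt (hU.mem_nhds hx)).isSymmSndFDerivAt ?_
    rw [minSmoothness_of_isRCLikeNormedField]
    exact ENat.LEInfty.out
  exact hs _ _

lemma contDiffOn_euclidean_apply {k : ℕ} {F : Coord m → Coord k} (hF : ContDiffOn ℝ ∞ F U)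
    (j : Fin k) : ContDiffOn ℝ ∞ (fun z => F z j) U :=
  (contDiffOn_euclidean.1 hF) j

lemma contDiffOn_matrix_det {ι : Type*} [Fintype ι] [DecidableEq ι]
    {B : Coord m → Matrix ι ι ℝ} (hB : ∀ i j, ContDiffOn ℝ ∞ (fun z => B z i j) U) :
    ContDiffOn ℝ ∞ (fun z => (B z).det) U := by
  simp only [Matrix.det_apply]
  refine ContDiffOn.sum fun σ _ => ?_
  refine ContDiffOn.const_smul _ ?_
  exact contDiffOn_prod fun i _ => hB _ _

lemma contDiffOn_matrix_inv {ι : Type*} [Fintype ι] [DecidableEq ι]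
    {B : Coord m → Matrix ι ι ℝ} (hB : ∀ i j, ContDiffOn ℝ ∞ (fun z => B z i j) U)
    (hdet : ∀ z ∈ U, IsUnit (B z).det) (i j : ι) :
    ContDiffOn ℝ ∞ (fun z => (B z)⁻¹ i j) U := by
  have h : ∀ z, (B z)⁻¹ i j = ((B z).det)⁻¹ * ((B z).updateRow j (Pi.single i 1)).det := by
    intro z
    rw [Matrix.inv_def, Ring.inverse_eq_inv', Matrix.smul_apply, Matrix.adjugate_apply, smul_eq_mul]
  simp only [h]
  refine ContDiffOn.mul ((contDiffOn_matrix_det hB).inv fun z hz => (hdet z hz).ne_zero) ?_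
  refine contDiffOn_matrix_det fun k l => ?_
  by_cases hk : k = j
  · simp only [Matrix.updateRow_apply, hk, if_true]
    exact contDiffOn_const
  · simp only [Matrix.updateRow_apply, hk, if_false]
    exact hB k l

/-- Jacobi's formula. The derivative of the Leibniz expansion is a sum over the differentiated
column, and each summand is the determinant with that column replaced. -/
lemma pd_matrix_det {ι : Type*} [Fintype ι] [DecidableEq ι] {B : Coord m → Matrix ι ι ℝ}
    (hB : ∀ i j, DifferentiableAt ℝ (fun z => B z i j) x) (hdet : IsUnit (B x).det) (i : Fin m) :
    pd i (fun z => (B z).det) x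
      = (B x).det * ∑ k, ∑ l, (B x)⁻¹ k l * pd i (fun z => B z l k) x := by
  have hp : ∀ σ : Equiv.Perm ι, HasFDerivAt (fun z => ∏ k, B z (σ k) k)
      (∑ k, (∏ l ∈ Finset.univ.erase k, B x (σ l) l) • fderiv ℝ (fun z => B z (σ k) k) x) x := by
    intro σ
    exact HasFDerivAt.finsetProd fun k _ => (hB _ _).hasFDerivAt
  have hd : HasFDerivAt (fun z => (B z).det) (∑ σ : Equiv.Perm ι, Equiv.Perm.sign σ •
      ∑ k, (∏ l ∈ Finset.univ.erase k, B x (σ l) l) • fderiv ℝ (fun z => B z (σ k) k) x) x := by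
    simp only [Matrix.det_apply]
    exact HasFDerivAt.fun_sum fun σ _ => (hp σ).const_smul _
  -- Cramer's rule for a determinant with one column replaced.
  have hcol : ∀ (k : ι) (v : ι → ℝ), ((B x).updateCol k v).det
      = (B x).det * ∑ l, (B x)⁻¹ k l * v l := by
    intro k v
    rw [← Matrix.cramer_apply, Matrix.cramer_eq_adjugate_mulVec, Matrix.inv_def,
      Ring.inverse_eq_inv', Matrix.mulVec, dotProduct, Finset.mul_sum]
    refine Finset.sum_congr rfl fun l _ => ?_
    rw [Matrix.smul_apply, smul_eq_mul, ← mul_assoc, ← mul_assoc, mul_inv_cancel₀ hdet.ne_zero,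
      one_mul]
  rw [Finset.mul_sum]
  have hr : ∀ k, (B x).det * ∑ l, (B x)⁻¹ k l * pd i (fun z => B z l k) x
      = ((B x).updateCol k fun l => pd i (fun z => B z l k) x).det := fun k => (hcol k _).symm
  simp only [hr]
  simp only [Matrix.det_apply ((B x).updateCol _ _)]
  rw [Finset.sum_comm]
  simp only [pd, hd.fderiv, sum_apply, smul_apply]
  refine Finset.sum_congr rfl fun σ _ => ?_
  rw [Finset.smul_sum]
  refine Finset.sum_congr rfl fun k _ => ?_
  congr 1
  rw [← Finset.mul_prod_erase _ _ (Finset.mem_univ k), smul_eq_mul, mul_comm]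
  congr 1
  · simp
  · refine Finset.prod_congr rfl fun l hl => ?_
    rw [Matrix.updateCol_ne (Finset.ne_of_mem_erase hl)]

end PartialDerivatives

/-! ### The tractor derivative of `D D 𝐫` in a flat projective scale. -/

section ProjectiveScale

/-- In a chart, a flat projective structure with a scale: the coefficients `Γ` of the torsion-free
representative that preserves the volume density `vol`, smooth on the open set `U`. -/
structure IsFlatScale {n : ℕ} (Γ : Coeffs (n + 1)) (vol : Coord (n + 1) → ℝ)
    (U : Set (Coord (n + 1))) : Prop where
  isOpen : IsOpen U
  contDiffOn_coeff : ∀ i j k, ContDiffOn ℝ ∞ (fun x => Γ x i j k) U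
  symm : ∀ x ∈ U, ∀ i j k, Γ x i j k = Γ x j i k
  contDiffOn_vol : ContDiffOn ℝ ∞ vol U
  vol_pos : ∀ x ∈ U, 0 < vol x
  pd_vol : ∀ x ∈ U, ∀ i, pd i vol x = (∑ l, Γ x i l l) * vol x
  weyl : ∀ x ∈ U, ∀ i j k l, projWeyl Γ x i j k l = 0

lemma contDiffOn_curv {m : ℕ} {Γ : Coeffs m} {U : Set (Coord m)} (hU : IsOpen U)
    (hΓ : ∀ i j k, ContDiffOn ℝ ∞ (fun x => Γ x i j k) U) (i j k l : Fin m) :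
    ContDiffOn ℝ ∞ (fun x => curv Γ x i j k l) U := by
  unfold curv
  refine (((hΓ _ _ _).pd hU i).sub ((hΓ _ _ _).pd hU j)).add ?_
  exact ContDiffOn.sum fun q _ => ((hΓ _ _ _).mul (hΓ _ _ _)).sub ((hΓ _ _ _).mul (hΓ _ _ _))

namespace IsFlatScale

variable {n : ℕ} {Γ : Coeffs (n + 1)} {vol : Coord (n + 1) → ℝ} {U : Set (Coord (n + 1))}
  (hS : IsFlatScale Γ vol U) {x : Coord (n + 1)} {ρ : Coord (n + 1) → ℝ}
include hS

lemma trace_eq (hx : x ∈ U) (i : Fin (n + 1)) :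
    ∑ l, Γ x i l l = pd i (fun z => Real.log (vol z)) x := by
  have h : HasFDerivAt (fun z => Real.log (vol z)) ((vol x)⁻¹ • fderiv ℝ vol x) x :=
    (hS.contDiffOn_vol.diffAt hS.isOpen hx).hasFDerivAt.log (hS.vol_pos x hx).ne'
  have h2 := hS.pd_vol x hx i
  have h3 := (hS.vol_pos x hx).ne'
  simp only [pd, h.fderiv, smul_apply, smul_eq_mul] at h2 ⊢
  rw [h2]
  field_simp

/-- The skew part of the Ricci tensor of a torsion-free connection is, up to sign, the exterior
derivative of the trace `Γ_{il}^l`. A parallel volume makes that trace the exact form `d log vol`.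
-/
lemma ricci_symm (hx : x ∈ U) (j l : Fin (n + 1)) : ricci Γ x j l = ricci Γ x l j := by
  have hlog : ContDiffOn ℝ ∞ (fun z => Real.log (vol z)) U :=
    hS.contDiffOn_vol.log fun z hz => (hS.vol_pos z hz).ne'
  have htr : ∀ j l, ∑ i, pd j (fun z => Γ z i l i) x
      = pd j (pd l (fun z => Real.log (vol z))) x := by
    intro j l
    rw [← pd_sum j Finset.univ fun i _ => (hS.contDiffOn_coeff i l i).diffAt hS.isOpen hx]
    refine pd_congr_of_isOpen j hS.isOpen hx fun z hz => ?_
    rw [← hS.trace_eq hz]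
    exact Finset.sum_congr rfl fun i _ => hS.symm z hz i l i
  have h1 : ∑ i, pd i (fun z => Γ z j l i) x = ∑ i, pd i (fun z => Γ z l j i) x :=
    Finset.sum_congr rfl fun i _ => pd_congr_of_isOpen i hS.isOpen hx fun z hz => hS.symm z hz j l i
  have h2 : ∑ i, ∑ q, Γ x i q i * Γ x j l q = ∑ i, ∑ q, Γ x i q i * Γ x l j q := by
    simp only [hS.symm x hx j l]
  have h3 : ∑ i, ∑ q, Γ x j q i * Γ x i l q = ∑ i, ∑ q, Γ x l q i * Γ x i j q := by
    rw [Finset.sum_comm]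
    refine Finset.sum_congr rfl fun q _ => Finset.sum_congr rfl fun i _ => ?_
    rw [hS.symm x hx j q, hS.symm x hx i l, mul_comm]
  have h4 := pd_comm hlog hS.isOpen hx j l
  simp only [ricci, curv, Finset.sum_add_distrib, Finset.sum_sub_distrib, htr]
  linarith

lemma projSchouten_symm (hx : x ∈ U) (j l : Fin (n + 1)) :
    projSchouten Γ x j l = projSchouten Γ x l j := by
  simp only [projSchouten, hS.ricci_symm hx j l]

lemma curv_eq (hx : x ∈ U) (i j k l : Fin (n + 1)) :
    curv Γ x i j k l = (if i = k then projSchouten Γ x j l else 0)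
      - (if j = k then projSchouten Γ x i l else 0) := by
  have := hS.weyl x hx i j k l
  simp only [projWeyl] at this
  linarith

lemma contDiffOn_projSchouten (i j : Fin (n + 1)) :
    ContDiffOn ℝ ∞ (fun x => projSchouten Γ x i j) U := by
  simp only [projSchouten, ricci]
  refine ContDiffOn.div_const ?_ _
  exact ContDiffOn.sum fun k _ => contDiffOn_curv hS.isOpen hS.contDiffOn_coeff _ _ _ _

lemma hess_symm (hρ : ContDiffOn ℝ ∞ ρ U) (hx : x ∈ U) (i j : Fin (n + 1)) :
    hess Γ ρ x i j = hess Γ ρ x j i := by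
  simp only [hess, pd_comm hρ hS.isOpen hx i j, hS.symm x hx i j]

lemma contDiffOn_hess (hρ : ContDiffOn ℝ ∞ ρ U) (i j : Fin (n + 1)) :
    ContDiffOn ℝ ∞ (fun x => hess Γ ρ x i j) U := by
  unfold hess
  refine ((hρ.pd hS.isOpen j).pd hS.isOpen i).sub (ContDiffOn.sum fun k _ => ?_)
  exact (hS.contDiffOn_coeff i j k).mul (hρ.pd hS.isOpen k)

end IsFlatScale

variable {n : ℕ} (Γ : Coeffs (n + 1)) (ρ : Coord (n + 1) → ℝ) (x : Coord (n + 1))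

lemma preAmbient_zero_zero : preAmbient Γ ρ x 0 0 = 2 * ρ x := by
  simp [preAmbient, tractorDCotractor, tractorD]

lemma preAmbient_zero_succ (j : Fin (n + 1)) : preAmbient Γ ρ x 0 j.succ = pd j ρ x := by
  simp [preAmbient, tractorDCotractor, tractorD]

variable {Γ ρ x} in
lemma preAmbient_succ_zero (hρ : DifferentiableAt ℝ ρ x) (i : Fin (n + 1)) :
    preAmbient Γ ρ x i.succ 0 = pd i ρ x := by
  simp only [preAmbient, tractorDCotractor, tractorD, cotractorConn, Matrix.of_apply,
    Matrix.cons_val_zero, Matrix.cons_val_succ, pd_const_mul i 2 hρ]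
  ring

lemma preAmbient_succ_succ (i j : Fin (n + 1)) :
    preAmbient Γ ρ x i.succ j.succ = hess Γ ρ x i j + 2 * ρ x * projSchouten Γ x i j := by
  simp only [preAmbient, tractorDCotractor, tractorD, cotractorConn, Matrix.of_apply,
    Matrix.cons_val_zero, Matrix.cons_val_succ, hess]
  ring

/-- The matrix of the tractor connection: `∇ᵢ u = ∂ᵢ u + Ωᵢ u` on tractors. -/
def tractorMatrix (i : Fin (n + 1)) : Matrix (Fin (n + 2)) (Fin (n + 2)) ℝ :=
  Matrix.of (Matrix.vecCons (Matrix.vecCons 0 fun j => -projSchouten Γ x i j)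
    fun k => Matrix.vecCons (if i = k then 1 else 0) fun j => Γ x i j k)

/-- The components `∇ᵢ g̃ⱼₖ` of the tractor covariant derivative of `g̃ = D D 𝐫`. -/
def cubic (i j k : Fin (n + 1)) : ℝ :=
  pd i (fun z => preAmbient Γ ρ z j.succ k.succ) x
    - ∑ l, Γ x i j l * preAmbient Γ ρ x l.succ k.succ
    - ∑ l, Γ x i k l * preAmbient Γ ρ x j.succ l.succ
    + projSchouten Γ x i j * pd k ρ x + projSchouten Γ x i k * pd j ρ x

/-- The covariant derivative `∇ᵢ g̃` as a matrix. -/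
def cubicMatrix (i : Fin (n + 1)) : Matrix (Fin (n + 2)) (Fin (n + 2)) ℝ :=
  Matrix.of (Matrix.vecCons 0 fun j => Matrix.vecCons 0 fun k => cubic Γ ρ x i j k)

namespace IsFlatScale

variable {Γ ρ x} {vol : Coord (n + 1) → ℝ} {U : Set (Coord (n + 1))} (hS : IsFlatScale Γ vol U)
  (hρ : ContDiffOn ℝ ∞ ρ U) (hx : x ∈ U)
include hS hρ

include hx in
lemma preAmbient_symm (I J : Fin (n + 2)) : preAmbient Γ ρ x I J = preAmbient Γ ρ x J I := by
  have hd := hρ.diffAt hS.isOpen hx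
  refine Fin.cases ?_ (fun i => ?_) I <;> refine Fin.cases ?_ (fun j => ?_) J
  · rfl
  · rw [preAmbient_zero_succ, preAmbient_succ_zero hd]
  · rw [preAmbient_zero_succ, preAmbient_succ_zero hd]
  · rw [preAmbient_succ_succ, preAmbient_succ_succ, hS.hess_symm hρ hx, hS.projSchouten_symm hx]

lemma contDiffOn_preAmbient (I J : Fin (n + 2)) :
    ContDiffOn ℝ ∞ (fun x => preAmbient Γ ρ x I J) U := by
  refine Fin.cases ?_ (fun i => ?_) I <;> refine Fin.cases ?_ (fun j => ?_) J
  · simp only [preAmbient_zero_zero]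
    exact contDiffOn_const.mul hρ
  · simp only [preAmbient_zero_succ]
    exact hρ.pd hS.isOpen j
  · exact (hρ.pd hS.isOpen i).congr fun z hz => preAmbient_succ_zero (hρ.diffAt hS.isOpen hz) i
  · simp only [preAmbient_succ_succ]
    exact (hS.contDiffOn_hess hρ i j).add
      ((contDiffOn_const.mul hρ).mul (hS.contDiffOn_projSchouten i j))

include hx

/-- In matrix form this is `∂ᵢ g̃ = Ωᵢᵀ g̃ + g̃ Ωᵢ + ∇ᵢ g̃`. Its content is that row and column `0`
of `∇ᵢ g̃` vanish: there the derivatives of `2ρ` and `dρ` are exactly what the connection terms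
reproduce from the other entries of `g̃`. The remaining block is `cubic` by definition, and `ρ` need
not vanish. -/
lemma pd_preAmbient (i : Fin (n + 1)) (I J : Fin (n + 2)) :
    pd i (fun z => preAmbient Γ ρ z I J) x
      = ∑ K, tractorMatrix Γ x i K I * preAmbient Γ ρ x K J
        + ∑ K, preAmbient Γ ρ x I K * tractorMatrix Γ x i K J + cubicMatrix Γ ρ x i I J := by
  have hd := hρ.diffAt hS.isOpen hx
  have hsz : ∀ j : Fin (n + 1), pd i (fun z => preAmbient Γ ρ z j.succ 0) x = pd i (pd j ρ) x :=
    fun j => pd_congr_of_isOpen i hS.isOpen hx fun z hz =>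
      preAmbient_succ_zero (hρ.diffAt hS.isOpen hz) j
  have hh : ∀ j, pd i (pd j ρ) x = hess Γ ρ x i j + ∑ k, Γ x i j k * pd k ρ x := by
    intro j
    simp [hess]
  refine Fin.cases ?_ (fun i => ?_) I <;> refine Fin.cases ?_ (fun j => ?_) J
  · simp only [Fin.sum_univ_succ (n := n + 1), tractorMatrix, cubicMatrix, preAmbient_zero_zero,
      preAmbient_zero_succ, preAmbient_succ_zero hd, Matrix.of_apply, Matrix.cons_val_zero,
      Matrix.cons_val_succ, pd_const_mul i 2 hd]
    simp
    ring
  · simp only [Fin.sum_univ_succ (n := n + 1), tractorMatrix, cubicMatrix, preAmbient_zero_zero,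
      preAmbient_zero_succ, Matrix.of_apply, Matrix.cons_val_zero,
      Matrix.cons_val_succ, preAmbient_succ_succ, ite_mul, one_mul, zero_mul, Finset.sum_ite_eq,
      Finset.mem_univ, if_true, Pi.zero_apply]
    rw [hh]
    simp only [mul_comm (pd _ ρ x)]
    ring
  · simp only [Fin.sum_univ_succ (n := n + 1), tractorMatrix, cubicMatrix, preAmbient_zero_zero, hsz,
      preAmbient_succ_zero hd, Matrix.of_apply, Matrix.cons_val_zero,
      Matrix.cons_val_succ, preAmbient_succ_succ, mul_ite, mul_one, mul_zero, Finset.sum_ite_eq,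
      Finset.mem_univ, if_true]
    rw [hh, hS.hess_symm hρ hx, hS.projSchouten_symm hx]
    ring
  · simp only [Fin.sum_univ_succ (n := n + 1), tractorMatrix, cubicMatrix, preAmbient_zero_succ,
      preAmbient_succ_zero hd, Matrix.of_apply, Matrix.cons_val_zero, Matrix.cons_val_succ, cubic]
    simp only [mul_comm (preAmbient Γ ρ x _ _)]
    ring

lemma cubic_symm_right (i j k : Fin (n + 1)) : cubic Γ ρ x i j k = cubic Γ ρ x i k j := by
  have h : pd i (fun z => preAmbient Γ ρ z j.succ k.succ) x
      = pd i (fun z => preAmbient Γ ρ z k.succ j.succ) x :=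
    pd_congr_of_isOpen i hS.isOpen hx fun z hz => hS.preAmbient_symm hρ hz _ _
  simp only [cubic, h]
  simp only [hS.preAmbient_symm hρ hx (Fin.succ _) k.succ,
    hS.preAmbient_symm hρ hx j.succ (Fin.succ _)]
  ring

/-- Commuting the first two derivatives in `∇ᵢ∇ⱼ∇ₖ ρ` costs `R_{ij}{}^l{}_k ∂_l ρ`. Flatness writes
this through `P`, and it cancels against the Schouten terms in `cubic` and those from
differentiating `2ρ P`. The remaining skew term is `2ρ` times the Cotton tensor and is killed by `ρ
= 0`. -/
lemma cubic_symm_left (h0 : ρ x = 0) (i j k : Fin (n + 1)) :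
    cubic Γ ρ x i j k = cubic Γ ρ x j i k := by
  have hU := hS.isOpen
  have hd := hρ.diffAt hU hx
  have hpd : ∀ i j, pd i (fun z => preAmbient Γ ρ z j.succ k.succ) x
      = pd i (pd j (pd k ρ)) x - ∑ l, (pd i (fun z => Γ z j k l) x * pd l ρ x
          + Γ x j k l * pd i (pd l ρ) x) + 2 * pd i ρ x * projSchouten Γ x j k := by
    intro i j
    simp only [preAmbient_succ_succ, hess]
    have d1 : DifferentiableAt ℝ (pd j (pd k ρ)) x := ((hρ.pd hU k).pd hU j).diffAt hU hx
    have d2 : ∀ l, DifferentiableAt ℝ (fun z => Γ z j k l * pd l ρ z) x := fun l =>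
      ((hS.contDiffOn_coeff j k l).mul (hρ.pd hU l)).diffAt hU hx
    have d3 : DifferentiableAt ℝ (fun z => 2 * ρ z) x := hd.const_mul 2
    have d4 : DifferentiableAt ℝ (fun z => projSchouten Γ z j k) x :=
      (hS.contDiffOn_projSchouten j k).diffAt hU hx
    rw [pd_add i (d1.fun_sub (DifferentiableAt.fun_sum fun l _ => d2 l)) (d3.fun_mul d4),
      pd_sub i d1 (DifferentiableAt.fun_sum fun l _ => d2 l), pd_sum i _ fun l _ => d2 l,
      pd_mul i d3 d4, pd_const_mul i 2 hd, h0]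
    simp only [pd_mul i ((hS.contDiffOn_coeff j k _).diffAt hU hx) ((hρ.pd hU _).diffAt hU hx)]
    ring
  have hG : ∀ i j, preAmbient Γ ρ x i.succ j.succ = pd i (pd j ρ) x - ∑ q, Γ x i j q * pd q ρ x := by
    intro i j
    rw [preAmbient_succ_succ, h0, hess]
    ring
  have hR : ∑ l, curv Γ x i j l k * pd l ρ x
      = projSchouten Γ x j k * pd i ρ x - projSchouten Γ x i k * pd j ρ x := by
    simp only [hS.curv_eq hx, sub_mul, ite_mul, zero_mul, Finset.sum_sub_distrib,
      Finset.sum_ite_eq, Finset.mem_univ, if_true]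
  have hR' : ∑ l, curv Γ x i j l k * pd l ρ x
      = ∑ l, pd i (fun z => Γ z j k l) x * pd l ρ x - ∑ l, pd j (fun z => Γ z i k l) x * pd l ρ x
        + ∑ l, Γ x j k l * ∑ q, Γ x i l q * pd q ρ x
        - ∑ l, Γ x i k l * ∑ q, Γ x j l q * pd q ρ x := by
    -- Renaming the summation indices matches the `ΓΓ∂ρ` terms of the commutator with the quadratic
    -- part of the curvature.
    have e1 : ∀ i j, ∑ l, Γ x j k l * ∑ q, Γ x i l q * pd q ρ x
        = ∑ l, (∑ q, Γ x i q l * Γ x j k q) * pd l ρ x := by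
      intro i j
      simp only [Finset.mul_sum, Finset.sum_mul]
      rw [Finset.sum_comm]
      refine Finset.sum_congr rfl fun q _ => Finset.sum_congr rfl fun l _ => ?_
      ring
    rw [e1, e1]
    simp only [curv, add_mul, sub_mul, Finset.sum_add_distrib, Finset.sum_sub_distrib]
    ring
  simp only [cubic, hpd, hG, Finset.sum_add_distrib, mul_sub, Finset.sum_sub_distrib]
  have hc1 : pd i (pd j (pd k ρ)) x = pd j (pd i (pd k ρ)) x := pd_comm (hρ.pd hU k) hU hx i j
  have hc2 : ∀ l, pd l (pd k ρ) x = pd k (pd l ρ) x := fun l => pd_comm hρ hU hx l k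
  have hc3 : ∀ l, Γ x j i l = Γ x i j l := fun l => hS.symm x hx j i l
  have hc4 := hS.projSchouten_symm hx j i
  simp only [hc3, hc1, hc4]
  linarith

/-- Differentiation of the Monge–Ampère equation: where the first derivative of `𝒥[𝐫]` vanishes,
`∇ᵢ g̃` is trace-free. -/
lemma sum_inv_mul_cubic (hdet : IsUnit (preAmbient Γ ρ x).det) (i : Fin (n + 1))
    (hMA : pd i (mongeAmpere Γ vol ρ) x = 0) :
    ∑ j, ∑ k, (preAmbient Γ ρ x)⁻¹ j.succ k.succ * cubic Γ ρ x i j k = 0 := by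
  set g := preAmbient Γ ρ x with hg
  have hU := hS.isOpen
  have hG : ∀ I J, DifferentiableAt ℝ (fun z => preAmbient Γ ρ z I J) x := fun I J =>
    (hS.contDiffOn_preAmbient hρ I J).diffAt hU hx
  have hvol := hS.contDiffOn_vol.diffAt hU hx
  have hMAd : DifferentiableAt ℝ (mongeAmpere Γ vol ρ) x := by
    have h1 := (contDiffOn_matrix_det (hS.contDiffOn_preAmbient hρ)).diffAt hU hx
    have h2 : DifferentiableAt ℝ (fun z => vol z ^ 2) x := hvol.pow 2
    exact h1.mul (h2.inv (pow_pos (hS.vol_pos x hx) 2).ne')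
  -- Since `det g̃ = 𝒥[𝐫] vol²` and `d𝒥[𝐫] = 0` here, the logarithmic derivative of `det g̃` is
  -- twice that of `vol`, which is `Γ_{il}^l`.
  have h1 : pd i (fun z => (preAmbient Γ ρ z).det) x = 2 * (∑ l, Γ x i l l) * g.det := by
    have : pd i (fun z => (preAmbient Γ ρ z).det) x
        = pd i (fun z => mongeAmpere Γ vol ρ z * (vol z * vol z)) x := by
      refine pd_congr_of_isOpen i hU hx fun z hz => ?_
      have := (hS.vol_pos z hz).ne'
      simp only [mongeAmpere]
      field_simp
    rw [this, pd_mul i hMAd (hvol.fun_mul hvol), hMA, pd_mul i hvol hvol, hS.pd_vol x hx]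
    have := (hS.vol_pos x hx).ne'
    simp only [mongeAmpere, ← hg]
    field_simp
    ring
  have h2 := pd_matrix_det hG hdet i
  rw [h1, mul_comm, ← hg] at h2
  have h3 := mul_left_cancel₀ hdet.ne_zero h2
  have h4 : ∑ k, ∑ l, g⁻¹ k l * pd i (fun z => preAmbient Γ ρ z l k) x
      = (g⁻¹ * ((tractorMatrix Γ x i)ᵀ * g + g * tractorMatrix Γ x i + cubicMatrix Γ ρ x i)).trace := by
    simp only [Matrix.trace, Matrix.diag, Matrix.mul_apply, Matrix.add_apply, Matrix.transpose_apply,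
      hS.pd_preAmbient hρ hx, hg]
  have h5 : (tractorMatrix Γ x i).trace = ∑ l, Γ x i l l := by
    simp [Matrix.trace, Fin.sum_univ_succ (n := n + 1), tractorMatrix]
  have h6 : (g⁻¹ * ((tractorMatrix Γ x i)ᵀ * g)).trace = ∑ l, Γ x i l l := by
    rw [← Matrix.mul_assoc, Matrix.trace_mul_comm, ← Matrix.mul_assoc, Matrix.mul_nonsing_inv _ hdet,
      Matrix.one_mul, Matrix.trace_transpose, h5]
  have h7 : (g⁻¹ * (g * tractorMatrix Γ x i)).trace = ∑ l, Γ x i l l := by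
    rw [← Matrix.mul_assoc, Matrix.nonsing_inv_mul _ hdet, Matrix.one_mul, h5]
  have h8 : (g⁻¹ * cubicMatrix Γ ρ x i).trace
      = ∑ j, ∑ k, g⁻¹ j.succ k.succ * cubic Γ ρ x i j k := by
    simp only [Matrix.trace, Matrix.diag, Matrix.mul_apply, Fin.sum_univ_succ (n := n + 1),
      cubicMatrix, Matrix.of_apply, Matrix.cons_val_zero, Matrix.cons_val_succ, Pi.zero_apply,
      mul_zero, Finset.sum_const_zero, zero_add]
    refine Finset.sum_congr rfl fun j _ => Finset.sum_congr rfl fun k _ => ?_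
    rw [hS.cubic_symm_right hρ hx]
  -- Each of the two terms with `Ωᵢ` contributes `tr Ωᵢ = Γ_{il}^l`. Together they account for the
  -- whole derivative of the volume, so the trace of `∇ᵢ g̃` has nothing left to equal.
  rw [h4, Matrix.mul_add, Matrix.mul_add, Matrix.trace_add, Matrix.trace_add, h6, h7, h8] at h3
  linarith

end IsFlatScale

end ProjectiveScale

/-! ### Christoffel symbols of the ambient metric. -/

section AmbientConnection

/-- Coefficients that satisfy the Koszul formula are the Christoffel symbols. -/
lemma leviCivita_eq_of_koszul {m : ℕ} {g : Coord m → Matrix (Fin m) (Fin m) ℝ} {z : Coord m}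
    (hg : ∀ I J, g z I J = g z J I) (hdet : IsUnit (g z).det) {i j : Fin m} {T : Fin m → ℝ}
    (hT : ∀ l, ∑ k, T k * g z k l = (1 / 2) *
      (pd i (fun z => g z j l) z + pd j (fun z => g z i l) z - pd l (fun z => g z i j) z))
    (k : Fin m) : leviCivita g z i j k = T k := by
  have h : (g z)⁻¹ *ᵥ (fun l => ∑ k, T k * g z k l) = T := by
    have : (fun l => ∑ k, T k * g z k l) = g z *ᵥ T := by
      ext l
      simp only [Matrix.mulVec, dotProduct]
      exact Finset.sum_congr rfl fun k _ => by rw [hg, mul_comm]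
    rw [this, Matrix.mulVec_mulVec, Matrix.nonsing_inv_mul _ hdet, Matrix.one_mulVec]
  rw [← congrFun h k]
  simp only [leviCivita, Matrix.mulVec, dotProduct, hT, Finset.mul_sum]
  refine Finset.sum_congr rfl fun l _ => ?_
  ring

/-- The Koszul formula for the Christoffel symbols. -/
lemma sum_leviCivita_mul {m : ℕ} {g : Coord m → Matrix (Fin m) (Fin m) ℝ} {z : Coord m}
    (hg : ∀ I J, g z I J = g z J I) (hdet : IsUnit (g z).det) (i j l : Fin m) :
    ∑ k, leviCivita g z i j k * g z k l = (1 / 2) *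
      (pd i (fun z => g z j l) z + pd j (fun z => g z i l) z - pd l (fun z => g z i j) z) := by
  set b : Fin m → ℝ := fun l => (1 / 2) *
      (pd i (fun z => g z j l) z + pd j (fun z => g z i l) z - pd l (fun z => g z i j) z) with hb
  have h : ∀ k, leviCivita g z i j k = ((g z)⁻¹ *ᵥ b) k := by
    intro k
    simp only [leviCivita, Matrix.mulVec, dotProduct, hb, Finset.mul_sum]
    exact Finset.sum_congr rfl fun l _ => by ring
  have h2 : g z *ᵥ ((g z)⁻¹ *ᵥ b) = b := by
    rw [Matrix.mulVec_mulVec, Matrix.mul_nonsing_inv _ hdet, Matrix.one_mulVec]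
  have h3 := congrFun h2 l
  change _ = b l
  rw [← h3]
  simp only [h, Matrix.mulVec, dotProduct]
  exact Finset.sum_congr rfl fun k _ => by rw [hg, mul_comm]

variable {n : ℕ}

@[simp] lemma ambBase_ambPoint (t : ℝ) (x : Coord (n + 1)) : ambBase (ambPoint t x) = x := by
  ext i
  simp [ambBase, ambPoint]

@[simp] lemma ambPoint_zero (t : ℝ) (x : Coord (n + 1)) : ambPoint t x 0 = t := by
  simp [ambPoint]

@[simp] lemma ambPoint_succ (t : ℝ) (x : Coord (n + 1)) (i : Fin (n + 1)) :
    ambPoint t x i.succ = x i := by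
  simp [ambPoint]

@[simp] lemma ambBase_apply (z : Coord (n + 2)) (i : Fin (n + 1)) : ambBase z i = z i.succ := rfl

/-- The projection `Ñ → N` as a linear map. -/
def ambBaseCLM : Coord (n + 2) →L[ℝ] Coord (n + 1) :=
  LinearMap.toContinuousLinearMap
    { toFun := ambBase
      map_add' := fun u v => by ext; simp
      map_smul' := fun a u => by ext; simp }

lemma ambBaseCLM_apply (z : Coord (n + 2)) : ambBaseCLM z = ambBase z := rfl

lemma hasFDerivAt_comp_ambBase {G : Type*} [NormedAddCommGroup G] [NormedSpace ℝ G]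
    {f : Coord (n + 1) → G} {z : Coord (n + 2)} (hf : DifferentiableAt ℝ f (ambBase z)) :
    HasFDerivAt (fun z => f (ambBase z)) ((fderiv ℝ f (ambBase z)).comp ambBaseCLM) z :=
  HasFDerivAt.comp (g := f) (f := ambBaseCLM) z hf.hasFDerivAt ambBaseCLM.hasFDerivAt

lemma ambBase_single_zero : ambBase (EuclideanSpace.single 0 1 : Coord (n + 2)) = 0 := by
  ext i
  simp

lemma ambBase_single_succ (i : Fin (n + 1)) :
    ambBase (EuclideanSpace.single i.succ 1 : Coord (n + 2)) = EuclideanSpace.single i 1 := by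
  ext j
  simp

lemma pd_zero_comp_ambBase {f : Coord (n + 1) → ℝ} {z : Coord (n + 2)}
    (hf : DifferentiableAt ℝ f (ambBase z)) : pd 0 (fun z => f (ambBase z)) z = 0 := by
  simp only [pd, (hasFDerivAt_comp_ambBase hf).fderiv, ContinuousLinearMap.comp_apply,
    ambBaseCLM_apply, ambBase_single_zero, map_zero]

lemma pd_succ_comp_ambBase {f : Coord (n + 1) → ℝ} {z : Coord (n + 2)}
    (hf : DifferentiableAt ℝ f (ambBase z)) (i : Fin (n + 1)) :
    pd i.succ (fun z => f (ambBase z)) z = pd i f (ambBase z) := by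
  simp only [pd, (hasFDerivAt_comp_ambBase hf).fderiv, ContinuousLinearMap.comp_apply,
    ambBaseCLM_apply, ambBase_single_succ]

lemma pd_apply {m : ℕ} (i j : Fin m) (z : Coord m) :
    pd i (fun z : Coord m => z j) z = if i = j then 1 else 0 := by
  rw [← pd_euclidean i (F := fun z => z) differentiableAt_id]
  simp [pd, eq_comm]

lemma differentiableAt_apply {m : ℕ} (j : Fin m) (z : Coord m) :
    DifferentiableAt ℝ (fun z : Coord m => z j) z :=
  (EuclideanSpace.proj (𝕜 := ℝ) j).differentiableAt

variable {Γ : Coeffs (n + 1)} {ρ : Coord (n + 1) → ℝ}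

lemma ambientMetric_zero_zero (z : Coord (n + 2)) :
    ambientMetric Γ ρ z 0 0 = preAmbient Γ ρ (ambBase z) 0 0 := by
  simp [ambientMetric]

lemma ambientMetric_zero_succ (z : Coord (n + 2)) (j : Fin (n + 1)) :
    ambientMetric Γ ρ z 0 j.succ = z 0 * preAmbient Γ ρ (ambBase z) 0 j.succ := by
  simp [ambientMetric]

lemma ambientMetric_succ_zero (z : Coord (n + 2)) (i : Fin (n + 1)) :
    ambientMetric Γ ρ z i.succ 0 = z 0 * preAmbient Γ ρ (ambBase z) i.succ 0 := by
  simp [ambientMetric]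

lemma ambientMetric_succ_succ (z : Coord (n + 2)) (i j : Fin (n + 1)) :
    ambientMetric Γ ρ z i.succ j.succ
      = z 0 * z 0 * preAmbient Γ ρ (ambBase z) i.succ j.succ := by
  simp [ambientMetric]

/-- In coordinates the homogeneous metric is `g̃` conjugated by `diag(1, t, …, t)`, so it is
nondegenerate wherever `g̃` is and `t ≠ 0`. -/
lemma det_ambientMetric (z : Coord (n + 2)) :
    (ambientMetric Γ ρ z).det = (z 0 ^ (n + 1)) ^ 2 * (preAmbient Γ ρ (ambBase z)).det := by
  set d : Fin (n + 2) → ℝ := Matrix.vecCons 1 (fun _ : Fin (n + 1) => z 0) with hd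
  have h : ambientMetric Γ ρ z
      = Matrix.diagonal d * preAmbient Γ ρ (ambBase z) * Matrix.diagonal d := by
    ext I J
    rw [Matrix.mul_diagonal, Matrix.diagonal_mul]
    simp only [ambientMetric, Matrix.of_apply, ← hd]
    ring
  have hprod : ∏ I, d I = z 0 ^ (n + 1) := by
    rw [Fin.prod_univ_succ]
    simp [hd]
  rw [h, Matrix.det_mul, Matrix.det_mul, Matrix.det_diagonal, hprod]
  ring

/-- The Christoffel symbols of the ambient metric over the hypersurface, at height `1`, for two
horizontal indices. -/
def ambientCoeff (Γ : Coeffs (n + 1)) (ρ : Coord (n + 1) → ℝ) (x : Coord (n + 1))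
    (i j : Fin (n + 1)) (K : Fin (n + 2)) : ℝ :=
  tractorMatrix Γ x i K j.succ
    + (1 / 2) * ∑ l, (preAmbient Γ ρ x)⁻¹ K l.succ * cubic Γ ρ x i j l

namespace IsFlatScale

variable {vol : Coord (n + 1) → ℝ} {U : Set (Coord (n + 1))} (hS : IsFlatScale Γ vol U)
  (hρ : ContDiffOn ℝ ∞ ρ U) {x : Coord (n + 1)} (hx : x ∈ U)
  (hdet : IsUnit (preAmbient Γ ρ x).det) {t : ℝ} (ht : 0 < t)
include hS hρ hx

lemma ambientMetric_symm (I J : Fin (n + 2)) :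
    ambientMetric Γ ρ (ambPoint t x) I J = ambientMetric Γ ρ (ambPoint t x) J I := by
  simp only [ambientMetric, Matrix.of_apply, ambBase_ambPoint, hS.preAmbient_symm hρ hx I J]
  ring

lemma differentiableAt_preAmbient (I J : Fin (n + 2)) :
    DifferentiableAt ℝ (fun z => preAmbient Γ ρ z I J) (ambBase (ambPoint t x)) := by
  rw [ambBase_ambPoint]
  exact (hS.contDiffOn_preAmbient hρ I J).diffAt hS.isOpen hx

lemma pd_zero_ambientMetric_zero_zero :
    pd 0 (fun z => ambientMetric Γ ρ z 0 0) (ambPoint t x) = 0 := by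
  simp only [ambientMetric_zero_zero]
  exact pd_zero_comp_ambBase (hS.differentiableAt_preAmbient hρ hx 0 0)

lemma pd_succ_ambientMetric_zero_zero (i : Fin (n + 1)) :
    pd i.succ (fun z => ambientMetric Γ ρ z 0 0) (ambPoint t x) = 2 * pd i ρ x := by
  simp only [ambientMetric_zero_zero]
  rw [pd_succ_comp_ambBase (hS.differentiableAt_preAmbient hρ hx 0 0), ambBase_ambPoint]
  simp only [preAmbient_zero_zero]
  exact pd_const_mul i 2 (hρ.diffAt hS.isOpen hx)

lemma pd_zero_ambientMetric_zero_succ (j : Fin (n + 1)) :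
    pd 0 (fun z => ambientMetric Γ ρ z 0 j.succ) (ambPoint t x) = pd j ρ x := by
  have h := hS.differentiableAt_preAmbient (t := t) hρ hx 0 j.succ
  simp only [ambientMetric_zero_succ]
  rw [pd_mul 0 (differentiableAt_apply _ _) (hasFDerivAt_comp_ambBase h).differentiableAt,
    pd_zero_comp_ambBase h, pd_apply]
  simp [preAmbient_zero_succ]

lemma pd_succ_ambientMetric_zero_succ (i j : Fin (n + 1)) :
    pd i.succ (fun z => ambientMetric Γ ρ z 0 j.succ) (ambPoint t x) = t * pd i (pd j ρ) x := by
  have h := hS.differentiableAt_preAmbient (t := t) hρ hx 0 j.succ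
  simp only [ambientMetric_zero_succ]
  rw [pd_mul _ (differentiableAt_apply _ _) (hasFDerivAt_comp_ambBase h).differentiableAt,
    pd_succ_comp_ambBase h, pd_apply]
  simp [preAmbient_zero_succ]

lemma pd_zero_ambientMetric_succ_succ (i j : Fin (n + 1)) :
    pd 0 (fun z => ambientMetric Γ ρ z i.succ j.succ) (ambPoint t x)
      = 2 * t * preAmbient Γ ρ x i.succ j.succ := by
  have h := hS.differentiableAt_preAmbient (t := t) hρ hx i.succ j.succ
  have h0 := differentiableAt_apply 0 (ambPoint t x)
  simp only [ambientMetric_succ_succ]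
  rw [pd_mul _ (h0.fun_mul h0) (hasFDerivAt_comp_ambBase h).differentiableAt, pd_mul _ h0 h0,
    pd_zero_comp_ambBase h, pd_apply]
  simp only [if_true, ambPoint_zero, ambBase_ambPoint]
  ring

lemma pd_succ_ambientMetric_succ_succ (i j k : Fin (n + 1)) :
    pd k.succ (fun z => ambientMetric Γ ρ z i.succ j.succ) (ambPoint t x)
      = t * t * pd k (fun z => preAmbient Γ ρ z i.succ j.succ) x := by
  have h := hS.differentiableAt_preAmbient (t := t) hρ hx i.succ j.succ
  have h0 := differentiableAt_apply 0 (ambPoint t x)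
  simp only [ambientMetric_succ_succ]
  rw [pd_mul _ (h0.fun_mul h0) (hasFDerivAt_comp_ambBase h).differentiableAt, pd_mul _ h0 h0,
    pd_succ_comp_ambBase h, pd_apply]
  simp

lemma pd_ambientMetric_symm (I J K : Fin (n + 2)) :
    pd I (fun z => ambientMetric Γ ρ z J K) (ambPoint t x)
      = pd I (fun z => ambientMetric Γ ρ z K J) (ambPoint t x) := by
  refine pd_congr I ?_
  have h : ∀ᶠ z in 𝓝 (ambPoint t x), ambBase z ∈ U := by
    have hc : ContinuousAt (fun z : Coord (n + 2) => ambBase z) (ambPoint t x) :=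
      ambBaseCLM.continuous.continuousAt
    refine hc.eventually_mem (hS.isOpen.mem_nhds ?_)
    rwa [ambBase_ambPoint]
  filter_upwards [h] with z hz
  simp only [ambientMetric, Matrix.of_apply, hS.preAmbient_symm hρ hz J K]
  ring

include hdet ht

omit hS hρ hx in
lemma isUnit_det_ambientMetric : IsUnit (ambientMetric Γ ρ (ambPoint t x)).det := by
  rw [det_ambientMetric, ambBase_ambPoint, ambPoint_zero]
  exact IsUnit.mul (isUnit_iff_ne_zero.2 (by positivity)) hdet

/-- The Euler field `T = t ∂_t` is dual to `d(t² ρ)`, and the metric is homogeneous of degree `2`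
along it; hence `∇̃ T = id`. This symbol and the two mixed ones below are the coordinate form of
that identity, checked through the Koszul formula. -/
lemma ambientConn_zero_zero (K : Fin (n + 2)) :
    leviCivita (ambientMetric Γ ρ) (ambPoint t x) 0 0 K = 0 := by
  refine leviCivita_eq_of_koszul (T := fun _ => 0) (hS.ambientMetric_symm hρ hx)
    (isUnit_det_ambientMetric hdet ht) (fun L => ?_) K
  refine Fin.cases ?_ (fun l => ?_) L
  · simp [hS.pd_zero_ambientMetric_zero_zero hρ hx]
  · simp [hS.pd_zero_ambientMetric_zero_succ hρ hx, hS.pd_succ_ambientMetric_zero_zero hρ hx]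
    ring

lemma ambientConn_zero_succ (j : Fin (n + 1)) (K : Fin (n + 2)) :
    leviCivita (ambientMetric Γ ρ) (ambPoint t x) 0 j.succ K = if j.succ = K then t⁻¹ else 0 := by
  refine leviCivita_eq_of_koszul (T := fun K => if j.succ = K then t⁻¹ else 0)
    (hS.ambientMetric_symm hρ hx) (isUnit_det_ambientMetric hdet ht) (fun L => ?_) K
  simp only [ite_mul, zero_mul, Finset.sum_ite_eq, Finset.mem_univ, if_true]
  have hU := hS.isOpen
  refine Fin.cases ?_ (fun l => ?_) L
  · rw [hS.pd_ambientMetric_symm hρ hx 0 j.succ 0, hS.pd_succ_ambientMetric_zero_zero hρ hx,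
      ambientMetric_succ_zero, ambBase_ambPoint, preAmbient_succ_zero (hρ.diffAt hU hx),
      ambPoint_zero]
    field_simp
    ring
  · rw [hS.pd_zero_ambientMetric_succ_succ hρ hx, hS.pd_succ_ambientMetric_zero_succ hρ hx,
      hS.pd_succ_ambientMetric_zero_succ hρ hx, pd_comm hρ hU hx l j, ambientMetric_succ_succ,
      ambBase_ambPoint, ambPoint_zero]
    field_simp
    ring

lemma ambientConn_succ_zero (j : Fin (n + 1)) (K : Fin (n + 2)) :
    leviCivita (ambientMetric Γ ρ) (ambPoint t x) j.succ 0 K = if j.succ = K then t⁻¹ else 0 := by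
  rw [← hS.ambientConn_zero_succ hρ hx hdet ht]
  simp only [leviCivita, hS.pd_ambientMetric_symm hρ hx _ 0 j.succ]
  congr 1
  refine Finset.sum_congr rfl fun l _ => ?_
  ring

/-- The Koszul formula contains three derivatives of the metric, with signs `+, +, -`. Since `cubic`
is totally symmetric on `M`, they contribute one copy of it, which with the factor `½` gives `Ω + ½
g̃⁻¹ cubic`. The vector `(t, 1, …, 1)` records the homogeneity in the fibre coordinate. -/
lemma ambientConn_succ_succ (h0 : ρ x = 0) (i j : Fin (n + 1)) (K : Fin (n + 2)) :
    leviCivita (ambientMetric Γ ρ) (ambPoint t x) i.succ j.succ K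
      = Matrix.vecCons t (fun _ : Fin (n + 1) => 1) K * ambientCoeff Γ ρ x i j K := by
  have hU := hS.isOpen
  have hd := hρ.diffAt hU hx
  -- The Koszul formula determines the symbols with lowered index; lowering cancels the inverse
  -- metric in `ambientCoeff`.
  have hinv : ∀ L, ∑ K, ambientCoeff Γ ρ x i j K * preAmbient Γ ρ x K L
      = ∑ K, tractorMatrix Γ x i K j.succ * preAmbient Γ ρ x K L
        + (1 / 2) * cubicMatrix Γ ρ x i j.succ L := by
    intro L
    have h1 : ∑ K, (∑ l, (preAmbient Γ ρ x)⁻¹ K l.succ * cubic Γ ρ x i j l) * preAmbient Γ ρ x K L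
        = ∑ l : Fin (n + 1), (1 : Matrix (Fin (n + 2)) (Fin (n + 2)) ℝ) L l.succ
            * cubic Γ ρ x i j l := by
      rw [← Matrix.mul_nonsing_inv _ hdet]
      simp only [Matrix.mul_apply, Finset.sum_mul]
      rw [Finset.sum_comm]
      refine Finset.sum_congr rfl fun l _ => Finset.sum_congr rfl fun K _ => ?_
      rw [hS.preAmbient_symm hρ hx L K]
      ring
    have h2 : ∑ l : Fin (n + 1), (1 : Matrix (Fin (n + 2)) (Fin (n + 2)) ℝ) L l.succ
            * cubic Γ ρ x i j l = cubicMatrix Γ ρ x i j.succ L := by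
      refine Fin.cases ?_ (fun l => ?_) L
      · simp [cubicMatrix, (Fin.succ_ne_zero _).symm]
      · simp [cubicMatrix, Matrix.one_apply]
    simp only [ambientCoeff, add_mul, Finset.sum_add_distrib, mul_assoc, ← Finset.mul_sum, h1, h2]
  refine leviCivita_eq_of_koszul
    (T := fun K => Matrix.vecCons t (fun _ : Fin (n + 1) => 1) K * ambientCoeff Γ ρ x i j K)
    (hS.ambientMetric_symm hρ hx) (isUnit_det_ambientMetric hdet ht) (fun L => ?_) K
  have hsum : ∑ K, Matrix.vecCons t (fun _ : Fin (n + 1) => 1) K * ambientCoeff Γ ρ x i j K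
        * ambientMetric Γ ρ (ambPoint t x) K L
      = t * Matrix.vecCons 1 (fun _ : Fin (n + 1) => t) L
        * ∑ K, ambientCoeff Γ ρ x i j K * preAmbient Γ ρ x K L := by
    rw [Finset.mul_sum]
    refine Finset.sum_congr rfl fun K _ => ?_
    simp only [ambientMetric, Matrix.of_apply, ambBase_ambPoint, ambPoint_zero]
    refine Fin.cases ?_ (fun k => ?_) K
    · simp only [Matrix.cons_val_zero]
      ring
    · simp only [Matrix.cons_val_succ]
      ring
  rw [hsum, hinv]
  refine Fin.cases ?_ (fun l => ?_) L
  · rw [hS.pd_ambientMetric_symm hρ hx _ j.succ 0, hS.pd_ambientMetric_symm hρ hx _ i.succ 0,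
      hS.pd_succ_ambientMetric_zero_succ hρ hx, hS.pd_succ_ambientMetric_zero_succ hρ hx,
      hS.pd_zero_ambientMetric_succ_succ hρ hx, pd_comm hρ hU hx j i, preAmbient_succ_succ, h0, hess,
      Fin.sum_univ_succ (n := n + 1)]
    simp only [preAmbient_zero_zero, preAmbient_succ_zero hd, h0, tractorMatrix, cubicMatrix,
      Matrix.of_apply, Matrix.cons_val_zero, Matrix.cons_val_succ]
    ring
  · rw [hS.pd_succ_ambientMetric_succ_succ hρ hx, hS.pd_succ_ambientMetric_succ_succ hρ hx,
      hS.pd_succ_ambientMetric_succ_succ hρ hx, hS.pd_preAmbient hρ hx, hS.pd_preAmbient hρ hx,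
      hS.pd_preAmbient hρ hx]
    -- Torsion-freeness of `∇` and symmetry of `P` make the tractor connection symmetric in its two
    -- horizontal indices. This lets four of the six `Ω` terms in the Koszul formula cancel in
    -- pairs.
    have hω : ∀ i j K, tractorMatrix Γ x i K j.succ = tractorMatrix Γ x j K i.succ := by
      intro i j K
      refine Fin.cases ?_ (fun k => ?_) K
      · simp [tractorMatrix, hS.projSchouten_symm hx i j]
      · simp [tractorMatrix, hS.symm x hx i j]
    simp only [mul_comm (preAmbient Γ ρ x _ _), hS.preAmbient_symm hρ hx (Fin.succ _) _]
    simp only [hω j i, hω l i, hω l j, cubicMatrix, Matrix.of_apply, Matrix.cons_val_succ,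
      hS.cubic_symm_left hρ hx h0 j i, hS.cubic_symm_left hρ hx h0 l i,
      hS.cubic_symm_right hρ hx i l j]
    ring

end IsFlatScale
end AmbientConnection

/-! ### The ambient metric and its connection along the hypersurface. -/

namespace LocalData

variable {n : ℕ} (D : LocalData n)

/-- Coordinate expressions of a strictly convex hypersurface in a flat projective manifold, with a
scale and a Fefferman defining density, on open sets `U` of the ambient chart and `W` of the chart
of the hypersurface. There is no condition on the field `ξ`. -/
structure IsFeffermanPatch (U : Set (Coord (n + 1))) (W : Set (Coord n)) : Prop where
  scale : IsFlatScale D.Γ D.vol U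
  contDiffOn_ρ : ContDiffOn ℝ ∞ D.ρ U
  isOpen : IsOpen W
  mem : ∀ y ∈ W, D.F y ∈ U
  contDiffOn_F : ContDiffOn ℝ ∞ D.F W
  ρ_eq_zero : ∀ y ∈ W, D.ρ (D.F y) = 0
  injective : ∀ y ∈ W, Function.Injective (fderiv ℝ D.F y)
  convex : ∀ y ∈ W, ∀ v : Coord (n + 1), v ≠ 0 → fderiv ℝ D.ρ (D.F y) v = 0 →
    0 < ∑ i, ∑ j, hess D.Γ D.ρ (D.F y) i j * v i * v j
  det : ∀ y ∈ W, (preAmbient D.Γ D.ρ (D.F y)).det = -D.vol (D.F y) ^ 2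
  pd_mongeAmpere : ∀ y ∈ W, ∀ i, pd i (mongeAmpere D.Γ D.vol D.ρ) (D.F y) = 0

/-- The ambient metric on tractors at a point of the hypersurface. -/
def amb (y : Coord n) (u v : Coord (n + 2)) : ℝ :=
  (fun I => u I) ⬝ᵥ (preAmbient D.Γ D.ρ (D.F y) *ᵥ fun J => v J)

/-- The covariant derivative of the ambient metric, as a trilinear form on `T N`. -/
def cubicForm (y : Coord n) (w u v : Coord (n + 1)) : ℝ :=
  ∑ i, ∑ j, ∑ k, cubic D.Γ D.ρ (D.F y) i j k * w i * u j * v k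

/-- The Hessian of `ρ` as a bilinear form. -/
def hessForm (y : Coord n) (u v : Coord (n + 1)) : ℝ :=
  ∑ i, ∑ j, hess D.Γ D.ρ (D.F y) i j * u i * v j

variable {D} {U : Set (Coord (n + 1))} {W : Set (Coord n)} {y : Coord n}

lemma projP_add_right (v w w' : Coord (n + 1)) :
    D.projP y v (w + w') = D.projP y v w + D.projP y v w' := by
  simp only [projP, PiLp.add_apply, mul_add, Finset.sum_add_distrib]

lemma projP_smul_right (v w : Coord (n + 1)) (a : ℝ) :
    D.projP y v (a • w) = a * D.projP y v w := by
  simp only [projP, PiLp.smul_apply, smul_eq_mul, Finset.mul_sum]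
  exact Finset.sum_congr rfl fun i _ => Finset.sum_congr rfl fun j _ => by ring

lemma amb_eq_sum (u v : Coord (n + 2)) :
    D.amb y u v = ∑ I, ∑ J, preAmbient D.Γ D.ρ (D.F y) I J * u I * v J := by
  simp only [amb, dotProduct, Matrix.mulVec, Finset.mul_sum]
  exact Finset.sum_congr rfl fun I _ => Finset.sum_congr rfl fun J _ => by ring

lemma amb_add_left (u u' v : Coord (n + 2)) :
    D.amb y (u + u') v = D.amb y u v + D.amb y u' v := by
  simp only [amb_eq_sum, PiLp.add_apply, mul_add, add_mul, Finset.sum_add_distrib]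

namespace IsFeffermanPatch

variable (hD : D.IsFeffermanPatch U W) (hy : y ∈ W)
include hD hy

lemma isUnit_det : IsUnit (preAmbient D.Γ D.ρ (D.F y)).det := by
  rw [hD.det y hy, isUnit_iff_ne_zero, neg_ne_zero]
  exact (pow_pos (hD.scale.vol_pos _ (hD.mem y hy)) 2).ne'

lemma differentiableAt_F : DifferentiableAt ℝ D.F y := hD.contDiffOn_F.diffAt hD.isOpen hy

lemma differentiableAt_ρ : DifferentiableAt ℝ D.ρ (D.F y) :=
  hD.contDiffOn_ρ.diffAt hD.scale.isOpen (hD.mem y hy)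

lemma amb_symm (u v : Coord (n + 2)) : D.amb y u v = D.amb y v u := by
  rw [amb_eq_sum, amb_eq_sum, Finset.sum_comm]
  refine Finset.sum_congr rfl fun I _ => Finset.sum_congr rfl fun J _ => ?_
  rw [hD.scale.preAmbient_symm hD.contDiffOn_ρ (hD.mem y hy) J I]
  ring

lemma hessForm_symm (u v : Coord (n + 1)) : D.hessForm y u v = D.hessForm y v u := by
  rw [hessForm, hessForm, Finset.sum_comm]
  refine Finset.sum_congr rfl fun I _ => Finset.sum_congr rfl fun J _ => ?_
  rw [hD.scale.hess_symm hD.contDiffOn_ρ (hD.mem y hy) J I]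
  ring

lemma cubicForm_symm_left (w u v : Coord (n + 1)) :
    D.cubicForm y w u v = D.cubicForm y u w v := by
  rw [cubicForm, cubicForm, Finset.sum_comm]
  refine Finset.sum_congr rfl fun I _ => Finset.sum_congr rfl fun J _ =>
    Finset.sum_congr rfl fun K _ => ?_
  rw [hD.scale.cubic_symm_left hD.contDiffOn_ρ (hD.mem y hy) (hD.ρ_eq_zero y hy) J I K]
  ring

lemma cubicForm_symm_right (w u v : Coord (n + 1)) :
    D.cubicForm y w u v = D.cubicForm y w v u := by
  rw [cubicForm, cubicForm]
  refine Finset.sum_congr rfl fun I _ => ?_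
  rw [Finset.sum_comm]
  refine Finset.sum_congr rfl fun J _ => Finset.sum_congr rfl fun K _ => ?_
  rw [hD.scale.cubic_symm_right hD.contDiffOn_ρ (hD.mem y hy) I K J]
  ring

lemma amb_ambPoint (a b : ℝ) (u v : Coord (n + 1)) :
    D.amb y (ambPoint a u) (ambPoint b v)
      = a * fderiv ℝ D.ρ (D.F y) v + b * fderiv ℝ D.ρ (D.F y) u + D.hessForm y u v := by
  rw [amb_eq_sum]
  simp only [Fin.sum_univ_succ (n := n + 1), ambPoint_zero, ambPoint_succ, preAmbient_zero_zero,
    preAmbient_zero_succ, preAmbient_succ_zero (hD.differentiableAt_ρ hy), preAmbient_succ_succ,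
    hD.ρ_eq_zero y hy, mul_zero, zero_mul, zero_add, add_zero, Finset.sum_add_distrib, hessForm,
    fderiv_eq_sum_pd, smul_eq_mul, Finset.mul_sum]
  rw [← add_assoc]
  congr 1
  congr 1
  · exact Finset.sum_congr rfl fun j _ => by ring
  · exact Finset.sum_congr rfl fun j _ => by ring

omit hD hy in
lemma projConn_apply {u : Coord n → Coord (n + 2)} (hu : DifferentiableAt ℝ u y) (α : Fin n)
    (K : Fin (n + 2)) : D.projConn u y α K = pd α (fun z => u z K) y
      + ∑ i, (pd α D.F y) i * ∑ J, tractorMatrix D.Γ (D.F y) i K J * u y J := by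
  refine Fin.cases ?_ (fun k => ?_) K
  · simp only [projConn, ambPoint_zero, projP, ambBase_apply, Fin.sum_univ_succ (n := n + 1),
      tractorMatrix, Matrix.of_apply, Matrix.cons_val_zero, Matrix.cons_val_succ, zero_mul, zero_add,
      Finset.mul_sum, sub_eq_add_neg, ← Finset.sum_neg_distrib]
    congr 1
    refine Finset.sum_congr rfl fun i _ => Finset.sum_congr rfl fun j _ => ?_
    ring
  · have hb : DifferentiableAt ℝ (fun z => ambBase (u z)) y :=
      ambBaseCLM.differentiableAt.comp y hu
    simp only [projConn, ambPoint_succ, covAlong, PiLp.add_apply, PiLp.smul_apply, smul_eq_mul,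
      pd_euclidean α hb, ambBase_apply, Fin.sum_univ_succ (n := n + 1),
      tractorMatrix, Matrix.of_apply, Matrix.cons_val_zero, Matrix.cons_val_succ, mul_add,
      Finset.sum_add_distrib, ite_mul, one_mul, zero_mul, mul_ite, mul_zero, Finset.sum_ite_eq',
      Finset.mem_univ, if_true, Finset.mul_sum, add_assoc]
    congr 1
    rw [add_comm, mul_comm]
    congr 1
    refine Finset.sum_congr rfl fun i _ => Finset.sum_congr rfl fun j _ => ?_
    ring

/-- The Leibniz rule for the ambient metric and the projective tractor connection. -/
lemma pd_amb {u v : Coord n → Coord (n + 2)} (hu : DifferentiableAt ℝ u y)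
    (hv : DifferentiableAt ℝ v y) (α : Fin n) :
    pd α (fun z => D.amb z (u z) (v z)) y
      = D.amb y (D.projConn u y α) (v y) + D.amb y (u y) (D.projConn v y α)
        + D.cubicForm y (pd α D.F y) (ambBase (u y)) (ambBase (v y)) := by
  set w := pd α D.F y with hw
  set Ω : Matrix (Fin (n + 2)) (Fin (n + 2)) ℝ := ∑ i, w i • tractorMatrix D.Γ (D.F y) i with hΩ
  set Q : Matrix (Fin (n + 2)) (Fin (n + 2)) ℝ := ∑ i, w i • cubicMatrix D.Γ D.ρ (D.F y) i with hQ
  set g := preAmbient D.Γ D.ρ (D.F y) with hg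
  have huI : ∀ I, DifferentiableAt ℝ (fun z => u z I) y := fun I =>
    (differentiableAt_apply I (u y)).comp y hu
  have hvI : ∀ I, DifferentiableAt ℝ (fun z => v z I) y := fun I =>
    (differentiableAt_apply I (v y)).comp y hv
  have hGd : ∀ I J, DifferentiableAt ℝ (fun x => preAmbient D.Γ D.ρ x I J) (D.F y) := fun I J =>
    (hD.scale.contDiffOn_preAmbient hD.contDiffOn_ρ I J).diffAt hD.scale.isOpen (hD.mem y hy)
  have hGF : ∀ I J, DifferentiableAt ℝ (fun z => preAmbient D.Γ D.ρ (D.F z) I J) y := fun I J =>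
    (hGd I J).comp y (hD.differentiableAt_F hy)
  -- The chain rule along `F` contracts the matrix identity of `pd_preAmbient` with `∂_αF`.
  have hdG : ∀ I J, pd α (fun z => preAmbient D.Γ D.ρ (D.F z) I J) y
      = (Ωᵀ * g + g * Ω + Q) I J := by
    intro I J
    rw [pd_comp α (hGd I J) (hD.differentiableAt_F hy)]
    simp only [hD.scale.pd_preAmbient hD.contDiffOn_ρ (hD.mem y hy), Matrix.add_apply,
      Matrix.mul_apply, Matrix.transpose_apply, hΩ, hQ, Matrix.sum_apply, Matrix.smul_apply,
      smul_eq_mul, mul_add, Finset.sum_add_distrib, Finset.mul_sum, Finset.sum_mul]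
    congr 1
    congr 1
    · rw [Finset.sum_comm]
      exact Finset.sum_congr rfl fun i _ => Finset.sum_congr rfl fun j _ => by ring
    · exact Finset.sum_congr rfl fun i _ => Finset.sum_congr rfl fun j _ => by ring
  have hconn : ∀ {u : Coord n → Coord (n + 2)}, DifferentiableAt ℝ u y →
      (fun K => D.projConn u y α K)
        = (fun K => pd α (fun z => u z K) y) + Ω *ᵥ (fun J => u y J) := by
    intro u hu
    ext K
    rw [projConn_apply hu]
    simp only [Pi.add_apply, Matrix.mulVec, dotProduct, hΩ, Matrix.sum_apply, Matrix.smul_apply,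
      smul_eq_mul, Finset.sum_mul, Finset.mul_sum]
    congr 1
    rw [Finset.sum_comm]
    exact Finset.sum_congr rfl fun i _ => Finset.sum_congr rfl fun j _ => by ring
  have hcub : D.cubicForm y w (ambBase (u y)) (ambBase (v y))
      = (fun I => u y I) ⬝ᵥ (Q *ᵥ fun J => v y J) := by
    have hQ0 : ∀ I, Q 0 I = 0 := fun I => by
      simp [hQ, Matrix.sum_apply, cubicMatrix]
    have hQs : ∀ I : Fin (n + 1), Q I.succ 0 = 0 := fun I => by
      simp [hQ, Matrix.sum_apply, cubicMatrix]
    have hQss : ∀ j k : Fin (n + 1), Q j.succ k.succ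
        = ∑ i, w i * cubic D.Γ D.ρ (D.F y) i j k := fun j k => by
      simp [hQ, Matrix.sum_apply, cubicMatrix]
    simp only [dotProduct, Matrix.mulVec, Fin.sum_univ_succ (n := n + 1), hQ0, hQs, hQss, zero_mul,
      Finset.sum_const_zero, mul_zero, zero_add, cubicForm, ambBase_apply, Finset.mul_sum,
      Finset.sum_mul]
    rw [Finset.sum_comm]
    refine Finset.sum_congr rfl fun j _ => ?_
    rw [Finset.sum_comm]
    exact Finset.sum_congr rfl fun i _ => Finset.sum_congr rfl fun j _ => by ring
  have hlhs : pd α (fun z => D.amb z (u z) (v z)) y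
      = (fun I => pd α (fun z => u z I) y) ⬝ᵥ (g *ᵥ fun J => v y J)
        + (fun I => u y I) ⬝ᵥ (g *ᵥ fun J => pd α (fun z => v z J) y)
        + (fun I => u y I) ⬝ᵥ ((Ωᵀ * g + g * Ω + Q) *ᵥ fun J => v y J) := by
    simp only [amb_eq_sum]
    rw [pd_sum α _ fun I _ => DifferentiableAt.fun_sum fun J _ =>
      ((hGF I J).fun_mul (huI I)).fun_mul (hvI J)]
    simp only [pd_sum α Finset.univ fun J _ => ((hGF _ J).fun_mul (huI _)).fun_mul (hvI J)]
    simp only [pd_mul α ((hGF _ _).fun_mul (huI _)) (hvI _), pd_mul α (hGF _ _) (huI _), hdG,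
      dotProduct, Matrix.mulVec, Finset.mul_sum, ← Finset.sum_add_distrib]
    exact Finset.sum_congr rfl fun i _ => Finset.sum_congr rfl fun j _ => by ring
  rw [hlhs, hcub]
  simp only [amb, hconn hu, hconn hv, ← hg, Matrix.add_mulVec, Matrix.mulVec_add, dotProduct_add,
    add_dotProduct, ← Matrix.mulVec_mulVec]
  rw [Matrix.dotProduct_mulVec _ Ωᵀ, Matrix.vecMul_transpose]
  ring

lemma pd_ambPoint_F (α : Fin n) (I : Fin (n + 2)) :
    (pd α (fun z => ambPoint 1 (D.F z)) y) I = ambPoint 0 (pd α D.F y) I := by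
  have hd : DifferentiableAt ℝ (fun z => ambPoint 1 (D.F z)) y := by
    refine differentiableAt_euclidean.2 fun I => ?_
    refine Fin.cases ?_ (fun i => ?_) I
    · simp
    · simp only [ambPoint_succ]
      exact (differentiableAt_apply i (D.F y)).comp y (hD.differentiableAt_F hy)
  rw [pd_euclidean α hd]
  refine Fin.cases ?_ (fun i => ?_) I
  · simp [pd_const]
  · simp only [ambPoint_succ, pd_euclidean α (hD.differentiableAt_F hy)]

/-- The section `t = 1` has horizontal velocity. At this height the mixed symbols `δᵢ^k` are column
`0` of the tractor connection matrix, so all the first-order terms reassemble into `projConn` and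
only the cubic correction is left. -/
lemma ambientConnM_apply {v : Coord n → Coord (n + 2)} (hv : DifferentiableAt ℝ v y) (α : Fin n)
    (K : Fin (n + 2)) : D.ambientConnM v y α K = D.projConn v y α K
      + (1 / 2) * ∑ l, (preAmbient D.Γ D.ρ (D.F y))⁻¹ K l.succ
        * ∑ i, ∑ j : Fin (n + 1), cubic D.Γ D.ρ (D.F y) i j l * (pd α D.F y) i * v y j.succ := by
  have hx := hD.mem y hy
  have hu := hD.isUnit_det hy
  have hone : ∀ K : Fin (n + 2), Matrix.vecCons (1 : ℝ) (fun _ : Fin (n + 1) => 1) K = 1 := by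
    intro K
    refine Fin.cases ?_ (fun k => ?_) K <;> simp
  have hT0 : ∀ (i : Fin (n + 1)) (K : Fin (n + 2)),
      (if i.succ = K then (1 : ℝ)⁻¹ else 0) = tractorMatrix D.Γ (D.F y) i K 0 := by
    intro i K
    refine Fin.cases ?_ (fun k => ?_) K
    · simp [tractorMatrix]
    · simp [tractorMatrix]
  rw [projConn_apply hv]
  simp only [ambientConnM, covAlong, PiLp.add_apply, pd_euclidean α hv, hD.pd_ambPoint_F hy,
    ambientConn, Fin.sum_univ_succ (n := n + 1), ambPoint_zero, ambPoint_succ, mul_zero, zero_mul,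
    Finset.sum_const_zero, zero_add,
    hD.scale.ambientConn_succ_zero hD.contDiffOn_ρ hx hu one_pos,
    hD.scale.ambientConn_succ_succ hD.contDiffOn_ρ hx hu one_pos (hD.ρ_eq_zero y hy), hone, hT0,
    ambientCoeff, one_mul, add_assoc]
  congr 1
  simp only [mul_add, add_mul, Finset.sum_add_distrib, Finset.mul_sum, Finset.sum_mul, ← add_assoc]
  congr 1
  · congr 1
    · exact Finset.sum_congr rfl fun i _ => by ring
    · exact Finset.sum_congr rfl fun i _ => Finset.sum_congr rfl fun j _ => by ring
  · calc _ = ∑ i, ∑ l, ∑ j : Fin (n + 1), (1 / 2) * ((preAmbient D.Γ D.ρ (D.F y))⁻¹ K l.succ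
        * (cubic D.Γ D.ρ (D.F y) i j l * (pd α D.F y) i * v y j.succ)) := by
          refine Finset.sum_congr rfl fun i _ => ?_
          rw [Finset.sum_comm]
          exact Finset.sum_congr rfl fun l _ => Finset.sum_congr rfl fun j _ => by ring
      _ = _ := Finset.sum_comm

/-- `∇̃ = ∇^proj + ½ g̃⁻¹ ∇^proj g̃` along the hypersurface. -/
lemma amb_ambientConnM {v : Coord n → Coord (n + 2)} (hv : DifferentiableAt ℝ v y) (α : Fin n)
    (Z : Coord (n + 2)) : D.amb y (D.ambientConnM v y α) Z = D.amb y (D.projConn v y α) Z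
      + (1 / 2) * D.cubicForm y (pd α D.F y) (ambBase (v y)) (ambBase Z) := by
  set g := preAmbient D.Γ D.ρ (D.F y) with hg
  set b : Fin (n + 2) → ℝ := Matrix.vecCons 0 (fun l =>
    ∑ i, ∑ j : Fin (n + 1), cubic D.Γ D.ρ (D.F y) i j l * (pd α D.F y) i * v y j.succ) with hb
  have h1 : (fun K => D.ambientConnM v y α K) = (fun K => D.projConn v y α K)
      + (1 / 2 : ℝ) • (g⁻¹ *ᵥ b) := by
    ext K
    rw [hD.ambientConnM_apply hy hv]
    simp [Matrix.mulVec, dotProduct, Fin.sum_univ_succ (n := n + 1), hb, hg]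
  -- Symmetry of `g̃` allows it to be moved across the pairing, where it cancels `g̃⁻¹`.
  have h2 : (g⁻¹ *ᵥ b) ⬝ᵥ (g *ᵥ fun J => Z J) = b ⬝ᵥ fun J => Z J := by
    have hs : gᵀ = g := by
      ext I J
      exact hD.scale.preAmbient_symm hD.contDiffOn_ρ (hD.mem y hy) J I
    rw [Matrix.dotProduct_mulVec, ← Matrix.mulVec_transpose, hs, Matrix.mulVec_mulVec,
      Matrix.mul_nonsing_inv _ (hD.isUnit_det hy), Matrix.one_mulVec]
  have h3 : (b ⬝ᵥ fun J => Z J) = D.cubicForm y (pd α D.F y) (ambBase (v y)) (ambBase Z) := by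
    simp only [dotProduct, Fin.sum_univ_succ (n := n + 1), hb, Matrix.cons_val_zero, zero_mul,
      Matrix.cons_val_succ, zero_add, cubicForm, ambBase_apply, Finset.sum_mul]
    rw [Finset.sum_comm]
    refine Finset.sum_congr rfl fun i _ => ?_
    rw [Finset.sum_comm]
  rw [← h3, ← h2, amb, h1, add_dotProduct, smul_dotProduct, smul_eq_mul]
  rfl

/-- The Levi-Civita connection of the ambient metric restricts to tractors along the hypersurface:
the derivative along a lift of a tangent vector does not depend on the lift. -/
lemma covDeriv_homField {v : Coord (n + 1) → Coord (n + 2)} (hv : DifferentiableAt ℝ v (D.F y))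
    {t : ℝ} (ht : 0 < t) (a : ℝ) (α : Fin n) :
    covDeriv D.ambientConn (homField v) (ambPoint t (D.F y)) (ambPoint a (pd α D.F y))
      = homLift t (D.ambientConnM (fun z => v (D.F z)) y α) := by
  have hx := hD.mem y hy
  have hu := hD.isUnit_det hy
  have hF := hD.differentiableAt_F hy
  have hvI : ∀ I, DifferentiableAt ℝ (fun x => v x I) (D.F y) := fun I =>
    (differentiableAt_apply I (v (D.F y))).comp _ hv
  have hvF : DifferentiableAt ℝ (fun z => v (D.F z)) y := hv.comp y hF
  have hvI' : ∀ I, DifferentiableAt ℝ (fun x => v x I) (ambBase (ambPoint t (D.F y))) := fun I => by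
    rw [ambBase_ambPoint]; exact hvI I
  have hinv : HasFDerivAt (fun z : Coord (n + 2) => (z 0)⁻¹)
      (-(t ^ 2)⁻¹ • EuclideanSpace.proj (𝕜 := ℝ) (0 : Fin (n + 2))) (ambPoint t (D.F y)) := by
    have h1 : HasFDerivAt (fun z : Coord (n + 2) => z 0)
      (EuclideanSpace.proj (𝕜 := ℝ) (0 : Fin (n + 2)) : Coord (n + 2) →L[ℝ] ℝ)
      (ambPoint t (D.F y)) := (EuclideanSpace.proj (𝕜 := ℝ) (0 : Fin (n + 2))).hasFDerivAt
    have h2 : HasDerivAt (fun s : ℝ => s⁻¹) (-(t ^ 2)⁻¹) ((ambPoint t (D.F y)) 0) := by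
      rw [ambPoint_zero]
      exact hasDerivAt_inv ht.ne'
    exact HasDerivAt.comp_hasFDerivAt (f := fun z : Coord (n + 2) => z 0) _ h2 h1
  have hd0 : HasFDerivAt (fun z => homField v z 0)
      ((fderiv ℝ (fun x => v x 0) (ambBase (ambPoint t (D.F y)))).comp ambBaseCLM)
      (ambPoint t (D.F y)) := by
    simpa [homField, homLift] using hasFDerivAt_comp_ambBase (hvI' 0)
  have hdk := fun k : Fin (n + 1) => hinv.fun_mul (hasFDerivAt_comp_ambBase (hvI' k.succ))
  have hfield : ∀ k : Fin (n + 1), (fun z => homField v z k.succ)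
      = fun z => (z 0)⁻¹ * v (ambBase z) k.succ := by
    intro k
    ext z
    simp [homField, homLift]
  have hdiff : DifferentiableAt ℝ (homField v) (ambPoint t (D.F y)) := by
    refine differentiableAt_euclidean.2 fun I => ?_
    refine Fin.cases ?_ (fun k => ?_) I
    · exact hd0.differentiableAt
    · rw [hfield]
      exact (hdk k).differentiableAt
  have hw : ∀ K, (fderiv ℝ (homField v) (ambPoint t (D.F y)) (ambPoint a (pd α D.F y))) K
      = fderiv ℝ (fun z => homField v z K) (ambPoint t (D.F y)) (ambPoint a (pd α D.F y)) := by
    intro K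
    have h := ((EuclideanSpace.proj (𝕜 := ℝ) K).hasFDerivAt.comp _ hdiff.hasFDerivAt).fderiv
    exact (congrArg (fun L => L (ambPoint a (pd α D.F y))) h).symm
  have hch : ∀ K, pd α (fun z => v (D.F z) K) y = fderiv ℝ (fun x => v x K) (D.F y) (pd α D.F y) := by
    intro K
    have h : fderiv ℝ (fun z => v (D.F z) K) y
        = (fderiv ℝ (fun x => v x K) (D.F y)).comp (fderiv ℝ D.F y) := fderiv_comp y (hvI K) hF
    simp only [pd, h, ContinuousLinearMap.comp_apply]
  have h0 : homField v (ambPoint t (D.F y)) 0 = v (D.F y) 0 := by simp [homField, homLift]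
  have hs : ∀ k : Fin (n + 1), homField v (ambPoint t (D.F y)) k.succ = t⁻¹ * v (D.F y) k.succ := by
    intro k
    simp [homField, homLift]
  have hL0 : ∀ u : Coord (n + 2), homLift t u 0 = u 0 := fun u => by simp [homLift]
  have hLs : ∀ (u : Coord (n + 2)) (k : Fin (n + 1)), homLift t u k.succ = t⁻¹ * u k.succ :=
    fun u k => by simp [homLift]
  ext K
  simp only [covDeriv, PiLp.add_apply, hw]
  refine Fin.cases ?_ (fun k => ?_) K
  -- The `∂_t` component of a tractor field is constant along the fibre, and the factor `t` in the
  -- horizontal symbols cancels the `t⁻¹` in `homLift`.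
  · rw [hd0.fderiv, hL0]
    simp only [ambientConnM, covAlong, PiLp.add_apply, pd_euclidean α hvF, hch,
      hD.pd_ambPoint_F hy, ambientConn, Fin.sum_univ_succ (n := n + 1), ambPoint_zero, ambPoint_succ,
      mul_zero, zero_mul, Finset.sum_const_zero, zero_add, h0, hs, Fin.succ_ne_zero, if_false, add_zero,
      hD.scale.ambientConn_succ_zero hD.contDiffOn_ρ hx hu one_pos,
      hD.scale.ambientConn_succ_zero hD.contDiffOn_ρ hx hu ht,
      hD.scale.ambientConn_zero_succ hD.contDiffOn_ρ hx hu ht,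
      hD.scale.ambientConn_zero_zero hD.contDiffOn_ρ hx hu ht,
      hD.scale.ambientConn_succ_succ hD.contDiffOn_ρ hx hu one_pos (hD.ρ_eq_zero y hy),
      hD.scale.ambientConn_succ_succ hD.contDiffOn_ρ hx hu ht (hD.ρ_eq_zero y hy),
      ContinuousLinearMap.comp_apply, ambBaseCLM_apply, ambBase_ambPoint, Matrix.cons_val_zero]
    congr 1
    refine Finset.sum_congr rfl fun i _ => Finset.sum_congr rfl fun j _ => ?_
    field_simp
  -- Independence of the lift: differentiating `t⁻¹` along `a ∂_t` gives `-a t⁻² v^k`, and the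
  -- symbol `Γ_{0k}^k = t⁻¹` gives `+a t⁻² v^k`.
  · rw [hfield, (hdk k).fderiv, hLs]
    simp only [ambientConnM, covAlong, PiLp.add_apply, pd_euclidean α hvF, hch,
      hD.pd_ambPoint_F hy, ambientConn, Fin.sum_univ_succ (n := n + 1), ambPoint_zero, ambPoint_succ,
      mul_zero, zero_mul, Finset.sum_const_zero, zero_add, h0, hs, Fin.succ_inj, ite_mul,
      hD.scale.ambientConn_succ_zero hD.contDiffOn_ρ hx hu one_pos,
      hD.scale.ambientConn_succ_zero hD.contDiffOn_ρ hx hu ht,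
      hD.scale.ambientConn_zero_succ hD.contDiffOn_ρ hx hu ht,
      hD.scale.ambientConn_zero_zero hD.contDiffOn_ρ hx hu ht,
      hD.scale.ambientConn_succ_succ hD.contDiffOn_ρ hx hu one_pos (hD.ρ_eq_zero y hy),
      hD.scale.ambientConn_succ_succ hD.contDiffOn_ρ hx hu ht (hD.ρ_eq_zero y hy),
      ContinuousLinearMap.comp_apply, ambBaseCLM_apply, ambBase_ambPoint, Matrix.cons_val_succ,
      Finset.sum_add_distrib, Finset.sum_ite_eq', Finset.mem_univ, if_true, add_apply, smul_apply,
      smul_eq_mul, PiLp.proj_apply, ambPoint_zero, mul_add, one_mul]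
    have h2 : ∑ i, ∑ j, ambientCoeff D.Γ D.ρ (D.F y) i j k.succ * (pd α D.F y) i
          * (t⁻¹ * v (D.F y) j.succ)
        = t⁻¹ * ∑ i, ∑ j, ambientCoeff D.Γ D.ρ (D.F y) i j k.succ * (pd α D.F y) i
          * v (D.F y) j.succ := by
      simp only [Finset.mul_sum]
      exact Finset.sum_congr rfl fun i _ => Finset.sum_congr rfl fun j _ => by ring
    rw [h2]
    generalize (∑ i, ∑ j, ambientCoeff D.Γ D.ρ (D.F y) i j k.succ * (pd α D.F y) i
          * v (D.F y) j.succ) = s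
    field_simp
    ring

end IsFeffermanPatch
end LocalData

/-! ### The pullback connection along a map. -/

section PullbackConnection

variable {n m : ℕ} {Γ : Coeffs m} {F V V' : Coord n → Coord m} {y : Coord n}

lemma covAlong_apply (hV : DifferentiableAt ℝ V y) (α : Fin n) (k : Fin m) :
    covAlong Γ F V y α k = pd α (fun z => V z k) y
      + ∑ i, ∑ j, Γ (F y) i j k * (pd α F y) i * V y j := by
  simp only [covAlong, PiLp.add_apply, pd_euclidean α hV]

lemma _root_.DifferentiableAt.coord (hV : DifferentiableAt ℝ V y) (k : Fin m) :
    DifferentiableAt ℝ (fun z => V z k) y :=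
  (differentiableAt_apply k (V y)).comp y hV

lemma covAlong_add (hV : DifferentiableAt ℝ V y) (hV' : DifferentiableAt ℝ V' y) (α : Fin n) :
    covAlong Γ F (fun z => V z + V' z) y α = covAlong Γ F V y α + covAlong Γ F V' y α := by
  ext k
  simp only [covAlong_apply (V := fun z => V z + V' z) (hV.add hV'), covAlong_apply hV,
    covAlong_apply hV', PiLp.add_apply, mul_add,
    Finset.sum_add_distrib, pd_add α (hV.coord k) (hV'.coord k)]
  ring

lemma covAlong_smul {f : Coord n → ℝ} (hf : DifferentiableAt ℝ f y)
    (hV : DifferentiableAt ℝ V y) (α : Fin n) :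
    covAlong Γ F (fun z => f z • V z) y α = pd α f y • V y + f y • covAlong Γ F V y α := by
  ext k
  simp only [covAlong_apply (V := fun z => f z • V z) (hf.smul hV), covAlong_apply hV,
    PiLp.add_apply, PiLp.smul_apply, smul_eq_mul,
    pd_mul α hf (hV.coord k), mul_add, Finset.mul_sum, add_assoc]
  congr 2
  exact Finset.sum_congr rfl fun i _ => Finset.sum_congr rfl fun j _ => by ring

lemma covAlong_zero (α : Fin n) : covAlong Γ F (fun _ => 0) y α = 0 := by
  ext k
  rw [covAlong_apply (differentiableAt_const _)]
  simp [pd_const]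

lemma covAlong_sum {ι : Type*} (s : Finset ι) {V : ι → Coord n → Coord m}
    (hV : ∀ a, DifferentiableAt ℝ (V a) y) (α : Fin n) :
    covAlong Γ F (fun z => ∑ a ∈ s, V a z) y α = ∑ a ∈ s, covAlong Γ F (V a) y α := by
  classical
  induction s using Finset.induction_on with
  | empty => simp [covAlong_zero]
  | insert a s ha ih =>
    simp only [Finset.sum_insert ha]
    rw [covAlong_add (hV a) (DifferentiableAt.fun_sum fun b _ => hV b), ih]

lemma covAlong_congr (α : Fin n) (h : V =ᶠ[𝓝 y] V') :
    covAlong Γ F V y α = covAlong Γ F V' y α := by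
  simp only [covAlong, pd_congr α h, h.eq_of_nhds]

end PullbackConnection

/-! ### The adapted frame and the Hessian of the defining function. -/

namespace LocalData

variable {n : ℕ} {D : LocalData n} {U : Set (Coord (n + 1))} {W : Set (Coord n)} {y : Coord n}

section Frame

lemma frame_mulVec (a : Fin (n + 1) → ℝ) : D.frame y *ᵥ a
    = fun i => (∑ γ, a γ.castSucc • pd γ D.F y + a (Fin.last n) • D.ξ y) i := by
  ext i
  simp [Matrix.mulVec, dotProduct, frame, Fin.sum_univ_castSucc, mul_comm]

variable (hB : IsUnit (D.frame y).det)
include hB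

lemma decomp_frame (a : Fin (n + 1) → ℝ) :
    D.decomp y (∑ γ, a γ.castSucc • pd γ D.F y + a (Fin.last n) • D.ξ y) = a := by
  rw [decomp, ← frame_mulVec, Matrix.mulVec_mulVec, Matrix.nonsing_inv_mul _ hB, Matrix.one_mulVec]

lemma decomp_castSucc (a : Fin n → ℝ) (b : ℝ) (γ : Fin n) :
    D.decomp y (∑ γ, a γ • pd γ D.F y + b • D.ξ y) γ.castSucc = a γ := by
  have h := congrFun (decomp_frame hB (Fin.snoc (α := fun _ => ℝ) a b)) γ.castSucc
  simpa using h

lemma decomp_last (a : Fin n → ℝ) (b : ℝ) :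
    D.decomp y (∑ γ, a γ • pd γ D.F y + b • D.ξ y) (Fin.last n) = b := by
  have h := congrFun (decomp_frame hB (Fin.snoc (α := fun _ => ℝ) a b)) (Fin.last n)
  simpa using h

lemma eq_sum_decomp (v : Coord (n + 1)) : v = ∑ γ, D.decomp y v γ.castSucc • pd γ D.F y
    + D.decomp y v (Fin.last n) • D.ξ y := by
  ext i
  rw [← congrFun (frame_mulVec (D.decomp y v)) i, decomp, Matrix.mulVec_mulVec,
    Matrix.mul_nonsing_inv _ hB, Matrix.one_mulVec]

lemma covAlong_pd_F (α β : Fin n) : covAlong D.Γ D.F (pd β D.F) y α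
    = ∑ γ, D.indConn y α β γ • pd γ D.F y - D.h y α β • D.ξ y := by
  conv_lhs => rw [eq_sum_decomp hB (covAlong D.Γ D.F (pd β D.F) y α)]
  simp [indConn, h]

lemma covAlong_ξ (α : Fin n) : covAlong D.Γ D.F D.ξ y α
    = ∑ γ, D.shape y α γ • pd γ D.F y + D.eta y α • D.ξ y := by
  conv_lhs => rw [eq_sum_decomp hB (covAlong D.Γ D.F D.ξ y α)]
  simp [shape, eta]

end Frame

lemma hessForm_add_right (u v v' : Coord (n + 1)) :
    D.hessForm y u (v + v') = D.hessForm y u v + D.hessForm y u v' := by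
  simp only [hessForm, PiLp.add_apply, mul_add, Finset.sum_add_distrib]

lemma hessForm_smul_right (u v : Coord (n + 1)) (a : ℝ) :
    D.hessForm y u (a • v) = a * D.hessForm y u v := by
  simp only [hessForm, PiLp.smul_apply, smul_eq_mul, Finset.mul_sum]
  exact Finset.sum_congr rfl fun i _ => Finset.sum_congr rfl fun j _ => by ring

lemma hessForm_sum_right {ι : Type*} (s : Finset ι) (u : Coord (n + 1)) (v : ι → Coord (n + 1)) :
    D.hessForm y u (∑ a ∈ s, v a) = ∑ a ∈ s, D.hessForm y u (v a) :=
  map_sum (AddMonoidHom.mk' (D.hessForm y u) (hessForm_add_right u)) v s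

lemma projP_sum_right {ι : Type*} (s : Finset ι) (u : Coord (n + 1)) (v : ι → Coord (n + 1)) :
    D.projP y u (∑ a ∈ s, v a) = ∑ a ∈ s, D.projP y u (v a) :=
  map_sum (AddMonoidHom.mk' (D.projP y u) (projP_add_right u)) v s

lemma cubicForm_add_right (w u v v' : Coord (n + 1)) :
    D.cubicForm y w u (v + v') = D.cubicForm y w u v + D.cubicForm y w u v' := by
  simp only [cubicForm, PiLp.add_apply, mul_add, Finset.sum_add_distrib]

lemma cubicForm_smul_right (w u v : Coord (n + 1)) (a : ℝ) :
    D.cubicForm y w u (a • v) = a * D.cubicForm y w u v := by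
  simp only [cubicForm, PiLp.smul_apply, smul_eq_mul, Finset.mul_sum]
  exact Finset.sum_congr rfl fun i _ => Finset.sum_congr rfl fun j _ =>
    Finset.sum_congr rfl fun k _ => by ring

lemma cubicForm_sum_right {ι : Type*} (s : Finset ι) (w u : Coord (n + 1))
    (v : ι → Coord (n + 1)) :
    D.cubicForm y w u (∑ a ∈ s, v a) = ∑ a ∈ s, D.cubicForm y w u (v a) :=
  map_sum (AddMonoidHom.mk' (D.cubicForm y w u) (cubicForm_add_right w u)) v s

lemma cubicForm_zero_mid (w v : Coord (n + 1)) : D.cubicForm y w 0 v = 0 := by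
  simp [cubicForm]

lemma ambPoint_add (a b : ℝ) (u v : Coord (n + 1)) :
    ambPoint (a + b) (u + v) = ambPoint a u + ambPoint b v := by
  ext K
  refine Fin.cases ?_ (fun k => ?_) K <;> simp [ambPoint_zero, ambPoint_succ]

lemma ambPoint_ambBase (v : Coord (n + 2)) : ambPoint (v 0) (ambBase v) = v := by
  ext K
  refine Fin.cases ?_ (fun k => ?_) K <;> simp [ambPoint_zero, ambPoint_succ]

lemma differentiableAt_ambPoint {a : Coord n → ℝ} {V : Coord n → Coord (n + 1)}
    (ha : DifferentiableAt ℝ a y) (hV : DifferentiableAt ℝ V y) :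
    DifferentiableAt ℝ (fun z => ambPoint (a z) (V z)) y := by
  refine differentiableAt_euclidean.2 fun I => ?_
  refine Fin.cases ?_ (fun i => ?_) I
  · simpa [ambPoint_zero] using ha
  · simp only [ambPoint_succ]
    exact (differentiableAt_apply i (V y)).comp y hV

lemma projConn_ambPoint (a : Coord n → ℝ) (V : Coord n → Coord (n + 1)) (α : Fin n) :
    D.projConn (fun z => ambPoint (a z) (V z)) y α
      = ambPoint (pd α a y - D.projP y (pd α D.F y) (V y))
        (covAlong D.Γ D.F V y α + a y • pd α D.F y) := by
  simp only [projConn, ambPoint_zero, ambBase_ambPoint]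

namespace IsFeffermanPatch

variable (hD : D.IsFeffermanPatch U W) (hy : y ∈ W)
include hD hy

lemma differentiableAt_pd_F (β : Fin n) : DifferentiableAt ℝ (pd β D.F) y :=
  (hD.contDiffOn_F.pd hD.isOpen β).diffAt hD.isOpen hy

lemma fderiv_ρ_pd_F (α : Fin n) : fderiv ℝ D.ρ (D.F y) (pd α D.F y) = 0 := by
  have h1 : pd α (fun z => D.ρ (D.F z)) y = 0 := by
    rw [pd_congr_of_isOpen α hD.isOpen hy hD.ρ_eq_zero, pd_const]
  rw [pd_comp α (hD.differentiableAt_ρ hy) (hD.differentiableAt_F hy)] at h1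
  rw [fderiv_eq_sum_pd]
  simpa using h1

/-- A linear relation among the columns loses its `ξ` term on applying `dρ`, which kills tangent
vectors; the rest vanishes by injectivity of `dF`. -/
lemma isUnit_det_frame (hξ : fderiv ℝ D.ρ (D.F y) (D.ξ y) ≠ 0) : IsUnit (D.frame y).det := by
  rw [← Matrix.isUnit_iff_isUnit_det, ← Matrix.mulVec_injective_iff_isUnit]
  have key : ∀ a, D.frame y *ᵥ a = 0 → a = 0 := by
    intro a ha
    have hv : ∑ γ, a γ.castSucc • pd γ D.F y + a (Fin.last n) • D.ξ y = 0 := by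
      ext i
      rw [← congrFun (frame_mulVec a) i, ha]
      rfl
    have hl : a (Fin.last n) = 0 := by
      have := congrArg (fderiv ℝ D.ρ (D.F y)) hv
      simp only [map_add, map_sum, map_smul, hD.fderiv_ρ_pd_F hy, smul_eq_mul,
        mul_zero, Finset.sum_const_zero, zero_add, map_zero] at this
      exact (mul_eq_zero.1 this).resolve_right hξ
    rw [hl, zero_smul, add_zero] at hv
    have h2 : fderiv ℝ D.F y (WithLp.toLp 2 fun γ => a γ.castSucc) = fderiv ℝ D.F y 0 := by
      rw [fderiv_eq_sum_pd, map_zero]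
      exact hv
    have h3 := hD.injective y hy h2
    ext j
    refine Fin.lastCases hl (fun γ => ?_) j
    have := congrArg (fun v : Coord n => v γ) h3
    simpa using this
  intro a b hab
  exact sub_eq_zero.1 (key _ (by rw [Matrix.mulVec_sub]; exact sub_eq_zero.2 hab))

lemma covAlong_pd_F_symm (α β : Fin n) :
    covAlong D.Γ D.F (pd β D.F) y α = covAlong D.Γ D.F (pd α D.F) y β := by
  rw [covAlong, covAlong, pd_comm hD.contDiffOn_F hD.isOpen hy α β]
  congr 1
  ext k
  simp only
  rw [Finset.sum_comm]
  refine Finset.sum_congr rfl fun i _ => Finset.sum_congr rfl fun j _ => ?_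
  rw [hD.scale.symm _ (hD.mem y hy) j i k]
  ring

lemma indConn_symm (α β γ : Fin n) : D.indConn y α β γ = D.indConn y β α γ := by
  rw [indConn, indConn, hD.covAlong_pd_F_symm hy]

lemma h_symm (α β : Fin n) : D.h y α β = D.h y β α := by
  simp only [h, Matrix.of_apply, hD.covAlong_pd_F_symm hy α β]

/-- On `M` the ambient metric pairs the tractor `(0, 1)` with `(V, 0)` to `dρ(V)`, so this is a case
of the Leibniz rule `pd_amb`. The cubic term drops out because `(0, 1)` has no `TN` part. -/
lemma pd_fderiv_ρ {V : Coord n → Coord (n + 1)} (hV : DifferentiableAt ℝ V y) (α : Fin n) :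
    pd α (fun z => fderiv ℝ D.ρ (D.F z) (V z)) y
      = D.hessForm y (pd α D.F y) (V y) + fderiv ℝ D.ρ (D.F y) (covAlong D.Γ D.F V y α) := by
  have h1 := hD.pd_amb hy (u := fun _ => ambPoint 1 0) (v := fun z => ambPoint 0 (V z))
    (differentiableAt_const _) (differentiableAt_ambPoint (differentiableAt_const _) hV) α
  rw [projConn_ambPoint (fun _ => 1) (fun _ => 0), projConn_ambPoint (fun _ => 0) V] at h1
  rw [ambBase_ambPoint, ambBase_ambPoint, hD.amb_ambPoint hy, hD.amb_ambPoint hy,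
    cubicForm_zero_mid, covAlong_zero] at h1
  have h2 : pd α (fun z => D.amb z (ambPoint 1 0) (ambPoint 0 (V z))) y
      = pd α (fun z => fderiv ℝ D.ρ (D.F z) (V z)) y := by
    refine pd_congr_of_isOpen α hD.isOpen hy fun z hz => ?_
    rw [hD.amb_ambPoint hz]
    simp [hessForm]
  rw [← h2, h1, pd_const, pd_const]
  simp [hessForm, projP]

/-- Differentiating a constant value of `dρ(V)` trades the Hessian for the transverse part of `∇V`.
For `V = ∂_βF` this identifies `h` with the Hessian up to the factor `dρ(ξ)`; for `V = ξ` it relates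
the Hessian to `η`. -/
lemma hessForm_pd_F_left {V : Coord n → Coord (n + 1)} (hV : DifferentiableAt ℝ V y) {a : ℝ}
    (hVρ : ∀ z ∈ W, fderiv ℝ D.ρ (D.F z) (V z) = a) (α : Fin n) :
    D.hessForm y (pd α D.F y) (V y) = -fderiv ℝ D.ρ (D.F y) (covAlong D.Γ D.F V y α) := by
  have h1 := hD.pd_fderiv_ρ hy hV α
  rw [pd_congr_of_isOpen α hD.isOpen hy hVρ, pd_const] at h1
  linarith

lemma hessForm_pd_F_pd_F (hB : IsUnit (D.frame y).det) (α β : Fin n) :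
    D.hessForm y (pd α D.F y) (pd β D.F y) = fderiv ℝ D.ρ (D.F y) (D.ξ y) * D.h y α β := by
  rw [hD.hessForm_pd_F_left hy (hD.differentiableAt_pd_F hy β)
    (fun z hz => hD.fderiv_ρ_pd_F hz β), covAlong_pd_F hB]
  simp only [map_sub, map_sum, map_smul, hD.fderiv_ρ_pd_F hy, smul_eq_mul, mul_zero,
    Finset.sum_const_zero, zero_sub, neg_neg]
  ring

/-- The tangent frame is independent, so the Hessian is positive definite on it. -/
lemma hessForm_pos {a : Fin n → ℝ} (ha : a ≠ 0) :
    0 < ∑ α, ∑ β, D.hessForm y (pd α D.F y) (pd β D.F y) * a α * a β := by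
  have hv : fderiv ℝ D.F y (WithLp.toLp 2 a) = ∑ α, a α • pd α D.F y := fderiv_eq_sum_pd _ _ _
  have h0 : fderiv ℝ D.F y (WithLp.toLp 2 a) ≠ 0 := by
    intro h
    rw [← map_zero (fderiv ℝ D.F y)] at h
    have := hD.injective y hy h
    exact ha (by simpa using this)
  have hρ : fderiv ℝ D.ρ (D.F y) (fderiv ℝ D.F y (WithLp.toLp 2 a)) = 0 := by
    rw [hv]
    simp [hD.fderiv_ρ_pd_F hy]
  have h1 := hD.convex y hy _ h0 hρ
  change 0 < D.hessForm y _ _ at h1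
  rw [hv, hessForm_sum_right] at h1
  refine h1.trans_eq ?_
  rw [Finset.sum_comm]
  refine Finset.sum_congr rfl fun β _ => ?_
  rw [hessForm_smul_right, hD.hessForm_symm hy, hessForm_sum_right, Finset.mul_sum]
  refine Finset.sum_congr rfl fun α _ => ?_
  rw [hessForm_smul_right, hD.hessForm_symm hy]
  ring

lemma h_posDef (hξ : 0 < fderiv ℝ D.ρ (D.F y) (D.ξ y)) : (D.h y).PosDef := by
  have hB := hD.isUnit_det_frame hy hξ.ne'
  refine Matrix.PosDef.of_dotProduct_mulVec_pos ?_ fun a ha => ?_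
  · ext α β
    simp [hD.h_symm hy α β]
  · have h1 := hD.hessForm_pos hy ha
    simp only [hD.hessForm_pd_F_pd_F hy hB] at h1
    have h2 : ∑ α, ∑ β, fderiv ℝ D.ρ (D.F y) (D.ξ y) * D.h y α β * a α * a β
        = fderiv ℝ D.ρ (D.F y) (D.ξ y) * (star a ⬝ᵥ D.h y *ᵥ a) := by
      simp only [dotProduct, Matrix.mulVec, Finset.mul_sum, star_trivial]
      exact Finset.sum_congr rfl fun i _ => Finset.sum_congr rfl fun j _ => by ring
    rw [h2] at h1
    exact pos_of_mul_pos_right h1 hξ.le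

/-- The determinant of the ambient metric in the frame `X, ∂₁F, …, ∂ₙF, ξ`. -/
lemma det_preAmbient_mul_det_frame :
    (preAmbient D.Γ D.ρ (D.F y)).det * (D.frame y).det ^ 2
      = -fderiv ℝ D.ρ (D.F y) (D.ξ y) ^ 2
        * (Matrix.of fun α β => D.hessForm y (pd α D.F y) (pd β D.F y)).det := by
  set s := fderiv ℝ D.ρ (D.F y) (D.ξ y) with hs
  set col : Fin (n + 1) → Coord (n + 1) :=
    Fin.snoc (α := fun _ => Coord (n + 1)) (fun α => pd α D.F y) (D.ξ y) with hcol
  set bv : Fin (n + 2) → Coord (n + 2) :=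
    Matrix.vecCons (ambPoint 1 0) (fun j => ambPoint 0 (col j)) with hbv
  set B : Matrix (Fin (n + 2)) (Fin (n + 2)) ℝ := Matrix.of fun I J => bv J I with hBdef
  have hBdet : B.det = (D.frame y).det := by
    rw [Matrix.det_succ_row_zero, Fin.sum_univ_succ]
    have h0 : ∀ j : Fin (n + 1), B 0 j.succ = 0 := fun j => by
      simp [hBdef, hbv, ambPoint_zero]
    have h1 : B 0 0 = 1 := by simp [hBdef, hbv, ambPoint_zero]
    simp only [h0, h1, mul_zero, zero_mul, Finset.sum_const_zero, add_zero, Fin.val_zero, pow_zero,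
      one_mul]
    congr 1
  set M := Bᵀ * preAmbient D.Γ D.ρ (D.F y) * B with hM
  have hMIJ : ∀ I J, M I J = D.amb y (bv I) (bv J) := by
    intro I J
    rw [hM, Matrix.mul_assoc]
    simp only [amb, Matrix.mul_apply, dotProduct, Matrix.mulVec, Matrix.transpose_apply, hBdef,
      Matrix.of_apply]
  have hcs : ∀ α : Fin n, col α.castSucc = pd α D.F y := fun α => by simp [hcol]
  have hcl : col (Fin.last n) = D.ξ y := by simp [hcol]
  have hb0 : bv 0 = ambPoint 1 0 := rfl
  have hbs : ∀ j, bv (Fin.succ j) = ambPoint 0 (col j) := fun j => rfl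
  have hM0 : ∀ j : Fin (n + 1), M 0 j.castSucc = 0 := by
    intro j
    rw [hMIJ, hb0]
    refine Fin.cases ?_ (fun i => ?_) j
    · rw [Fin.castSucc_zero, hb0, hD.amb_ambPoint hy]
      simp [hessForm]
    · rw [Fin.castSucc_succ, hbs, hcs, hD.amb_ambPoint hy, hD.fderiv_ρ_pd_F hy]
      simp [hessForm]
  have hM0l : M 0 (Fin.last (n + 1)) = s := by
    rw [hMIJ, hb0, ← Fin.succ_last, hbs, hcl, hD.amb_ambPoint hy]
    simp [hessForm, hs]
  have hMs : ∀ i, M (Fin.succ i) 0 = M 0 (Fin.succ i) := fun i => by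
    rw [hMIJ, hMIJ, hD.amb_symm hy]
  -- The tractor `(0, 1)` is null and orthogonal to all tangent vectors, so the first row and first
  -- column of the Gram matrix have their only nonzero entry `s` in the last place. Expanding along
  -- both leaves the tangential Hessian.
  have hdetM : M.det = -s ^ 2
      * (Matrix.of fun α β => D.hessForm y (pd α D.F y) (pd β D.F y)).det := by
    rw [Matrix.det_succ_row_zero, Fin.sum_univ_castSucc]
    simp only [hM0, hM0l, mul_zero, zero_mul, Finset.sum_const_zero, zero_add,
      Fin.succAbove_last]
    rw [Matrix.det_succ_column_zero, Fin.sum_univ_castSucc]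
    have hc : ∀ i : Fin n, M.submatrix Fin.succ Fin.castSucc i.castSucc 0 = 0 := fun i => by
      rw [Matrix.submatrix_apply, Fin.castSucc_zero, hMs, Fin.succ_castSucc, hM0]
    have hcl' : M.submatrix Fin.succ Fin.castSucc (Fin.last n) 0 = s := by
      rw [Matrix.submatrix_apply, Fin.castSucc_zero, hMs, Fin.succ_last, hM0l]
    simp only [hc, hcl', mul_zero, zero_mul, Finset.sum_const_zero, zero_add, Fin.succAbove_last]
    have hH : (M.submatrix Fin.succ Fin.castSucc).submatrix Fin.castSucc Fin.succ
        = Matrix.of fun α β => D.hessForm y (pd α D.F y) (pd β D.F y) := by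
      ext α β
      simp only [Matrix.submatrix_apply, Matrix.of_apply, hMIJ, Fin.castSucc_succ, hbs, hcs,
        hD.amb_ambPoint hy, zero_mul, zero_add]
    rw [hH]
    simp only [Fin.val_last]
    -- These are the signs of the last entries in expansions of sizes `n + 2` and `n + 1`; their
    -- product is the Lorentzian sign.
    have : (-1 : ℝ) ^ (n + 1) * (-1) ^ n = -1 := by
      rw [← pow_add]
      exact Odd.neg_one_pow ⟨n, by ring⟩
    linear_combination (s ^ 2 *
      (Matrix.of fun α β => D.hessForm y (pd α D.F y) (pd β D.F y)).det) * this
  rw [← hdetM, hM, Matrix.det_mul, Matrix.det_mul, Matrix.det_transpose, hBdet]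
  ring

end IsFeffermanPatch
end LocalData

/-! ### The affine normal in terms of the defining function. -/

namespace LocalData

variable {n : ℕ} {D : LocalData n} {U : Set (Coord (n + 1))} {W : Set (Coord n)} {y : Coord n}

/-- The description of the affine normal through the Hessian of a Fefferman defining function. -/
structure IsUnitNormal (D : LocalData n) (W : Set (Coord n)) : Prop where
  smooth : ContDiffOn ℝ ∞ D.ξ W
  fderiv_ρ : ∀ y ∈ W, fderiv ℝ D.ρ (D.F y) (D.ξ y) = 1
  hessForm : ∀ y ∈ W, ∀ α, D.hessForm y (pd α D.F y) (D.ξ y) = 0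

namespace IsFeffermanPatch

variable (hD : D.IsFeffermanPatch U W)
include hD

/-- Insert `det g̃ = -vol²` and `Hess ρ = dρ(ξ) h` on `TM` into the Gram determinant: two factors
`dρ(ξ)` come from the expansion and `n` from the determinant of the Hessian. The volume condition on
`ξ` thus reads `dρ(ξ)^{n+2} = 1`. -/
lemma vol_sq_mul_det_frame_sq (hy : y ∈ W) (hξ : fderiv ℝ D.ρ (D.F y) (D.ξ y) ≠ 0) :
    (D.vol (D.F y) * |(D.frame y).det|) ^ 2
      = fderiv ℝ D.ρ (D.F y) (D.ξ y) ^ (n + 2) * (D.h y).det := by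
  have hB := hD.isUnit_det_frame hy hξ
  have h1 := hD.det_preAmbient_mul_det_frame hy
  have h2 : (Matrix.of fun α β => D.hessForm y (pd α D.F y) (pd β D.F y))
      = fderiv ℝ D.ρ (D.F y) (D.ξ y) • D.h y := by
    ext α β
    simp [hD.hessForm_pd_F_pd_F hy hB]
  rw [h2, Matrix.det_smul, Fintype.card_fin, hD.det y hy] at h1
  rw [mul_pow, sq_abs]
  linear_combination -h1

/-- The volume condition and `dρ(ξ) > 0` force `dρ(ξ) = 1`. With `dρ(ξ)` constant along `M`, the
component `Hess ρ (∂_αF, ξ)` is `-η_α`. -/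
lemma _root_.ConfCodazzi.LocalData.IsAffineNormal.isUnitNormal (hN : D.IsAffineNormal W) :
    D.IsUnitNormal W := by
  have h1 : ∀ y ∈ W, fderiv ℝ D.ρ (D.F y) (D.ξ y) = 1 := by
    intro y hy
    have hξ := hN.pos y hy
    have hp := (hD.h_posDef hy hξ).det_pos
    have h2 := hD.vol_sq_mul_det_frame_sq hy hξ.ne'
    rw [hN.volume y hy, Real.sq_sqrt hp.le] at h2
    have h3 : fderiv ℝ D.ρ (D.F y) (D.ξ y) ^ (n + 2) = 1 :=
      mul_right_cancel₀ hp.ne' (by rw [one_mul]; exact h2.symm)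
    exact (pow_eq_one_iff_of_nonneg hξ.le (by omega)).1 h3
  refine ⟨hN.smooth, h1, fun y hy α => ?_⟩
  have hB := hD.isUnit_det_frame hy (hN.pos y hy).ne'
  rw [hD.hessForm_pd_F_left hy (hN.smooth.diffAt hD.isOpen hy) h1, covAlong_ξ hB,
    hN.eta_eq_zero y hy]
  simp [hD.fderiv_ρ_pd_F hy]

lemma _root_.ConfCodazzi.LocalData.IsUnitNormal.isAffineNormal (hN : D.IsUnitNormal W) :
    D.IsAffineNormal W := by
  have hpos : ∀ y ∈ W, 0 < fderiv ℝ D.ρ (D.F y) (D.ξ y) := fun y hy => by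
    rw [hN.fderiv_ρ y hy]; exact one_pos
  refine ⟨hN.smooth, hpos, fun y hy => ?_, fun y hy α => ?_⟩
  · have h2 := hD.vol_sq_mul_det_frame_sq hy (hpos y hy).ne'
    rw [hN.fderiv_ρ y hy, one_pow, one_mul] at h2
    rw [← h2, Real.sqrt_sq]
    exact mul_nonneg (hD.scale.vol_pos _ (hD.mem y hy)).le (abs_nonneg _)
  · have hB := hD.isUnit_det_frame hy (hpos y hy).ne'
    have h1 := hD.hessForm_pd_F_left hy (hN.smooth.diffAt hD.isOpen hy) hN.fderiv_ρ α
    rw [hN.hessForm y hy, covAlong_ξ hB] at h1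
    simpa [hD.fderiv_ρ_pd_F hy, hN.fderiv_ρ y hy] using h1

/-- The affine normal is the `TN`-part of the first column of the inverse of `D D 𝐫`. -/
lemma isUnitNormal_of_inv (hξ : ∀ y ∈ W, D.ξ y
    = WithLp.toLp 2 fun i => (preAmbient D.Γ D.ρ (D.F y))⁻¹ i.succ 0) : D.IsUnitNormal W := by
  -- Row `0` of `g̃ g̃⁻¹ e₀ = e₀` is `dρ(ξ) = 1`, because `ρ = 0`. The other rows say that `Hess ρ
  -- (·, ξ)` is a multiple of `dρ`, hence zero on tangent vectors.
  have hcol : ∀ y ∈ W, ∀ I : Fin (n + 2), ∑ J, preAmbient D.Γ D.ρ (D.F y) I J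
      * (preAmbient D.Γ D.ρ (D.F y))⁻¹ J 0 = if I = 0 then 1 else 0 := by
    intro y hy I
    rw [← Matrix.mul_apply, Matrix.mul_nonsing_inv _ (hD.isUnit_det hy), Matrix.one_apply]
  refine ⟨?_, fun y hy => ?_, fun y hy α => ?_⟩
  · refine ContDiffOn.congr (contDiffOn_euclidean.2 fun i => ?_) hξ
    refine (contDiffOn_matrix_inv (U := W) (fun I J => ?_) (fun y hy => hD.isUnit_det hy) i.succ 0)
    exact (hD.scale.contDiffOn_preAmbient hD.contDiffOn_ρ I J).comp hD.contDiffOn_F hD.mem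
  · have h1 := hcol y hy 0
    rw [Fin.sum_univ_succ, preAmbient_zero_zero, hD.ρ_eq_zero y hy] at h1
    simp only [preAmbient_zero_succ, if_true, mul_zero, zero_mul, zero_add] at h1
    rw [fderiv_eq_sum_pd, hξ y hy, ← h1]
    exact Finset.sum_congr rfl fun i _ => by simp [mul_comm]
  · have h1 : ∀ i : Fin (n + 1), ∑ j, hess D.Γ D.ρ (D.F y) i j * D.ξ y j
        = -(preAmbient D.Γ D.ρ (D.F y))⁻¹ 0 0 * pd i D.ρ (D.F y) := by
      intro i
      have h2 := hcol y hy i.succ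
      rw [Fin.sum_univ_succ, preAmbient_succ_zero (hD.differentiableAt_ρ hy)] at h2
      simp only [preAmbient_succ_succ, hD.ρ_eq_zero y hy, mul_zero, zero_mul, add_zero,
        Fin.succ_ne_zero, if_false] at h2
      rw [hξ y hy]
      simp only
      linear_combination h2
    have h3 : D.hessForm y (pd α D.F y) (D.ξ y)
        = ∑ i, (pd α D.F y) i * ∑ j, hess D.Γ D.ρ (D.F y) i j * D.ξ y j := by
      simp only [LocalData.hessForm, Finset.mul_sum]
      exact Finset.sum_congr rfl fun i _ => Finset.sum_congr rfl fun j _ => by ring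
    have h4 := hD.fderiv_ρ_pd_F hy α
    rw [fderiv_eq_sum_pd] at h4
    rw [h3]
    simp only [h1]
    have h5 : ∑ i, (pd α D.F y) i * (-(preAmbient D.Γ D.ρ (D.F y))⁻¹ 0 0 * pd i D.ρ (D.F y))
        = -(preAmbient D.Γ D.ρ (D.F y))⁻¹ 0 0 * ∑ i, (pd α D.F y) i • pd i D.ρ (D.F y) := by
      rw [Finset.mul_sum]
      exact Finset.sum_congr rfl fun i _ => by simp only [smul_eq_mul]; ring
    rw [h5, h4, mul_zero]

end IsFeffermanPatch

/-- A Fefferman patch with its affine normal. -/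
structure IsNormalPatch (D : LocalData n) (U : Set (Coord (n + 1))) (W : Set (Coord n)) : Prop
    extends D.IsFeffermanPatch U W, D.IsUnitNormal W

/-! ### Components of the cubic form in the frame of the affine normal. -/

namespace IsNormalPatch

variable (hD : D.IsNormalPatch U W)
include hD

lemma isUnit_det_frame (hy : y ∈ W) : IsUnit (D.frame y).det :=
  hD.toIsFeffermanPatch.isUnit_det_frame hy (by rw [hD.fderiv_ρ y hy]; exact one_ne_zero)

lemma contDiffOn_covAlong {V : Coord n → Coord (n + 1)} (hV : ContDiffOn ℝ ∞ V W) (α : Fin n) :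
    ContDiffOn ℝ ∞ (fun y => covAlong D.Γ D.F V y α) W := by
  unfold covAlong
  refine (hV.pd hD.isOpen α).add (contDiffOn_euclidean.2 fun k => ?_)
  change ContDiffOn ℝ ∞ (fun y => ∑ i, ∑ j, D.Γ (D.F y) i j k * (pd α D.F y) i * V y j) W
  refine ContDiffOn.sum fun i _ => ContDiffOn.sum fun j _ => ?_
  refine ContDiffOn.mul (ContDiffOn.mul ?_ ?_) ?_
  · exact (hD.scale.contDiffOn_coeff i j k).comp hD.contDiffOn_F hD.mem
  · exact contDiffOn_euclidean_apply (hD.contDiffOn_F.pd hD.isOpen α) i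
  · exact contDiffOn_euclidean_apply hV j

lemma contDiffOn_frame (i j : Fin (n + 1)) : ContDiffOn ℝ ∞ (fun y => D.frame y i j) W := by
  refine Fin.lastCases ?_ (fun α => ?_) j
  · simpa [frame] using contDiffOn_euclidean_apply hD.smooth i
  · simpa [frame] using contDiffOn_euclidean_apply (hD.contDiffOn_F.pd hD.isOpen α) i

lemma contDiffOn_decomp {V : Coord n → Coord (n + 1)} (hV : ContDiffOn ℝ ∞ V W)
    (j : Fin (n + 1)) : ContDiffOn ℝ ∞ (fun y => D.decomp y (V y) j) W := by
  simp only [decomp, Matrix.mulVec, dotProduct]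
  refine ContDiffOn.sum fun i _ => ContDiffOn.mul ?_ (contDiffOn_euclidean_apply hV i)
  exact contDiffOn_matrix_inv hD.contDiffOn_frame (fun y hy => hD.isUnit_det_frame hy) j i

lemma contDiffOn_indConn (α β γ : Fin n) : ContDiffOn ℝ ∞ (fun y => D.indConn y α β γ) W :=
  hD.contDiffOn_decomp (hD.contDiffOn_covAlong (hD.contDiffOn_F.pd hD.isOpen β) α) _

lemma contDiffOn_h (α β : Fin n) : ContDiffOn ℝ ∞ (fun y => D.h y α β) W := by
  simp only [h, Matrix.of_apply]
  exact (hD.contDiffOn_decomp (hD.contDiffOn_covAlong (hD.contDiffOn_F.pd hD.isOpen β) α) _).neg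

lemma h_posDef (hy : y ∈ W) : (D.h y).PosDef :=
  hD.toIsFeffermanPatch.h_posDef hy (by rw [hD.fderiv_ρ y hy]; exact one_pos)

lemma isUnit_det_h (hy : y ∈ W) : IsUnit (D.h y).det :=
  isUnit_iff_ne_zero.2 (hD.h_posDef hy).det_pos.ne'

lemma contDiffOn_hInv (α β : Fin n) : ContDiffOn ℝ ∞ (fun y => D.hInv y α β) W :=
  contDiffOn_matrix_inv hD.contDiffOn_h (fun _ hy => hD.isUnit_det_h hy) α β

lemma contDiffOn_connH (α β γ : Fin n) : ContDiffOn ℝ ∞ (fun y => D.connH y α β γ) W := by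
  simp only [connH, leviCivita]
  refine contDiffOn_const.mul (ContDiffOn.sum fun δ _ => (hD.contDiffOn_hInv γ δ).mul ?_)
  exact (((hD.contDiffOn_h _ _).pd hD.isOpen _).add ((hD.contDiffOn_h _ _).pd hD.isOpen _)).sub
    ((hD.contDiffOn_h _ _).pd hD.isOpen _)

lemma contDiffOn_A (α β γ : Fin n) : ContDiffOn ℝ ∞ (fun y => D.A y α β γ) W :=
  (hD.contDiffOn_connH α β γ).sub (hD.contDiffOn_indConn α β γ)

lemma connH_symm (hy : y ∈ W) (α β γ : Fin n) : D.connH y α β γ = D.connH y β α γ := by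
  simp only [connH, leviCivita]
  congr 1
  refine Finset.sum_congr rfl fun δ _ => ?_
  rw [pd_congr_of_isOpen δ hD.isOpen hy fun z hz => hD.h_symm hz α β]
  ring

lemma A_symm (hy : y ∈ W) (α β γ : Fin n) : D.A y α β γ = D.A y β α γ := by
  rw [A, A, hD.connH_symm hy, hD.indConn_symm hy]

/-- `∇^h h = 0`. -/
lemma pd_h (hy : y ∈ W) (α β γ : Fin n) : pd α (fun z => D.h z β γ) y
    = ∑ δ, D.connH y α β δ * D.h y δ γ + ∑ δ, D.connH y α γ δ * D.h y β δ := by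
  have hs : ∀ α β γ, pd α (fun z => D.h z β γ) y = pd α (fun z => D.h z γ β) y := fun α β γ =>
    pd_congr_of_isOpen α hD.isOpen hy fun z hz => hD.h_symm hz β γ
  have h1 : ∀ α β γ, ∑ δ, D.connH y α β δ * D.h y δ γ = (1 / 2) *
      (pd α (fun z => D.h z β γ) y + pd β (fun z => D.h z α γ) y - pd γ (fun z => D.h z α β) y) :=
    fun α β γ => sum_leviCivita_mul (fun β γ => hD.h_symm hy β γ) (hD.isUnit_det_h hy) α β γ
  have h2 : ∑ δ, D.connH y α γ δ * D.h y β δ = ∑ δ, D.connH y α γ δ * D.h y δ β :=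
    Finset.sum_congr rfl fun δ _ => by rw [hD.h_symm hy]
  rw [h2, h1, h1, hs α γ β]
  ring

/-- The derivative of the Hessian of `ρ` along the hypersurface. -/
lemma pd_hessForm (hy : y ∈ W) {V V' : Coord n → Coord (n + 1)} (hV : DifferentiableAt ℝ V y)
    (hV' : DifferentiableAt ℝ V' y) (α : Fin n) :
    pd α (fun z => D.hessForm z (V z) (V' z)) y
      = D.hessForm y (covAlong D.Γ D.F V y α) (V' y)
        - D.projP y (pd α D.F y) (V y) * fderiv ℝ D.ρ (D.F y) (V' y)
        + D.hessForm y (V y) (covAlong D.Γ D.F V' y α)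
        - D.projP y (pd α D.F y) (V' y) * fderiv ℝ D.ρ (D.F y) (V y)
        + D.cubicForm y (pd α D.F y) (V y) (V' y) := by
  have h1 := hD.pd_amb hy (u := fun z => ambPoint 0 (V z)) (v := fun z => ambPoint 0 (V' z))
    (differentiableAt_ambPoint (differentiableAt_const _) hV)
    (differentiableAt_ambPoint (differentiableAt_const _) hV') α
  rw [projConn_ambPoint (fun _ => 0) V, projConn_ambPoint (fun _ => 0) V', ambBase_ambPoint,
    ambBase_ambPoint, hD.amb_ambPoint hy, hD.amb_ambPoint hy, pd_const] at h1
  have h2 : pd α (fun z => D.amb z (ambPoint 0 (V z)) (ambPoint 0 (V' z))) y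
      = pd α (fun z => D.hessForm z (V z) (V' z)) y := by
    refine pd_congr_of_isOpen α hD.isOpen hy fun z hz => ?_
    rw [hD.amb_ambPoint hz]
    simp
  rw [← h2, h1]
  simp only [zero_smul, add_zero]
  ring

lemma hessForm_pd_F_pd_F (hy : y ∈ W) (α β : Fin n) :
    D.hessForm y (pd α D.F y) (pd β D.F y) = D.h y α β := by
  rw [hD.toIsFeffermanPatch.hessForm_pd_F_pd_F hy (hD.isUnit_det_frame hy), hD.fderiv_ρ y hy,
    one_mul]

lemma covAlong_pd_F (hy : y ∈ W) (α β : Fin n) : covAlong D.Γ D.F (pd β D.F) y α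
    = ∑ γ, D.indConn y α β γ • pd γ D.F y - D.h y α β • D.ξ y :=
  LocalData.covAlong_pd_F (hD.isUnit_det_frame hy) α β

lemma covAlong_ξ (hy : y ∈ W) (α : Fin n) : covAlong D.Γ D.F D.ξ y α
    = ∑ γ, D.shape y α γ • pd γ D.F y := by
  rw [LocalData.covAlong_ξ (hD.isUnit_det_frame hy),
    (IsUnitNormal.isAffineNormal hD.toIsFeffermanPatch hD.toIsUnitNormal).eta_eq_zero y hy,
    zero_smul, add_zero]

lemma hessForm_pd_F_ξ (hy : y ∈ W) (α : Fin n) : D.hessForm y (pd α D.F y) (D.ξ y) = 0 :=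
  hD.hessForm y hy α

lemma hessForm_ξ_pd_F (hy : y ∈ W) (α : Fin n) : D.hessForm y (D.ξ y) (pd α D.F y) = 0 := by
  rw [hD.hessForm_symm hy, hD.hessForm_pd_F_ξ hy]

lemma differentiableAt_ξ (hy : y ∈ W) : DifferentiableAt ℝ D.ξ y := hD.smooth.diffAt hD.isOpen hy

/-- Differentiate `h_{βγ} = Hess ρ (∂_βF, ∂_γF)`. The tractor Leibniz rule uses `∇^ξ` and leaves the
cubic form, while `∇^h h = 0` leaves nothing; the difference of the connections is `A`. -/
lemma cubicForm_eq_ALow_add (hy : y ∈ W) (α β γ : Fin n) :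
    D.cubicForm y (pd α D.F y) (pd β D.F y) (pd γ D.F y) = D.ALow y α β γ + D.ALow y α γ β := by
  have h1 := hD.pd_hessForm hy (hD.differentiableAt_pd_F hy β) (hD.differentiableAt_pd_F hy γ) α
  have hc : ∀ β γ, D.hessForm y (pd γ D.F y) (covAlong D.Γ D.F (pd β D.F) y α)
      = ∑ δ, D.indConn y α β δ * D.h y γ δ := by
    intro β γ
    rw [hD.covAlong_pd_F hy, sub_eq_add_neg, ← neg_smul, hessForm_add_right, hessForm_smul_right,
      hD.hessForm_pd_F_ξ hy, mul_zero, add_zero, hessForm_sum_right]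
    exact Finset.sum_congr rfl fun δ _ => by
      rw [hessForm_smul_right, hD.hessForm_pd_F_pd_F hy]
  rw [pd_congr_of_isOpen α hD.isOpen hy fun z hz => hD.hessForm_pd_F_pd_F hz β γ,
    hD.hessForm_symm hy (covAlong _ _ _ _ _), hc, hc, hD.fderiv_ρ_pd_F hy, hD.fderiv_ρ_pd_F hy,
    hD.pd_h hy] at h1
  have h2 : ∀ β γ, D.ALow y α β γ = ∑ δ, D.connH y α β δ * D.h y γ δ
      - ∑ δ, D.indConn y α β δ * D.h y γ δ := by
    intro β γ
    rw [← Finset.sum_sub_distrib]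
    exact Finset.sum_congr rfl fun δ _ => by rw [A, hD.h_symm hy δ γ]; ring
  have h3 : ∑ δ, D.connH y α β δ * D.h y δ γ = ∑ δ, D.connH y α β δ * D.h y γ δ :=
    Finset.sum_congr rfl fun δ _ => by rw [hD.h_symm hy]
  rw [h2, h2, ← h3]
  linarith

lemma ALow_symm_left (hy : y ∈ W) (α β γ : Fin n) : D.ALow y α β γ = D.ALow y β α γ := by
  simp only [ALow, hD.A_symm hy α β]

/-- Up to the factor two, the Fubini–Pick form is the derivative of the ambient metric. -/
lemma cubicForm_pd_F (hy : y ∈ W) (α β γ : Fin n) :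
    D.cubicForm y (pd α D.F y) (pd β D.F y) (pd γ D.F y) = 2 * D.ALow y α β γ := by
  -- As `A` is symmetric in its first two indices, it has three values under permutations of `α, β,
  -- γ`. The pairwise sums of these all equal the totally symmetric cubic form, so each value is
  -- half of it.
  have h1 := hD.cubicForm_eq_ALow_add hy α β γ
  have h2 := hD.cubicForm_eq_ALow_add hy γ α β
  have h3 := hD.cubicForm_eq_ALow_add hy β γ α
  have e2 : D.cubicForm y (pd γ D.F y) (pd α D.F y) (pd β D.F y)
      = D.cubicForm y (pd α D.F y) (pd β D.F y) (pd γ D.F y) := by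
    rw [hD.cubicForm_symm_left hy, hD.cubicForm_symm_right hy]
  have e3 : D.cubicForm y (pd β D.F y) (pd γ D.F y) (pd α D.F y)
      = D.cubicForm y (pd α D.F y) (pd β D.F y) (pd γ D.F y) := by
    rw [hD.cubicForm_symm_right hy, hD.cubicForm_symm_left hy]
  rw [e2, hD.ALow_symm_left hy γ β α] at h2
  rw [e3, hD.ALow_symm_left hy β α γ] at h3
  rw [hD.ALow_symm_left hy α γ β] at h1
  linarith

lemma ALow_symm_right (hy : y ∈ W) (α β γ : Fin n) : D.ALow y α β γ = D.ALow y α γ β := by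
  have h1 := hD.cubicForm_eq_ALow_add hy α β γ
  rw [hD.cubicForm_pd_F hy] at h1
  linarith

/-- The shape operator with lowered index. -/
def _root_.ConfCodazzi.LocalData.shapeLow (D : LocalData n) (y : Coord n) (α β : Fin n) : ℝ :=
  ∑ γ, D.shape y α γ * D.h y γ β

/-- This is the derivative of `Hess ρ (∂_βF, ξ) = 0` along `M`. The Gauss formula contributes `Hess
ρ(ξ,ξ) h`, the Weingarten formula contributes `S`, and `P` enters through the scalar slot of the
tractor connection, paired with `dρ(ξ) = 1`. -/
lemma cubicForm_pd_F_ξ (hy : y ∈ W) (α β : Fin n) :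
    D.cubicForm y (pd α D.F y) (pd β D.F y) (D.ξ y) = D.projP y (pd α D.F y) (pd β D.F y)
      + D.hessForm y (D.ξ y) (D.ξ y) * D.h y α β - D.shapeLow y α β := by
  have h1 := hD.pd_hessForm hy (hD.differentiableAt_pd_F hy β) (hD.differentiableAt_ξ hy) α
  have hc : D.hessForm y (pd β D.F y) (covAlong D.Γ D.F D.ξ y α) = D.shapeLow y α β := by
    rw [hD.covAlong_ξ hy, hessForm_sum_right]
    exact Finset.sum_congr rfl fun γ _ => by
      rw [hessForm_smul_right, hD.hessForm_pd_F_pd_F hy, hD.h_symm hy]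
  have hc' : D.hessForm y (covAlong D.Γ D.F (pd β D.F) y α) (D.ξ y)
      = -(D.hessForm y (D.ξ y) (D.ξ y) * D.h y α β) := by
    rw [hD.hessForm_symm hy, hD.covAlong_pd_F hy, sub_eq_add_neg, ← neg_smul, hessForm_add_right,
      hessForm_smul_right, hessForm_sum_right]
    simp only [hessForm_smul_right, hD.hessForm_ξ_pd_F hy, mul_zero, Finset.sum_const_zero]
    ring
  rw [pd_congr_of_isOpen α hD.isOpen hy fun z hz => hD.hessForm_pd_F_ξ hz β, pd_const, hc, hc',
    hD.fderiv_ρ_pd_F hy, hD.fderiv_ρ y hy] at h1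
  linarith

/-- Since `∇_α ξ` is tangent to `M`, it is orthogonal to `ξ` for the Hessian. Only the Schouten
terms and the derivative of `Hess ρ(ξ,ξ)` survive. -/
lemma cubicForm_ξ_ξ (hy : y ∈ W) (α : Fin n) :
    D.cubicForm y (pd α D.F y) (D.ξ y) (D.ξ y) = 2 * D.projP y (pd α D.F y) (D.ξ y)
      + pd α (fun z => D.hessForm z (D.ξ z) (D.ξ z)) y := by
  have h1 := hD.pd_hessForm hy (hD.differentiableAt_ξ hy) (hD.differentiableAt_ξ hy) α
  have hc : D.hessForm y (D.ξ y) (covAlong D.Γ D.F D.ξ y α) = 0 := by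
    rw [hD.covAlong_ξ hy, hessForm_sum_right]
    simp only [hessForm_smul_right, hD.hessForm_ξ_pd_F hy, mul_zero, Finset.sum_const_zero]
  rw [hD.hessForm_symm hy (covAlong _ _ _ _ _), hc, hD.fderiv_ρ y hy] at h1
  linarith

end IsNormalPatch
end LocalData

lemma sum_comm_triple {ι κ₁ κ₂ κ₃ : Type*} [Fintype ι] [Fintype κ₁] [Fintype κ₂] [Fintype κ₃]
    (f : ι → κ₁ → κ₂ → κ₃ → ℝ) :
    ∑ a, ∑ i, ∑ j, ∑ k, f a i j k = ∑ i, ∑ j, ∑ k, ∑ a, f a i j k := by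
  rw [Finset.sum_comm]
  refine Finset.sum_congr rfl fun i _ => ?_
  rw [Finset.sum_comm]
  refine Finset.sum_congr rfl fun j _ => ?_
  rw [Finset.sum_comm]

/-! ### Curvature of a pullback connection. -/

section Curvature

variable {n m : ℕ} {Γ : Coeffs m} {F V : Coord n → Coord m} {U : Set (Coord m)} {W : Set (Coord n)}
  {y : Coord n}

/-- The curvature of a pullback connection. -/
lemma covAlong_comm (hU : IsOpen U) (hW : IsOpen W)
    (hΓ : ∀ i j k, ContDiffOn ℝ ∞ (fun x => Γ x i j k) U) (hF : ContDiffOn ℝ ∞ F W)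
    (hFU : ∀ z ∈ W, F z ∈ U) (hV : ContDiffOn ℝ ∞ V W) (hy : y ∈ W) (α β : Fin n) (k : Fin m)
    (hβ : DifferentiableAt ℝ (fun z => covAlong Γ F V z β) y)
    (hα : DifferentiableAt ℝ (fun z => covAlong Γ F V z α) y) :
    covAlong Γ F (fun z => covAlong Γ F V z β) y α k
        - covAlong Γ F (fun z => covAlong Γ F V z α) y β k
      = ∑ l, (∑ i, ∑ j, curv Γ (F y) i j k l * (pd α F y) i * (pd β F y) j) * V y l := by
  -- With the pulled-back connection form `θ`, the commutator is `dθ + θ ∧ θ`; the terms with second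
  -- derivatives of `F` cancel by symmetry.
  set θ : Fin n → Coord n → Fin m → Fin m → ℝ := fun α z k l =>
    ∑ i, Γ (F z) i l k * (pd α F z) i with hθ
  have hΓF : ∀ i j k, DifferentiableAt ℝ (fun z => Γ (F z) i j k) y := fun i j k =>
    ((hΓ i j k).comp hF hFU).diffAt hW hy
  have hFi : ∀ α i, DifferentiableAt ℝ (fun z => (pd α F z) i) y := fun α i =>
    (contDiffOn_euclidean_apply (hF.pd hW α) i).diffAt hW hy
  have hVl : ∀ l, ContDiffOn ℝ ∞ (fun z => V z l) W := contDiffOn_euclidean_apply hV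
  have hθd : ∀ α k l, DifferentiableAt ℝ (fun z => θ α z k l) y := fun α k l =>
    DifferentiableAt.fun_sum fun i _ => (hΓF i l k).fun_mul (hFi α i)
  have hcov : ∀ α, ∀ z ∈ W, ∀ k, covAlong Γ F V z α k
      = pd α (fun z => V z k) z + ∑ l, θ α z k l * V z l := by
    intro α z hz k
    rw [covAlong_apply (hV.diffAt hW hz), Finset.sum_comm]
    simp only [hθ, Finset.sum_mul]
  have hsecond : ∀ α β, DifferentiableAt ℝ (fun z => covAlong Γ F V z β) y →
      covAlong Γ F (fun z => covAlong Γ F V z β) y α k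
      = pd α (pd β fun z => V z k) y
        + ∑ l, (pd α (fun z => θ β z k l) y * V y l + θ β y k l * pd α (fun z => V z l) y)
        + ∑ l, θ α y k l * (pd β (fun z => V z l) y + ∑ q, θ β y l q * V y q) := by
    intro α β hd
    rw [covAlong_apply hd, pd_congr_of_isOpen α hW hy fun z hz => hcov β z hz k,
      pd_add α (((hVl k).pd hW β).diffAt hW hy) (DifferentiableAt.fun_sum fun l _ =>
        (hθd β k l).fun_mul ((hVl l).diffAt hW hy)), pd_sum α _ fun l _ =>
        (hθd β k l).fun_mul ((hVl l).diffAt hW hy)]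
    congr 1
    · congr 1
      exact Finset.sum_congr rfl fun l _ => pd_mul α (hθd β k l) ((hVl l).diffAt hW hy)
    · rw [Finset.sum_comm]
      refine Finset.sum_congr rfl fun l _ => ?_
      rw [← hcov β y hy l, Finset.sum_mul]
  have hpdθ : ∀ α β l, pd α (fun z => θ β z k l) y
      = ∑ i, ∑ j, pd j (fun x => Γ x i l k) (F y) * (pd α F y) j * (pd β F y) i
        + ∑ i, Γ (F y) i l k * (pd α (pd β F) y) i := by
    intro α β l
    rw [pd_sum α _ fun i _ => (hΓF i l k).fun_mul (hFi β i), ← Finset.sum_add_distrib]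
    refine Finset.sum_congr rfl fun i _ => ?_
    rw [pd_mul α (hΓF i l k) (hFi β i), pd_comp α ((hΓ i l k).diffAt hU (hFU y hy))
      (hF.diffAt hW hy), pd_euclidean α ((hF.pd hW β).diffAt hW hy), Finset.sum_mul]
    congr 1
    exact Finset.sum_congr rfl fun j _ => by ring
  have hcurv : ∀ l, ∑ i, ∑ j, curv Γ (F y) i j k l * (pd α F y) i * (pd β F y) j
      = pd α (fun z => θ β z k l) y - pd β (fun z => θ α z k l) y
        + ∑ q, (θ α y k q * θ β y q l - θ β y k q * θ α y q l) := by
    intro l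
    rw [hpdθ, hpdθ, pd_comm hF hW hy α β]
    have h1 : ∑ q, (θ α y k q * θ β y q l - θ β y k q * θ α y q l)
        = ∑ i, ∑ j, ∑ q, (Γ (F y) i q k * Γ (F y) j l q - Γ (F y) j q k * Γ (F y) i l q)
          * (pd α F y) i * (pd β F y) j := by
      have h2 : ∀ q, θ α y k q * θ β y q l - θ β y k q * θ α y q l
          = ∑ i, ∑ j, (Γ (F y) i q k * Γ (F y) j l q - Γ (F y) j q k * Γ (F y) i l q)
          * (pd α F y) i * (pd β F y) j := by
        intro q
        simp only [hθ]
        rw [Finset.sum_mul_sum, mul_comm (∑ i, Γ (F y) i q k * (pd β F y) i), Finset.sum_mul_sum,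
          ← Finset.sum_sub_distrib]
        refine Finset.sum_congr rfl fun i _ => ?_
        rw [← Finset.sum_sub_distrib]
        exact Finset.sum_congr rfl fun j _ => by ring
      simp only [h2]
      rw [Finset.sum_comm]
      refine Finset.sum_congr rfl fun i _ => ?_
      rw [Finset.sum_comm]
    rw [h1]
    have h3 : ∑ i, ∑ j, pd j (fun x => Γ x i l k) (F y) * (pd α F y) j * (pd β F y) i
        = ∑ i, ∑ j, pd i (fun x => Γ x j l k) (F y) * (pd α F y) i * (pd β F y) j :=
      Finset.sum_comm
    rw [h3]
    simp only [curv, add_mul, sub_mul, Finset.sum_add_distrib, Finset.sum_sub_distrib,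
      Finset.sum_mul]
    have h4 : ∑ i, ∑ j, pd j (fun x => Γ x i l k) (F y) * (pd α F y) i * (pd β F y) j
        = ∑ i, ∑ j, pd j (fun x => Γ x i l k) (F y) * (pd β F y) j * (pd α F y) i :=
      Finset.sum_congr rfl fun i _ => Finset.sum_congr rfl fun j _ => by ring
    rw [h4]
    ring
  rw [hsecond α β hβ, hsecond β α hα, pd_comm (hVl k) hW hy α β]
  simp only [hcurv, add_mul, sub_mul, mul_add, Finset.sum_add_distrib, Finset.sum_sub_distrib,
    Finset.sum_mul, Finset.mul_sum]
  have h5 : ∀ α β, ∑ l, ∑ q, θ α y k l * (θ β y l q * V y q)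
      = ∑ l, ∑ q, θ α y k q * θ β y q l * V y l := by
    intro α β
    rw [Finset.sum_comm]
    exact Finset.sum_congr rfl fun l _ => Finset.sum_congr rfl fun q _ => by ring
  rw [h5, h5]
  ring

end Curvature

/-! ### The Gauss equation and the trace of the cubic form. -/

namespace LocalData.IsNormalPatch

variable {n : ℕ} {D : LocalData n} {U : Set (Coord (n + 1))} {W : Set (Coord n)} {y : Coord n}
  (hD : D.IsNormalPatch U W)
include hD

lemma covAlong_comm (hy : y ∈ W) {V : Coord n → Coord (n + 1)} (hV : ContDiffOn ℝ ∞ V W)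
    (α β : Fin n) : covAlong D.Γ D.F (fun z => covAlong D.Γ D.F V z β) y α
        - covAlong D.Γ D.F (fun z => covAlong D.Γ D.F V z α) y β
      = D.projP y (pd β D.F y) (V y) • pd α D.F y - D.projP y (pd α D.F y) (V y) • pd β D.F y := by
  ext k
  rw [PiLp.sub_apply, ConfCodazzi.covAlong_comm hD.scale.isOpen hD.isOpen hD.scale.contDiffOn_coeff
    hD.contDiffOn_F hD.mem hV hy α β k ((hD.contDiffOn_covAlong hV β).diffAt hD.isOpen hy)
    ((hD.contDiffOn_covAlong hV α).diffAt hD.isOpen hy)]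
  simp only [hD.scale.curv_eq (hD.mem y hy), sub_mul, ite_mul, zero_mul, Finset.sum_sub_distrib,
    Finset.sum_ite_eq', Finset.mem_univ, if_true, PiLp.sub_apply,
    PiLp.smul_apply, smul_eq_mul, projP]
  have h1 : ∀ (i : Fin (n + 1)) (f : Fin (n + 1) → ℝ),
      (∑ j, if i = k then f j else 0) = if i = k then ∑ j, f j else 0 := by
    intro i f
    split_ifs <;> simp
  simp only [h1, Finset.sum_ite_eq', Finset.mem_univ, if_true]
  congr 1
  · simp only [Finset.sum_mul]
    rw [Finset.sum_comm]
    exact Finset.sum_congr rfl fun i _ => Finset.sum_congr rfl fun j _ => by ring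
  · simp only [Finset.sum_mul]
    rw [Finset.sum_comm]
    exact Finset.sum_congr rfl fun i _ => Finset.sum_congr rfl fun j _ => by ring

/-- The Gauss equation. -/
lemma curv_indConn (hy : y ∈ W) (α β γ δ : Fin n) : curv D.indConn y α β γ δ
    = D.h y β δ * D.shape y α γ - D.h y α δ * D.shape y β γ
      + (if α = γ then D.projP y (pd β D.F y) (pd δ D.F y) else 0)
      - (if β = γ then D.projP y (pd α D.F y) (pd δ D.F y) else 0) := by
  have hB := hD.isUnit_det_frame hy
  -- Differentiate the Gauss formula once more, applying the Gauss formula to `∂_γF` and the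
  -- Weingarten formula to `ξ`.
  have hsec : ∀ α β, covAlong D.Γ D.F (fun z => covAlong D.Γ D.F (pd δ D.F) z β) y α
      = ∑ γ, (pd α (fun z => D.indConn z β δ γ) y + ∑ q, D.indConn y β δ q * D.indConn y α q γ
          - D.h y β δ * D.shape y α γ) • pd γ D.F y
        + (-(∑ q, D.indConn y β δ q * D.h y α q) - pd α (fun z => D.h z β δ) y) • D.ξ y := by
    intro α β
    have hd1 : ∀ γ, DifferentiableAt ℝ (fun z => D.indConn z β δ γ) y := fun γ =>
      (hD.contDiffOn_indConn β δ γ).diffAt hD.isOpen hy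
    have hd2 : DifferentiableAt ℝ (fun z => -D.h z β δ) y :=
      ((hD.contDiffOn_h β δ).diffAt hD.isOpen hy).neg
    have hd3 := hD.differentiableAt_pd_F hy
    have hd4 := hD.differentiableAt_ξ hy
    rw [covAlong_congr α (Filter.eventuallyEq_of_mem (hD.isOpen.mem_nhds hy) fun z hz => by
      rw [hD.covAlong_pd_F hz, sub_eq_add_neg, ← neg_smul]),
      covAlong_add (DifferentiableAt.fun_sum fun γ _ => (hd1 γ).fun_smul (hd3 γ))
        (hd2.fun_smul hd4),
      covAlong_sum _ (fun γ => (hd1 γ).fun_smul (hd3 γ)), covAlong_smul hd2 hd4, pd_neg,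
      hD.covAlong_ξ hy]
    simp only [covAlong_smul (hd1 _) (hd3 _), hD.covAlong_pd_F hy, smul_sub, Finset.smul_sum,
      smul_smul, Finset.sum_add_distrib, Finset.sum_sub_distrib, add_smul, sub_smul, neg_smul,
      Finset.sum_smul, neg_mul, Finset.sum_neg_distrib]
    rw [Finset.sum_comm (f := fun x i => (D.indConn y β δ x * D.indConn y α x i) • pd i D.F y)]
    abel
  have h1 := hD.covAlong_comm hy (hD.contDiffOn_F.pd hD.isOpen δ) α β
  have hlhs : covAlong D.Γ D.F (fun z => covAlong D.Γ D.F (pd δ D.F) z β) y α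
        - covAlong D.Γ D.F (fun z => covAlong D.Γ D.F (pd δ D.F) z α) y β
      = ∑ γ, (curv D.indConn y α β γ δ - D.h y β δ * D.shape y α γ + D.h y α δ * D.shape y β γ)
          • pd γ D.F y
        + ((-(∑ q, D.indConn y β δ q * D.h y α q) - pd α (fun z => D.h z β δ) y)
          - (-(∑ q, D.indConn y α δ q * D.h y β q) - pd β (fun z => D.h z α δ) y)) • D.ξ y := by
    rw [hsec, hsec, add_sub_add_comm, ← Finset.sum_sub_distrib, ← sub_smul]
    congr 1
    refine Finset.sum_congr rfl fun γ _ => ?_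
    rw [← sub_smul]
    congr 1
    have : ∑ q, (D.indConn y α q γ * D.indConn y β δ q - D.indConn y β q γ * D.indConn y α δ q)
        = ∑ q, D.indConn y β δ q * D.indConn y α q γ
          - ∑ q, D.indConn y α δ q * D.indConn y β q γ := by
      rw [← Finset.sum_sub_distrib]
      exact Finset.sum_congr rfl fun q _ => by ring
    rw [curv, this]
    ring
  have hrhs : D.projP y (pd β D.F y) (pd δ D.F y) • pd α D.F y
        - D.projP y (pd α D.F y) (pd δ D.F y) • pd β D.F y
      = ∑ γ, ((if α = γ then D.projP y (pd β D.F y) (pd δ D.F y) else 0)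
      - (if β = γ then D.projP y (pd α D.F y) (pd δ D.F y) else 0)) • pd γ D.F y
        + (0 : ℝ) • D.ξ y := by
    simp [sub_smul, ite_smul, Finset.sum_sub_distrib]
  rw [hlhs, hrhs] at h1
  -- Only the tangential coefficient is compared; the coefficient of `ξ` is not needed.
  have h2 : D.decomp y _ γ.castSucc = D.decomp y _ γ.castSucc :=
    congrArg (fun v => D.decomp y v γ.castSucc) h1
  rw [decomp_castSucc hB, decomp_castSucc hB] at h2
  linarith

/-- The inverse of the ambient metric in the frame given by the affine normal. -/
lemma inv_preAmbient (hy : y ∈ W) : (preAmbient D.Γ D.ρ (D.F y))⁻¹ = Matrix.of fun I J =>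
    ∑ α, (∑ β, D.hInv y α β * ambPoint 0 (pd β D.F y) J) * ambPoint 0 (pd α D.F y) I
      + ambPoint (-(D.hessForm y (D.ξ y) (D.ξ y) / 2)) (D.ξ y) J * ambPoint 1 (0 : Coord (n + 1)) I
      + ambPoint 1 (0 : Coord (n + 1)) J
        * ambPoint (-(D.hessForm y (D.ξ y) (D.ξ y) / 2)) (D.ξ y) I := by
  -- This value makes the tractor `(ξ, -κ)` null. It is orthogonal to `TM` and pairs to `1` with the
  -- null tractor `(0, 1)`, so the frame is orthogonal apart from a hyperbolic pair and its dual
  -- basis is explicit.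
  set κ := D.hessForm y (D.ξ y) (D.ξ y) / 2 with hκ
  refine Matrix.inv_eq_left_inv (Matrix.ext_of_mulVec_single fun K => ?_)
  rw [Matrix.one_mulVec]
  generalize (Pi.single K 1 : Fin (n + 2) → ℝ) = v
  set v' : Coord (n + 2) := WithLp.toLp 2 v with hv'
  have hamb : ∀ u : Coord (n + 2),
      (∑ J, u J * (preAmbient D.Γ D.ρ (D.F y) *ᵥ v) J) = D.amb y u v' := fun u => rfl
  ext I
  have hlhs : ((Matrix.of fun I J =>
      ∑ α, (∑ β, D.hInv y α β * ambPoint 0 (pd β D.F y) J) * ambPoint 0 (pd α D.F y) I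
      + ambPoint (-κ) (D.ξ y) J * ambPoint 1 (0 : Coord (n + 1)) I
      + ambPoint 1 (0 : Coord (n + 1)) J * ambPoint (-κ) (D.ξ y) I)
        * preAmbient D.Γ D.ρ (D.F y)) *ᵥ v
      = fun I => ∑ α, (∑ β, D.hInv y α β * D.amb y (ambPoint 0 (pd β D.F y)) v')
          * ambPoint 0 (pd α D.F y) I
        + D.amb y (ambPoint (-κ) (D.ξ y)) v' * ambPoint 1 (0 : Coord (n + 1)) I
        + D.amb y (ambPoint 1 0) v' * ambPoint (-κ) (D.ξ y) I := by
    ext I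
    rw [← Matrix.mulVec_mulVec]
    simp only [← hamb]
    generalize preAmbient D.Γ D.ρ (D.F y) *ᵥ v = u
    simp only [Matrix.mulVec, dotProduct, Matrix.of_apply, add_mul, Finset.sum_add_distrib,
      Finset.sum_mul, Finset.mul_sum]
    congr 1
    · congr 1
      · rw [Finset.sum_comm]
        refine Finset.sum_congr rfl fun α _ => ?_
        rw [Finset.sum_comm]
        exact Finset.sum_congr rfl fun i _ => Finset.sum_congr rfl fun j _ => by ring
      · exact Finset.sum_congr rfl fun j _ => by ring
    · exact Finset.sum_congr rfl fun j _ => by ring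
  rw [hlhs]
  set w := ambBase v' with hw
  set a := D.decomp y w with ha
  have hvw : v' = ambPoint (v 0) w := (ambPoint_ambBase v').symm
  have hwd : w = ∑ γ, a γ.castSucc • pd γ D.F y + a (Fin.last n) • D.ξ y :=
    eq_sum_decomp (hD.isUnit_det_frame hy) w
  have h1 : fderiv ℝ D.ρ (D.F y) w = a (Fin.last n) := by
    rw [hwd]
    simp [hD.fderiv_ρ_pd_F hy, hD.fderiv_ρ y hy]
  have h2 : ∀ β, D.hessForm y (pd β D.F y) w = ∑ γ, D.h y β γ * a γ.castSucc := by
    intro β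
    rw [hwd, hessForm_add_right, hessForm_sum_right, hessForm_smul_right, hD.hessForm_pd_F_ξ hy,
      mul_zero, add_zero]
    exact Finset.sum_congr rfl fun γ _ => by
      rw [hessForm_smul_right, hD.hessForm_pd_F_pd_F hy, mul_comm]
  have h3 : D.hessForm y (D.ξ y) w = a (Fin.last n) * (2 * κ) := by
    rw [hwd, hessForm_add_right, hessForm_sum_right, hessForm_smul_right, hκ]
    simp only [hessForm_smul_right, hD.hessForm_ξ_pd_F hy, mul_zero, Finset.sum_const_zero]
    ring
  have h4 : ∀ α, ∑ β, D.hInv y α β * ∑ γ, D.h y β γ * a γ.castSucc = a α.castSucc := by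
    intro α
    have : (D.h y)⁻¹ *ᵥ (D.h y *ᵥ fun γ => a γ.castSucc) = fun γ => a γ.castSucc := by
      rw [Matrix.mulVec_mulVec, Matrix.nonsing_inv_mul _ (hD.isUnit_det_h hy), Matrix.one_mulVec]
    exact congrFun this α
  have hz : D.hessForm y 0 w = 0 := by simp [hessForm]
  rw [hvw]
  simp only [hD.amb_ambPoint hy, hD.fderiv_ρ_pd_F hy, hD.fderiv_ρ y hy, h1, h2, h3, hz, map_zero,
    mul_zero, zero_mul, zero_add, add_zero, mul_one, one_mul, h4]
  refine Fin.cases ?_ (fun i => ?_) I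
  · simp only [ambPoint_zero, mul_zero, Finset.sum_const_zero]
    ring
  · have : v i.succ = w i := rfl
    rw [this, hwd]
    simp [ambPoint_succ]

/-- The Fubini–Pick form of a Fefferman defining density is trace-free. -/
lemma sum_hInv_mul_cubicForm (hy : y ∈ W) (w : Coord (n + 1)) :
    ∑ α, ∑ β, D.hInv y α β * D.cubicForm y w (pd α D.F y) (pd β D.F y) = 0 := by
  have h1 : ∀ i, ∑ j : Fin (n + 1), ∑ k : Fin (n + 1), (∑ α, (∑ β, D.hInv y α β * (pd β D.F y) k)
      * (pd α D.F y) j) * cubic D.Γ D.ρ (D.F y) i j k = 0 := by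
    intro i
    have h2 := hD.scale.sum_inv_mul_cubic hD.contDiffOn_ρ (hD.mem y hy) (hD.isUnit_det hy) i
      (hD.pd_mongeAmpere y hy i)
    -- In both hyperbolic terms of the inverse one factor is the tractor `(0, 1)`, which has no `TN`
    -- part. Against the cubic form only the block `h^{αβ}` remains. The vector `w` may be
    -- transverse to `M`, since `𝒥[𝐫]` is stationary in all directions.
    simpa only [hD.inv_preAmbient hy, Matrix.of_apply, ambPoint_succ, PiLp.zero_apply, mul_zero,
      zero_mul, add_zero] using h2
  calc _ = ∑ i, w i * ∑ j : Fin (n + 1), ∑ k : Fin (n + 1),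
        (∑ α, (∑ β, D.hInv y α β * (pd β D.F y) k) * (pd α D.F y) j)
          * cubic D.Γ D.ρ (D.F y) i j k := by
        simp only [cubicForm, Finset.mul_sum, Finset.sum_mul]
        rw [Finset.sum_congr rfl fun α _ => sum_comm_triple _, sum_comm_triple]
        refine Finset.sum_congr rfl fun i _ => Finset.sum_congr rfl fun j _ =>
          Finset.sum_congr rfl fun k _ => Finset.sum_congr rfl fun α _ =>
          Finset.sum_congr rfl fun β _ => ?_
        ring
    _ = 0 := by simp only [h1, mul_zero, Finset.sum_const_zero]

end LocalData.IsNormalPatch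

/-! ### Matrix calculus for comparing two connections. -/

section MatrixDerivative

variable {n : ℕ} {ι : Type*} [Fintype ι] {B B' : Coord n → Matrix ι ι ℝ} {y : Coord n}
  {W : Set (Coord n)}

/-- The entrywise partial derivative of a matrix-valued function. -/
def pdMatrix (α : Fin n) (B : Coord n → Matrix ι ι ℝ) (y : Coord n) : Matrix ι ι ℝ :=
  Matrix.of fun i j => pd α (fun z => B z i j) y

lemma pdMatrix_mul (hB : ∀ i j, DifferentiableAt ℝ (fun z => B z i j) y)
    (hB' : ∀ i j, DifferentiableAt ℝ (fun z => B' z i j) y) (α : Fin n) :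
    pdMatrix α (fun z => B z * B' z) y = pdMatrix α B y * B' y + B y * pdMatrix α B' y := by
  ext i j
  simp only [pdMatrix, Matrix.of_apply, Matrix.mul_apply, Matrix.add_apply]
  rw [pd_sum α _ fun k _ => (hB i k).fun_mul (hB' k j), ← Finset.sum_add_distrib]
  exact Finset.sum_congr rfl fun k _ => pd_mul α (hB i k) (hB' k j)

omit [Fintype ι] in
lemma pdMatrix_add (hB : ∀ i j, DifferentiableAt ℝ (fun z => B z i j) y)
    (hB' : ∀ i j, DifferentiableAt ℝ (fun z => B' z i j) y) (α : Fin n) :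
    pdMatrix α (fun z => B z + B' z) y = pdMatrix α B y + pdMatrix α B' y := by
  ext i j
  simp only [pdMatrix, Matrix.of_apply, Matrix.add_apply]
  exact pd_add α (hB i j) (hB' i j)

omit [Fintype ι] in
lemma pdMatrix_transpose (α : Fin n) :
    pdMatrix α (fun z => (B z)ᵀ) y = (pdMatrix α B y)ᵀ := rfl

omit [Fintype ι] in
lemma pdMatrix_congr (hW : IsOpen W) (hy : y ∈ W) (α : Fin n) (h : ∀ z ∈ W, B z = B' z) :
    pdMatrix α B y = pdMatrix α B' y := by
  ext i j
  exact pd_congr_of_isOpen α hW hy fun z hz => by rw [h z hz]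

omit [Fintype ι] in
lemma pdMatrix_comm (hW : IsOpen W) (hy : y ∈ W)
    (hB : ∀ i j, ContDiffOn ℝ ∞ (fun z => B z i j) W) (α β : Fin n) :
    pdMatrix α (pdMatrix β B) y = pdMatrix β (pdMatrix α B) y := by
  ext i j
  exact pd_comm (hB i j) hW hy α β

end MatrixDerivative

section CurvatureAlgebra

variable {ι : Type*} [Fintype ι] {H C₁ C₂ A₁ A₂ R R' N dA₁₂ dA₂₁ dC₁₂ dC₂₁ : Matrix ι ι ℝ}

/-- The covariant exterior derivative of a difference tensor that is symmetric for a parallel metric,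
in terms of the curvature of the other connection. -/
lemma mul_add_mul_eq_of_symm
    (hR : R = dC₁₂ - dC₂₁ + C₂ * C₁ - C₁ * C₂)
    (hR' : R' = (dC₁₂ - dA₁₂) - (dC₂₁ - dA₂₁) + (C₂ - A₂) * (C₁ - A₁) - (C₁ - A₁) * (C₂ - A₂))
    (hN : N = dA₁₂ - dA₂₁ + A₂ * C₁ + C₂ * A₁ - A₁ * C₂ - C₁ * A₂)
    (hRH : R * H + H * Rᵀ = 0) (h₁ : A₁ * H = H * A₁ᵀ) (h₂ : A₂ * H = H * A₂ᵀ)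
    (h₁₂ : dA₁₂ * H + A₂ * (C₁ * H + H * C₁ᵀ) = (C₁ * H + H * C₁ᵀ) * A₂ᵀ + H * dA₁₂ᵀ)
    (h₂₁ : dA₂₁ * H + A₁ * (C₂ * H + H * C₂ᵀ) = (C₂ * H + H * C₂ᵀ) * A₁ᵀ + H * dA₂₁ᵀ) :
    N * H + N * H = -(R' * H + H * R'ᵀ) := by
  -- The curvature of `∇' + A` is that of `∇'`, plus the covariant exterior derivative of `A`, plus
  -- a commutator. Matrices carry the lower index in the rows, which reverses the usual order of
  -- products.
  have hRe : R = R' + N - A₂ * A₁ + A₁ * A₂ := by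
    rw [hR, hR', hN]
    noncomm_ring
  -- The derivative of an `H`-symmetric tensor by a connection with `∇H = 0` is again `H`-symmetric.
  have hNs : N * H = H * Nᵀ := by
    rw [hN]
    simp only [Matrix.transpose_sub, Matrix.transpose_add, Matrix.transpose_mul]
    linear_combination (norm := noncomm_ring) h₁₂ - h₂₁ + C₂ * h₁ - C₁ * h₂ - h₂ * C₁ᵀ + h₁ * C₂ᵀ
  -- The commutator of two `H`-symmetric endomorphisms is `H`-skew. As `R` is `H`-skew too, taking
  -- the `H`-symmetric part of `hRe` isolates `N`.
  have hAs : (A₁ * A₂ - A₂ * A₁) * H + H * (A₁ * A₂ - A₂ * A₁)ᵀ = 0 := by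
    simp only [Matrix.transpose_sub, Matrix.transpose_mul]
    linear_combination (norm := noncomm_ring) A₁ * h₂ - A₂ * h₁ + h₁ * A₂ᵀ - h₂ * A₁ᵀ
  have hRe' : R = R' + N + (A₁ * A₂ - A₂ * A₁) := by rw [hRe]; abel
  rw [hRe', Matrix.transpose_add, Matrix.transpose_add] at hRH
  linear_combination (norm := noncomm_ring) hRH - hAs + hNs

/-- The curvature of a metric connection is skew. -/
lemma curvature_mul_add_mul_transpose {d₁ d₂ : Matrix ι ι ℝ}
    (hR : R = dC₁₂ - dC₂₁ + C₂ * C₁ - C₁ * C₂) (hd₁ : d₁ = C₁ * H + H * C₁ᵀ)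
    (hd₂ : d₂ = C₂ * H + H * C₂ᵀ)
    (h : (dC₁₂ * H + C₂ * d₁) + (d₁ * C₂ᵀ + H * dC₁₂ᵀ)
      = (dC₂₁ * H + C₁ * d₂) + (d₂ * C₁ᵀ + H * dC₂₁ᵀ)) : R * H + H * Rᵀ = 0 := by
  rw [hR]
  rw [hd₁, hd₂] at h
  simp only [Matrix.transpose_sub, Matrix.transpose_add, Matrix.transpose_mul]
  linear_combination (norm := noncomm_ring) h

end CurvatureAlgebra

/-! ### The curvature of the affine metric through `S`, `P` and `A`. -/

namespace LocalData

variable {n : ℕ} (D : LocalData n)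

/-- The matrices of the Levi-Civita connection of the affine metric. -/
def connMatrix (α : Fin n) (y : Coord n) : Matrix (Fin n) (Fin n) ℝ :=
  Matrix.of fun δ γ => D.connH y α δ γ

/-- The matrices of the Fubini–Pick form. -/
def AMatrix (α : Fin n) (y : Coord n) : Matrix (Fin n) (Fin n) ℝ :=
  Matrix.of fun δ γ => D.A y α δ γ

/-- The tangential part of the projective Schouten tensor. -/
def tanP (y : Coord n) (α β : Fin n) : ℝ := D.projP y (pd α D.F y) (pd β D.F y)

/-- The trace of the tangential part of the projective Schouten tensor. -/
def trP (y : Coord n) : ℝ := ∑ α, ∑ β, D.hInv y α β * D.tanP y α β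

/-- The quadratic expression `A_{βε}{}^α A_{αδ}{}^ε` in the Fubini–Pick form. -/
def quadA (y : Coord n) (β δ : Fin n) : ℝ := ∑ α, ∑ ε, D.A y α δ ε * D.A y β ε α

variable {D} {U : Set (Coord (n + 1))} {W : Set (Coord n)} {y : Coord n}

namespace IsNormalPatch

variable (hD : D.IsNormalPatch U W) (hy : y ∈ W)
include hD hy

lemma hInv_symm (α β : Fin n) : D.hInv y α β = D.hInv y β α := by
  have hs : (D.h y)ᵀ = D.h y := by
    ext α β
    exact hD.h_symm hy β α
  have h := congrFun (congrFun (Matrix.transpose_nonsing_inv (D.h y)) β) α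
  rw [hs, Matrix.transpose_apply] at h
  exact h

lemma sum_hInv_mul_h (α γ : Fin n) :
    ∑ β, D.hInv y α β * D.h y β γ = if α = γ then 1 else 0 := by
  have h := congrFun (congrFun (Matrix.nonsing_inv_mul _ (hD.isUnit_det_h hy)) α) γ
  rwa [Matrix.mul_apply, Matrix.one_apply] at h

lemma sum_h_mul_hInv (α γ : Fin n) :
    ∑ β, D.h y α β * D.hInv y β γ = if α = γ then 1 else 0 := by
  have h := congrFun (congrFun (Matrix.mul_nonsing_inv _ (hD.isUnit_det_h hy)) α) γ
  rwa [Matrix.mul_apply, Matrix.one_apply] at h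

lemma sum_sum_mul_h_mul_hInv (f : Fin n → ℝ) (γ : Fin n) :
    ∑ β, (∑ δ, f δ * D.h y δ β) * D.hInv y β γ = f γ := by
  simp only [Finset.sum_mul]
  rw [Finset.sum_comm]
  simp only [mul_assoc, ← Finset.mul_sum, hD.sum_h_mul_hInv hy, mul_ite, mul_one, mul_zero,
    Finset.sum_ite_eq', Finset.mem_univ, if_true]

lemma sum_sum_mul_hInv_mul_h (f : Fin n → ℝ) (γ : Fin n) :
    ∑ β, (∑ δ, f δ * D.hInv y δ β) * D.h y β γ = f γ := by
  simp only [Finset.sum_mul]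
  rw [Finset.sum_comm]
  simp only [mul_assoc, ← Finset.mul_sum, hD.sum_hInv_mul_h hy, mul_ite, mul_one, mul_zero,
    Finset.sum_ite_eq', Finset.mem_univ, if_true]

lemma A_eq_sum_ALow (α β γ : Fin n) : D.A y α β γ = ∑ δ, D.ALow y α β δ * D.hInv y δ γ :=
  (hD.sum_sum_mul_h_mul_hInv hy (D.A y α β) γ).symm

/-- Apolarity: the cubic form is trace-free in a tangent direction, and there it is `2A`. -/
lemma sum_A_trace (α : Fin n) : ∑ γ, D.A y α γ γ = 0 := by
  have h1 := hD.sum_hInv_mul_cubicForm hy (pd α D.F y)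
  simp only [hD.cubicForm_pd_F hy] at h1
  simp only [hD.A_eq_sum_ALow hy]
  have h2 : ∑ γ, ∑ δ, D.hInv y γ δ * (2 * D.ALow y α γ δ)
      = 2 * ∑ γ, ∑ δ, D.ALow y α γ δ * D.hInv y δ γ := by
    simp only [Finset.mul_sum]
    exact Finset.sum_congr rfl fun γ _ => Finset.sum_congr rfl fun δ _ => by
      rw [hD.hInv_symm hy δ γ]; ring
  linarith

lemma sum_hInv_mul_shapeLow : ∑ α, ∑ β, D.hInv y α β * D.shapeLow y α β = D.trS y := by
  refine Finset.sum_congr rfl fun α _ => ?_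
  rw [← hD.sum_sum_mul_h_mul_hInv hy (D.shape y α) α]
  exact Finset.sum_congr rfl fun β _ => by rw [shapeLow, hD.hInv_symm hy α β]; ring

lemma sum_hInv_mul_h_trace : ∑ α, ∑ β, D.hInv y α β * D.h y α β = n := by
  have : ∀ α, ∑ β, D.hInv y α β * D.h y α β = 1 := by
    intro α
    rw [← if_pos (rfl : α = α) (α := ℝ) (t := 1) (e := 0), ← hD.sum_hInv_mul_h hy α α]
    exact Finset.sum_congr rfl fun β _ => by rw [hD.h_symm hy]
  simp [this]

/-- The same trace-freeness, now in the direction `ξ`, where the cubic form is `P + Hess ρ(ξ,ξ) h -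
S`. -/
lemma nat_mul_hessForm_ξ : n * D.hessForm y (D.ξ y) (D.ξ y) = D.trS y - D.trP y := by
  have h1 := hD.sum_hInv_mul_cubicForm hy (D.ξ y)
  have h2 : ∀ α β, D.cubicForm y (D.ξ y) (pd α D.F y) (pd β D.F y) = D.tanP y α β
      + D.hessForm y (D.ξ y) (D.ξ y) * D.h y α β - D.shapeLow y α β := by
    intro α β
    rw [hD.cubicForm_symm_left hy, hD.cubicForm_symm_right hy, hD.cubicForm_pd_F_ξ hy]
    rfl
  have h3 : ∑ α, ∑ β, D.hInv y α β * (D.tanP y α β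
      + D.hessForm y (D.ξ y) (D.ξ y) * D.h y α β - D.shapeLow y α β)
      = D.trP y + D.hessForm y (D.ξ y) (D.ξ y) * ∑ α, ∑ β, D.hInv y α β * D.h y α β
        - ∑ α, ∑ β, D.hInv y α β * D.shapeLow y α β := by
    simp only [trP, Finset.mul_sum, ← Finset.sum_add_distrib, ← Finset.sum_sub_distrib]
    exact Finset.sum_congr rfl fun γ _ => Finset.sum_congr rfl fun δ _ => by ring
  simp only [h2] at h1
  rw [h3, hD.sum_hInv_mul_h_trace hy, hD.sum_hInv_mul_shapeLow hy] at h1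
  linarith

lemma AMatrix_mul_h (α : Fin n) : D.AMatrix α y * D.h y = D.h y * (D.AMatrix α y)ᵀ := by
  ext β γ
  have h1 : (D.AMatrix α y * D.h y) β γ = D.ALow y α β γ := rfl
  have h2 : (D.h y * (D.AMatrix α y)ᵀ) β γ = D.ALow y α γ β := by
    simp only [Matrix.mul_apply, Matrix.transpose_apply, AMatrix, Matrix.of_apply, ALow]
    exact Finset.sum_congr rfl fun δ _ => by rw [hD.h_symm hy]; ring
  rw [h1, h2, hD.ALow_symm_right hy]

lemma pdMatrix_h (α : Fin n) : pdMatrix α D.h y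
    = D.connMatrix α y * D.h y + D.h y * (D.connMatrix α y)ᵀ := by
  ext β γ
  simp only [pdMatrix, Matrix.of_apply, hD.pd_h hy, Matrix.add_apply, Matrix.mul_apply,
    Matrix.transpose_apply, connMatrix]
  congr 1
  exact Finset.sum_congr rfl fun δ _ => mul_comm _ _

lemma differentiableAt_connMatrix (α i j : Fin n) :
    DifferentiableAt ℝ (fun z => D.connMatrix α z i j) y :=
  (hD.contDiffOn_connH α i j).diffAt hD.isOpen hy

lemma differentiableAt_AMatrix (α i j : Fin n) :
    DifferentiableAt ℝ (fun z => D.AMatrix α z i j) y :=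
  (hD.contDiffOn_A α i j).diffAt hD.isOpen hy

lemma differentiableAt_h (i j : Fin n) : DifferentiableAt ℝ (fun z => D.h z i j) y :=
  (hD.contDiffOn_h i j).diffAt hD.isOpen hy

lemma pdMatrix_AMatrix_mul_h (α β : Fin n) : pdMatrix α (D.AMatrix β) y * D.h y
      + D.AMatrix β y * (D.connMatrix α y * D.h y + D.h y * (D.connMatrix α y)ᵀ)
    = (D.connMatrix α y * D.h y + D.h y * (D.connMatrix α y)ᵀ) * (D.AMatrix β y)ᵀ
      + D.h y * (pdMatrix α (D.AMatrix β) y)ᵀ := by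
  have h1 := pdMatrix_congr hD.isOpen hy α fun z hz => hD.AMatrix_mul_h hz β
  rw [pdMatrix_mul (hD.differentiableAt_AMatrix hy β) (hD.differentiableAt_h hy),
    pdMatrix_mul (B' := fun z => (D.AMatrix β z)ᵀ) (hD.differentiableAt_h hy)
      (fun i j => hD.differentiableAt_AMatrix hy β j i), pdMatrix_transpose, hD.pdMatrix_h hy] at h1
  exact h1

omit hD hy in
lemma curv_connH_matrix (α β : Fin n) : (Matrix.of fun δ γ => curv D.connH y α β γ δ)
    = pdMatrix α (D.connMatrix β) y - pdMatrix β (D.connMatrix α) y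
      + D.connMatrix β y * D.connMatrix α y - D.connMatrix α y * D.connMatrix β y := by
  ext δ γ
  simp only [Matrix.of_apply, curv, pdMatrix, Matrix.sub_apply, Matrix.add_apply, Matrix.mul_apply,
    connMatrix, Finset.sum_sub_distrib]
  simp only [mul_comm (D.connH y β δ _), mul_comm (D.connH y α δ _)]
  ring

lemma curv_connH_mul_h (α β : Fin n) : (Matrix.of fun δ γ => curv D.connH y α β γ δ) * D.h y
    + D.h y * (Matrix.of fun δ γ => curv D.connH y α β γ δ)ᵀ = 0 := by
  refine curvature_mul_add_mul_transpose (curv_connH_matrix α β) (hD.pdMatrix_h hy α)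
    (hD.pdMatrix_h hy β) ?_
  have h1 := pdMatrix_comm hD.isOpen hy hD.contDiffOn_h α β
  have h2 : ∀ α β, pdMatrix α (pdMatrix β D.h) y
      = (pdMatrix α (D.connMatrix β) y * D.h y + D.connMatrix β y * pdMatrix α D.h y)
        + (pdMatrix α D.h y * (D.connMatrix β y)ᵀ + D.h y * (pdMatrix α (D.connMatrix β) y)ᵀ) := by
    intro α β
    have hc := hD.differentiableAt_connMatrix hy β
    have hh := hD.differentiableAt_h hy
    rw [pdMatrix_congr hD.isOpen hy α fun z hz => hD.pdMatrix_h hz β,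
      pdMatrix_add (B := fun z => D.connMatrix β z * D.h z)
        (B' := fun z => D.h z * (D.connMatrix β z)ᵀ)
        (y := y) (fun i j => DifferentiableAt.fun_sum (u := Finset.univ)
          fun k _ => (hc i k).fun_mul (hh k j))
        (fun i j => DifferentiableAt.fun_sum (u := Finset.univ)
          fun k _ => (hh i k).fun_mul (hc j k)),
      pdMatrix_mul hc hh, pdMatrix_mul (B' := fun z => (D.connMatrix β z)ᵀ) hh fun i j => hc j i,
      pdMatrix_transpose]
  rw [h2, h2] at h1
  exact h1

lemma curv_indConn_matrix (α β : Fin n) : (Matrix.of fun δ γ => curv D.indConn y α β γ δ)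
    = (pdMatrix α (D.connMatrix β) y - pdMatrix α (D.AMatrix β) y)
      - (pdMatrix β (D.connMatrix α) y - pdMatrix β (D.AMatrix α) y)
      + (D.connMatrix β y - D.AMatrix β y) * (D.connMatrix α y - D.AMatrix α y)
      - (D.connMatrix α y - D.AMatrix α y) * (D.connMatrix β y - D.AMatrix β y) := by
  have hpd : ∀ α β δ γ, pd α (fun z => D.indConn z β δ γ) y
      = pd α (fun z => D.connH z β δ γ) y - pd α (fun z => D.A z β δ γ) y := by
    intro α β δ γ
    rw [← pd_sub α ((hD.contDiffOn_connH β δ γ).diffAt hD.isOpen hy)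
      ((hD.contDiffOn_A β δ γ).diffAt hD.isOpen hy)]
    simp only [A, sub_sub_cancel]
  have hi : ∀ α β γ, D.indConn y α β γ = D.connH y α β γ - D.A y α β γ := fun α β γ => by
    rw [A, sub_sub_cancel]
  ext δ γ
  simp only [Matrix.of_apply, curv, pdMatrix, Matrix.sub_apply, Matrix.add_apply, Matrix.mul_apply,
    connMatrix, AMatrix, Finset.sum_sub_distrib, hpd, hi]
  simp only [mul_comm (D.connH y β δ _ - D.A y β δ _), mul_comm (D.connH y α δ _ - D.A y α δ _)]
  ring

/-- The skew-symmetrized covariant derivative of the Fubini–Pick form. -/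
def _root_.ConfCodazzi.LocalData.dA (D : LocalData n) (y : Coord n) (α β : Fin n) :
    Matrix (Fin n) (Fin n) ℝ :=
  pdMatrix α (D.AMatrix β) y - pdMatrix β (D.AMatrix α) y + D.AMatrix β y * D.connMatrix α y
    + D.connMatrix β y * D.AMatrix α y - D.AMatrix α y * D.connMatrix β y
    - D.connMatrix α y * D.AMatrix β y

/-- The curvature of `∇^h` is skew for `h`, so the part of the curvature of `∇^ξ` symmetric for `h`
is balanced by the exterior derivative of `A`. Together with the Gauss equation this determines that
derivative from `S` and `P`. -/
lemma dA_mul_h_add_self (α β : Fin n) : D.dA y α β * D.h y + D.dA y α β * D.h y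
    = -((Matrix.of fun δ γ => curv D.indConn y α β γ δ) * D.h y
      + D.h y * (Matrix.of fun δ γ => curv D.indConn y α β γ δ)ᵀ) :=
  mul_add_mul_eq_of_symm (curv_connH_matrix α β) (hD.curv_indConn_matrix hy α β) rfl
    (hD.curv_connH_mul_h hy α β) (hD.AMatrix_mul_h hy α) (hD.AMatrix_mul_h hy β)
    (hD.pdMatrix_AMatrix_mul_h hy α β) (hD.pdMatrix_AMatrix_mul_h hy β α)

lemma pd_A_trace (β δ : Fin n) : ∑ α, pd β (fun z => D.A z α δ α) y = 0 := by
  rw [← pd_sum β _ fun α _ => (hD.contDiffOn_A α δ α).diffAt hD.isOpen hy,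
    pd_congr_of_isOpen β hD.isOpen hy (g := fun _ => 0) fun z hz => ?_, pd_const]
  rw [← hD.sum_A_trace hz δ]
  exact Finset.sum_congr rfl fun α _ => hD.A_symm hz α δ α

/-- Contracting `∇_α A_{βδ}{}^γ - ∇_β A_{αδ}{}^γ` over `α = γ` leaves the divergence, because the
second term differentiates a vanishing trace. -/
lemma sum_dA_trace (β δ : Fin n) : ∑ α, D.dA y α β δ α = D.divA y β δ := by
  simp only [dA, Matrix.sub_apply, Matrix.add_apply, Matrix.mul_apply, pdMatrix, Matrix.of_apply,
    AMatrix, connMatrix, Finset.sum_add_distrib, Finset.sum_sub_distrib, divA, hD.pd_A_trace hy]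
  have h1 : ∑ α, ∑ q, D.connH y β δ q * D.A y α q α = 0 := by
    rw [Finset.sum_comm]
    simp only [← Finset.mul_sum]
    refine Finset.sum_eq_zero fun q _ => ?_
    rw [← mul_zero (D.connH y β δ q), ← hD.sum_A_trace hy q]
    congr 1
    exact Finset.sum_congr rfl fun α _ => hD.A_symm hy α q α
  have h2 : ∑ α, ∑ q, D.A y α δ q * D.connH y β q α
      = ∑ α, ∑ q, D.connH y α β q * D.A y q δ α := by
    rw [Finset.sum_comm]
    exact Finset.sum_congr rfl fun α _ => Finset.sum_congr rfl fun q _ => by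
      rw [hD.connH_symm hy β α]; ring
  have h3 : ∑ α, ∑ q, D.A y β δ q * D.connH y α q α = ∑ α, ∑ q, D.connH y α q α * D.A y β δ q :=
    Finset.sum_congr rfl fun α _ => Finset.sum_congr rfl fun q _ => mul_comm _ _
  rw [h1, h2, h3]
  ring

lemma sum_curv_indConn (β δ : Fin n) : ∑ α, curv D.indConn y α β α δ
    = D.trS y * D.h y β δ - D.shapeLow y β δ + ((n : ℝ) - 1) * D.tanP y β δ := by
  have h1 : ∑ α, D.h y α δ * D.shape y β α = D.shapeLow y β δ :=
    Finset.sum_congr rfl fun α _ => mul_comm _ _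
  have h2 : ∑ α, D.h y β δ * D.shape y α α = D.trS y * D.h y β δ := by
    rw [← Finset.mul_sum, mul_comm]; rfl
  simp only [hD.curv_indConn hy, Finset.sum_add_distrib, Finset.sum_sub_distrib, if_true, h1, h2,
    Finset.sum_const, Finset.card_univ, Fintype.card_fin, nsmul_eq_mul, Finset.sum_ite_eq,
    Finset.mem_univ]
  simp only [tanP]
  ring

lemma curv_indConn_mul_h (α β δ ε : Fin n) :
    ((Matrix.of fun δ γ => curv D.indConn y α β γ δ) * D.h y) δ ε
      = D.h y β δ * D.shapeLow y α ε - D.h y α δ * D.shapeLow y β ε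
        + D.h y α ε * D.tanP y β δ - D.h y β ε * D.tanP y α δ := by
  simp only [Matrix.mul_apply, Matrix.of_apply, hD.curv_indConn hy, add_mul, sub_mul, ite_mul,
    zero_mul, Finset.sum_add_distrib, Finset.sum_sub_distrib, Finset.sum_ite_eq, Finset.mem_univ,
    if_true, mul_assoc, ← Finset.mul_sum]
  simp only [shapeLow, tanP]
  ring

/-- The divergence of the Fubini–Pick form. -/
lemma divA_eq (β δ : Fin n) : D.divA y β δ
    = (n / 2 : ℝ) * (D.shapeLow y β δ - D.tanP y β δ)
      - (1 / 2) * (D.trS y - D.trP y) * D.h y β δ := by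
  -- Raise the last index of the symmetrized Gauss equation; the traces `t1` to `t4` evaluate the
  -- transposed half.
  have hN : ∀ α, 2 * D.dA y α β δ α = -(curv D.indConn y α β α δ
      + ∑ ε, (D.h y β ε * D.shapeLow y α δ - D.h y α ε * D.shapeLow y β δ
        + D.h y α δ * D.tanP y β ε - D.h y β δ * D.tanP y α ε) * D.hInv y ε α) := by
    intro α
    have h1 := hD.dA_mul_h_add_self hy α β
    have h2 : ∀ ε, ((D.h y * (Matrix.of fun δ γ => curv D.indConn y α β γ δ)ᵀ) δ ε)
        = D.h y β ε * D.shapeLow y α δ - D.h y α ε * D.shapeLow y β δ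
        + D.h y α δ * D.tanP y β ε - D.h y β δ * D.tanP y α ε := by
      intro ε
      rw [← hD.curv_indConn_mul_h hy α β ε δ, Matrix.mul_apply, Matrix.mul_apply]
      exact Finset.sum_congr rfl fun q _ => by
        rw [Matrix.transpose_apply, hD.h_symm hy]; ring
    have h3 := congrFun (congrFun (congrArg (fun X : Matrix (Fin n) (Fin n) ℝ => X * (D.h y)⁻¹) h1)
      δ) α
    have h4 : ∀ X : Matrix (Fin n) (Fin n) ℝ, X * D.h y * (D.h y)⁻¹ = X := fun X => by
      rw [Matrix.mul_assoc, Matrix.mul_nonsing_inv _ (hD.isUnit_det_h hy), Matrix.mul_one]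
    simp only [Matrix.add_mul, Matrix.neg_mul, h4] at h3
    rw [Matrix.add_apply, Matrix.neg_apply, Matrix.add_apply, Matrix.of_apply,
      Matrix.mul_apply] at h3
    simp only [h2] at h3
    rw [two_mul]
    exact h3
  have hsum := Finset.sum_congr (rfl : (Finset.univ : Finset (Fin n)) = _) fun α _ => hN α
  rw [← Finset.mul_sum, hD.sum_dA_trace hy, Finset.sum_neg_distrib, Finset.sum_add_distrib,
    hD.sum_curv_indConn hy] at hsum
  have t1 : ∑ α, ∑ ε, D.h y β ε * D.shapeLow y α δ * D.hInv y ε α = D.shapeLow y β δ := by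
    have : ∀ α, ∑ ε, D.h y β ε * D.shapeLow y α δ * D.hInv y ε α
        = D.shapeLow y α δ * if β = α then 1 else 0 := by
      intro α
      rw [← hD.sum_h_mul_hInv hy, Finset.mul_sum]
      exact Finset.sum_congr rfl fun ε _ => by ring
    simp [this]
  have t2 : ∑ α, ∑ ε, D.h y α ε * D.shapeLow y β δ * D.hInv y ε α = n * D.shapeLow y β δ := by
    rw [← hD.sum_hInv_mul_h_trace hy, Finset.sum_mul]
    refine Finset.sum_congr rfl fun α _ => ?_
    rw [Finset.sum_mul]
    exact Finset.sum_congr rfl fun ε _ => by rw [hD.hInv_symm hy ε α]; ring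
  have t3 : ∑ α, ∑ ε, D.h y α δ * D.tanP y β ε * D.hInv y ε α = D.tanP y β δ := by
    rw [← hD.sum_sum_mul_hInv_mul_h hy (D.tanP y β) δ]
    refine Finset.sum_congr rfl fun α _ => ?_
    rw [Finset.sum_mul]
    exact Finset.sum_congr rfl fun ε _ => by ring
  have t4 : ∑ α, ∑ ε, D.h y β δ * D.tanP y α ε * D.hInv y ε α = D.h y β δ * D.trP y := by
    rw [trP, Finset.mul_sum]
    refine Finset.sum_congr rfl fun α _ => ?_
    rw [Finset.mul_sum]
    exact Finset.sum_congr rfl fun ε _ => by rw [hD.hInv_symm hy ε α]; ring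
  simp only [add_mul, sub_mul, Finset.sum_add_distrib, Finset.sum_sub_distrib, t1, t2, t3, t4]
    at hsum
  linarith

/-- Trace the curvature of `∇^ξ + A`: it gives the Ricci tensor of `∇^ξ`, plus `δA`, plus quadratic
terms, of which one vanishes by apolarity and the other is `quadA`. -/
lemma ricci_connH (β δ : Fin n) : ricci D.connH y β δ
    = (1 / 2) * (D.trS y + D.trP y) * D.h y β δ
      + ((n : ℝ) / 2 - 1) * (D.shapeLow y β δ + D.tanP y β δ) + D.quadA y β δ := by
  have h1 : ∀ α, curv D.connH y α β α δ = curv D.indConn y α β α δ + D.dA y α β δ α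
      - ∑ q, D.A y β δ q * D.A y α q α + ∑ q, D.A y α δ q * D.A y β q α := by
    intro α
    have e1 := congrFun (congrFun (curv_connH_matrix (D := D) (y := y) α β) δ) α
    have e2 := congrFun (congrFun (hD.curv_indConn_matrix hy α β) δ) α
    rw [Matrix.of_apply] at e1 e2
    have e3 : ∑ q, D.A y β δ q * D.A y α q α = (D.AMatrix β y * D.AMatrix α y) δ α := rfl
    have e4 : ∑ q, D.A y α δ q * D.A y β q α = (D.AMatrix α y * D.AMatrix β y) δ α := rfl
    rw [e1, e2, e3, e4, dA, ← Matrix.add_apply, ← Matrix.sub_apply, ← Matrix.add_apply]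
    refine congrFun (congrFun ?_ δ) α
    noncomm_ring
  have h2 : ∑ α, ∑ q, D.A y β δ q * D.A y α q α = 0 := by
    rw [Finset.sum_comm]
    simp only [← Finset.mul_sum]
    refine Finset.sum_eq_zero fun q _ => ?_
    rw [← mul_zero (D.A y β δ q), ← hD.sum_A_trace hy q]
    congr 1
    exact Finset.sum_congr rfl fun α _ => hD.A_symm hy α q α
  simp only [ricci, h1, Finset.sum_add_distrib, Finset.sum_sub_distrib, h2, hD.sum_dA_trace hy,
    hD.sum_curv_indConn hy, hD.divA_eq hy]
  simp only [quadA]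
  ring

end IsNormalPatch
end LocalData

/-! ### The conformal Schouten tensor and the coefficients `E`, `F`, `G`. -/

namespace LocalData.IsNormalPatch

variable {n : ℕ} {D : LocalData n} {U : Set (Coord (n + 1))} {W : Set (Coord n)} {y : Coord n}
  (hD : D.IsNormalPatch U W) (hy : y ∈ W)
include hD hy

lemma sum_hInv_mul_quadA : ∑ β, ∑ δ, D.hInv y β δ * D.quadA y β δ = D.normSqA y := by
  have h1 : ∀ β δ, D.hInv y β δ * D.quadA y β δ = ∑ α, ∑ ε, ∑ ε', ∑ α',
      D.hInv y β δ * ((D.ALow y α δ ε' * D.hInv y ε' ε) * (D.ALow y β ε α' * D.hInv y α' α)) := by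
    intro β δ
    simp only [quadA, hD.A_eq_sum_ALow hy, Finset.sum_mul_sum]
    simp only [Finset.mul_sum]
  simp only [h1]
  -- The exchanges bring the six sums into the order of `normSqA`; total symmetry of `A` then
  -- matches the summands.
  refine Finset.sum_comm.trans ?_
  refine (Finset.sum_congr rfl fun _ _ => Finset.sum_comm).trans ?_
  refine Finset.sum_comm.trans ?_
  refine (Finset.sum_congr rfl fun _ _ => Finset.sum_congr rfl fun _ _ =>
    Finset.sum_congr rfl fun _ _ => Finset.sum_comm).trans ?_
  refine (Finset.sum_congr rfl fun _ _ => Finset.sum_congr rfl fun _ _ => Finset.sum_comm).trans ?_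
  refine (Finset.sum_congr rfl fun _ _ => Finset.sum_congr rfl fun _ _ =>
    Finset.sum_congr rfl fun _ _ => Finset.sum_congr rfl fun _ _ => Finset.sum_comm).trans ?_
  refine (Finset.sum_congr rfl fun _ _ => Finset.sum_congr rfl fun _ _ =>
    Finset.sum_congr rfl fun _ _ => Finset.sum_comm).trans ?_
  refine Finset.sum_congr rfl fun α _ => Finset.sum_congr rfl fun δ _ =>
    Finset.sum_congr rfl fun ε' _ => Finset.sum_congr rfl fun α' _ =>
    Finset.sum_congr rfl fun β _ => Finset.sum_congr rfl fun ε _ => ?_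
  rw [hD.ALow_symm_left hy α' β ε, hD.ALow_symm_right hy β α' ε, hD.hInv_symm hy β δ,
    hD.hInv_symm hy α' α]
  ring

/-- `|A|²` is the quadratic form of `h⁻¹ ⊗ h⁻¹ ⊗ h⁻¹`, and a Kronecker product of positive definite
matrices is positive definite. -/
lemma ALow_eq_zero (h : D.normSqA y = 0) (α β γ : Fin n) : D.ALow y α β γ = 0 := by
  have hp : ((D.h y)⁻¹).PosDef := (hD.h_posDef hy).inv
  have hK := hp.kronecker (hp.kronecker hp)
  set x : Fin n × Fin n × Fin n → ℝ := fun p => D.ALow y p.1 p.2.1 p.2.2 with hx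
  have hq : star x ⬝ᵥ (Matrix.kronecker (D.h y)⁻¹ (Matrix.kronecker (D.h y)⁻¹ (D.h y)⁻¹) *ᵥ x)
      = D.normSqA y := by
    simp only [dotProduct, Matrix.mulVec, Fintype.sum_prod_type, Matrix.kronecker,
      Matrix.kroneckerMap_apply, star_trivial, hx, normSqA, hInv, Finset.mul_sum]
    refine Finset.sum_congr rfl fun α _ => Finset.sum_congr rfl fun δ _ =>
      Finset.sum_congr rfl fun ε' _ => Finset.sum_congr rfl fun α' _ =>
      Finset.sum_congr rfl fun β _ => Finset.sum_congr rfl fun ε _ => ?_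
    ring
  by_contra hne
  have hx0 : x ≠ 0 := fun h0 => hne (congrFun h0 (α, β, γ))
  exact (hK.dotProduct_mulVec_pos hx0).ne' (hq.trans h)

lemma scal_eq : D.scal y = ((n : ℝ) - 1) * (D.trS y + D.trP y) + D.normSqA y := by
  have h1 : D.scal y = (1 / 2) * (D.trS y + D.trP y) * ∑ α, ∑ β, D.hInv y α β * D.h y α β
      + ((n : ℝ) / 2 - 1) * (∑ α, ∑ β, D.hInv y α β * D.shapeLow y α β + D.trP y)
      + ∑ α, ∑ β, D.hInv y α β * D.quadA y α β := by
    simp only [scal, hD.ricci_connH hy, trP, Finset.mul_sum, ← Finset.sum_add_distrib]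
    exact Finset.sum_congr rfl fun γ _ => Finset.sum_congr rfl fun δ _ => by ring
  rw [h1, hD.sum_hInv_mul_h_trace hy, hD.sum_hInv_mul_shapeLow hy, hD.sum_hInv_mul_quadA hy]
  ring

lemma J'_eq (hn : 2 ≤ n) : D.J' y = (1 / 2) * (D.trS y + D.trP y) := by
  have h1 : (n : ℝ) - 1 ≠ 0 := by
    have : (2 : ℝ) ≤ n := by exact_mod_cast hn
    linarith
  rw [J', hD.scal_eq hy]
  field_simp
  ring

/-- The term `|A|²` in `J'` cancels the one in `scal`, so `J' = ½ (tr S + tr P)` and `tr S - J' = ½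
(tr S - tr P)`. Hence the correction in `Φ` is the one that makes the image of `(1, 0, 0)` null. -/
lemma c_eq (hn : 2 ≤ n) : D.c y = D.hessForm y (D.ξ y) (D.ξ y) / 2 := by
  have h1 : (n : ℝ) ≠ 0 := by
    have : n ≠ 0 := by omega
    exact_mod_cast this
  rw [c, hD.J'_eq hy hn, div_eq_iff h1]
  linear_combination (-1 / 2) * hD.nat_mul_hessForm_ξ hy

/-- For `n ≥ 3` this is the formula for `Ric^h`. For `n = 2`, where the Ricci tensor carries no
trace-free information, the terms `tf S - ½ δA` of the Möbius structure supply the mean of `S` and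
`P` through the formula for `δA`. In both cases only terms quadratic in `A` are left. -/
lemma two_mul_P_sub (hn : 2 ≤ n) (α β : Fin n) :
    2 * D.P y α β - D.shapeLow y α β - D.tanP y α β
      = if n = 2 then (1 / 2) * D.normSqA y * D.h y α β
        else (2 / ((n : ℝ) - 2)) *
          (D.quadA y α β - D.normSqA y / (2 * ((n : ℝ) - 1)) * D.h y α β) := by
  have h1 : (n : ℝ) - 1 ≠ 0 := by
    have : (2 : ℝ) ≤ n := by exact_mod_cast hn
    linarith
  by_cases h2 : n = 2
  · have h2' : (n : ℝ) = 2 := by exact_mod_cast h2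
    have hS : D.tfS y α β = D.shapeLow y α β - (D.trS y / n) * D.h y α β := rfl
    rw [P, if_pos h2, if_pos h2, hD.divA_eq hy, hD.scal_eq hy, hS, h2']
    ring
  · have h2' : (n : ℝ) - 2 ≠ 0 := by
      rw [sub_ne_zero]
      exact_mod_cast h2
    rw [P, if_neg h2, if_neg h2, hD.ricci_connH hy, hD.scal_eq hy]
    field_simp
    ring

/-- The conformal Schouten tensor is the mean of the shape operator and the projective Schouten
tensor exactly when the Fubini–Pick form vanishes. -/
lemma forall_two_mul_P_sub_eq_zero_iff (hn : 2 ≤ n) :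
    (∀ α β, 2 * D.P y α β - D.shapeLow y α β - D.tanP y α β = 0)
      ↔ ∀ α β γ, D.ALow y α β γ = 0 := by
  have h1 : (0 : ℝ) < (n : ℝ) - 1 := by
    have : (2 : ℝ) ≤ n := by exact_mod_cast hn
    linarith
  refine ⟨fun h => hD.ALow_eq_zero hy ?_, fun h α β => ?_⟩
  · have ht : ∑ α, ∑ β, D.hInv y α β
        * (2 * D.P y α β - D.shapeLow y α β - D.tanP y α β) = 0 := by
      simp only [h, mul_zero, Finset.sum_const_zero]
    simp only [hD.two_mul_P_sub hy hn] at ht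
    by_cases h2 : n = 2
    · have h2' : (n : ℝ) = 2 := by exact_mod_cast h2
      simp only [if_pos h2] at ht
      have h3 : ∑ α, ∑ β, D.hInv y α β * ((1 / 2) * D.normSqA y * D.h y α β)
          = (1 / 2) * D.normSqA y * ∑ α, ∑ β, D.hInv y α β * D.h y α β := by
        simp only [Finset.mul_sum]
        exact Finset.sum_congr rfl fun γ _ => Finset.sum_congr rfl fun δ _ => by ring
      rw [h3, hD.sum_hInv_mul_h_trace hy, h2'] at ht
      linarith
    · have h2' : (n : ℝ) - 2 ≠ 0 := by
        rw [sub_ne_zero]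
        exact_mod_cast h2
      simp only [if_neg h2] at ht
      have h3 : ∑ α, ∑ β, D.hInv y α β * ((2 / ((n : ℝ) - 2)) *
          (D.quadA y α β - D.normSqA y / (2 * ((n : ℝ) - 1)) * D.h y α β))
          = (2 / ((n : ℝ) - 2)) * (∑ α, ∑ β, D.hInv y α β * D.quadA y α β
            - D.normSqA y / (2 * ((n : ℝ) - 1)) * ∑ α, ∑ β, D.hInv y α β * D.h y α β) := by
        simp only [Finset.mul_sum, ← Finset.sum_sub_distrib]
        exact Finset.sum_congr rfl fun γ _ => Finset.sum_congr rfl fun δ _ => by ring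
      rw [h3, hD.sum_hInv_mul_h_trace hy, hD.sum_hInv_mul_quadA hy] at ht
      have h4 : (2 / ((n : ℝ) - 2)) * (D.normSqA y - D.normSqA y / (2 * ((n : ℝ) - 1)) * n)
          = D.normSqA y / ((n : ℝ) - 1) := by
        have := h1.ne'
        field_simp
        ring
      rw [h4] at ht
      exact (div_eq_zero_iff.1 ht).resolve_right h1.ne'
  · have hA : ∀ α β γ, D.A y α β γ = 0 := fun α β γ => by
      simp [hD.A_eq_sum_ALow hy, h]
    rw [hD.two_mul_P_sub hy hn]
    simp [normSqA, quadA, h, hA]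

omit hD hy in
lemma E_eq (α β : Fin n) :
    D.E y α β = -D.shapeLow y α β + D.c y * D.h y α β + D.P y α β := by
  have hS : D.tfS y α β = D.shapeLow y α β - (D.trS y / n) * D.h y α β := rfl
  rw [E, hS, c]
  ring

omit hD hy in
lemma E_sub_G (α β : Fin n) :
    D.E y α β - D.G y α β = 2 * D.P y α β - D.shapeLow y α β - D.tanP y α β := by
  rw [E_eq, G, tanP]
  ring

/-- The tensor `P^h` cancels in the sum and `2c = Hess ρ(ξ,ξ)`, which leaves the mixed component of
the cubic form. -/
lemma E_add_G (hn : 2 ≤ n) (α β : Fin n) :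
    D.E y α β + D.G y α β = D.cubicForm y (pd α D.F y) (pd β D.F y) (D.ξ y) := by
  rw [E_eq, G, hD.cubicForm_pd_F_ξ hy, hD.c_eq hy hn]
  ring

lemma differentiableAt_hessForm_ξ :
    DifferentiableAt ℝ (fun z => D.hessForm z (D.ξ z) (D.ξ z)) y := by
  have hh : ∀ i j, ContDiffOn ℝ ∞ (fun z => hess D.Γ D.ρ (D.F z) i j) W := fun i j =>
    (hD.scale.contDiffOn_hess hD.contDiffOn_ρ i j).comp hD.contDiffOn_F hD.mem
  have hξ := contDiffOn_euclidean_apply hD.smooth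
  exact DifferentiableAt.fun_sum fun i _ => DifferentiableAt.fun_sum fun j _ =>
    (((hh i j).mul (hξ i)).mul (hξ j)).diffAt hD.isOpen hy

lemma differentiableAt_c (hn : 2 ≤ n) : DifferentiableAt ℝ D.c y := by
  have h1 : DifferentiableAt ℝ (fun z => (1 / 2) * D.hessForm z (D.ξ z) (D.ξ z)) y :=
    (hD.differentiableAt_hessForm_ξ hy).const_mul _
  refine h1.congr_of_eventuallyEq
    (Filter.eventuallyEq_of_mem (hD.isOpen.mem_nhds hy) fun z hz => ?_)
  rw [hD.c_eq hz hn]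
  ring

lemma two_mul_Fform (hn : 2 ≤ n) (α : Fin n) :
    2 * D.Fform y α = D.cubicForm y (pd α D.F y) (D.ξ y) (D.ξ y) := by
  have h1 : pd α D.c y = (1 / 2) * pd α (fun z => D.hessForm z (D.ξ z) (D.ξ z)) y := by
    rw [← pd_const_mul α _ (hD.differentiableAt_hessForm_ξ hy)]
    exact pd_congr_of_isOpen α hD.isOpen hy fun z hz => by rw [hD.c_eq hz hn]; ring
  rw [hD.cubicForm_ξ_ξ hy, Fform, h1]
  ring

end LocalData.IsNormalPatch

/-! ### The isometry `Φ` and the two tractor connections. -/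

namespace LocalData

variable {n : ℕ} {D : LocalData n} {U : Set (Coord (n + 1))} {W : Set (Coord n)} {y : Coord n}

lemma Phi_add (X Y : ConfTractor n) : D.Phi y (X + Y) = D.Phi y X + D.Phi y Y := by
  simp only [Phi, Prod.fst_add, Prod.snd_add, Pi.add_apply, ← ambPoint_add, add_smul,
    Finset.sum_add_distrib]
  congr 1
  · ring
  · abel

namespace IsNormalPatch

variable (hD : D.IsNormalPatch U W) (hy : y ∈ W)
include hD hy

lemma bijective_Phi : Function.Bijective (D.Phi y) := by
  have hB := hD.isUnit_det_frame hy
  constructor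
  · intro X Y hXY
    have hb : (∑ α, X.2.1 α • pd α D.F y) + X.1 • D.ξ y
        = (∑ α, Y.2.1 α • pd α D.F y) + Y.1 • D.ξ y := by
      have := congrArg ambBase hXY
      rwa [Phi, Phi, ambBase_ambPoint, ambBase_ambPoint] at this
    have h0 : X.2.2 - D.c y * X.1 = Y.2.2 - D.c y * Y.1 := by
      have := congrArg (fun v : Coord (n + 2) => v 0) hXY
      simpa only [Phi, ambPoint_zero] using this
    have h1 : X.1 = Y.1 := by
      rw [← decomp_last hB X.2.1 X.1, hb, decomp_last hB]
    have h2 : X.2.1 = Y.2.1 := by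
      ext γ
      rw [← decomp_castSucc hB X.2.1 X.1, hb, decomp_castSucc hB]
    have h3 : X.2.2 = Y.2.2 := by
      rw [h1] at h0
      linarith
    exact Prod.ext h1 (Prod.ext h2 h3)
  · intro v
    refine ⟨(D.decomp y (ambBase v) (Fin.last n), fun γ => D.decomp y (ambBase v) γ.castSucc,
      v 0 + D.c y * D.decomp y (ambBase v) (Fin.last n)), ?_⟩
    simp only [Phi, add_sub_cancel_right]
    rw [← eq_sum_decomp hB, ambPoint_ambBase]

lemma hessForm_ambBase_Phi (X Y : ConfTractor n) :
    D.hessForm y ((∑ α, X.2.1 α • pd α D.F y) + X.1 • D.ξ y)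
        ((∑ α, Y.2.1 α • pd α D.F y) + Y.1 • D.ξ y)
      = ∑ α, ∑ β, D.h y α β * X.2.1 α * Y.2.1 β
        + X.1 * Y.1 * D.hessForm y (D.ξ y) (D.ξ y) := by
  have h1 : ∀ β, D.hessForm y ((∑ α, X.2.1 α • pd α D.F y) + X.1 • D.ξ y) (pd β D.F y)
      = ∑ α, X.2.1 α * D.h y α β := by
    intro β
    rw [hD.hessForm_symm hy, hessForm_add_right, hessForm_sum_right, hessForm_smul_right,
      hD.hessForm_pd_F_ξ hy, mul_zero, add_zero]
    exact Finset.sum_congr rfl fun α _ => by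
      rw [hessForm_smul_right, hD.hessForm_pd_F_pd_F hy, hD.h_symm hy]
  have h2 : D.hessForm y ((∑ α, X.2.1 α • pd α D.F y) + X.1 • D.ξ y) (D.ξ y)
      = X.1 * D.hessForm y (D.ξ y) (D.ξ y) := by
    rw [hD.hessForm_symm hy, hessForm_add_right, hessForm_sum_right, hessForm_smul_right]
    simp only [hessForm_smul_right, hD.hessForm_ξ_pd_F hy, mul_zero, Finset.sum_const_zero,
      zero_add]
  rw [hessForm_add_right, hessForm_sum_right, hessForm_smul_right, h2]
  simp only [hessForm_smul_right, h1, Finset.mul_sum]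
  rw [Finset.sum_comm]
  congr 1
  · exact Finset.sum_congr rfl fun γ _ => Finset.sum_congr rfl fun δ _ => by ring
  · ring

/-- `Φ` is an isometry for the tractor metric and the ambient metric. -/
lemma amb_Phi (hn : 2 ≤ n) (X Y : ConfTractor n) :
    D.amb y (D.Phi y X) (D.Phi y Y) = D.tractorMetric y X Y := by
  rw [Phi, Phi, hD.amb_ambPoint hy, hD.hessForm_ambBase_Phi hy, hD.c_eq hy hn, tractorMetric]
  simp only [map_add, map_sum, map_smul, hD.fderiv_ρ_pd_F hy, hD.fderiv_ρ y hy, smul_eq_mul,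
    mul_zero, Finset.sum_const_zero, zero_add, mul_one]
  ring

/-- The frame components of the cubic form are `2A`, `E + G` and `2F`. This is the shape of twice
the symmetric part of `Ã`, with which it is matched below. -/
lemma cubicForm_ambBase_Phi (hn : 2 ≤ n) (α : Fin n) (X Y : ConfTractor n) :
    D.cubicForm y (pd α D.F y) (ambBase (D.Phi y X)) (ambBase (D.Phi y Y))
      = ∑ δ, (∑ γ, 2 * D.ALow y α γ δ * X.2.1 γ) * Y.2.1 δ
        + (∑ γ, (D.E y α γ + D.G y α γ) * X.2.1 γ) * Y.1
        + X.1 * (∑ δ, (D.E y α δ + D.G y α δ) * Y.2.1 δ) + 2 * D.Fform y α * X.1 * Y.1 := by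
  have h1 : ∀ v, D.cubicForm y (pd α D.F y) ((∑ γ, X.2.1 γ • pd γ D.F y) + X.1 • D.ξ y) v
      = ∑ γ, X.2.1 γ * D.cubicForm y (pd α D.F y) v (pd γ D.F y)
        + X.1 * D.cubicForm y (pd α D.F y) v (D.ξ y) := by
    intro v
    rw [hD.cubicForm_symm_right hy, cubicForm_add_right, cubicForm_sum_right,
      cubicForm_smul_right]
    simp only [cubicForm_smul_right]
  have h2 : ∀ δ, D.cubicForm y (pd α D.F y) ((∑ γ, X.2.1 γ • pd γ D.F y) + X.1 • D.ξ y)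
      (pd δ D.F y) = ∑ γ, 2 * D.ALow y α γ δ * X.2.1 γ + X.1 * (D.E y α δ + D.G y α δ) := by
    intro δ
    rw [h1, hD.E_add_G hy hn]
    congr 1
    exact Finset.sum_congr rfl fun γ _ => by
      rw [hD.cubicForm_pd_F hy, hD.ALow_symm_right hy α δ γ, mul_comm]
  have h3 : D.cubicForm y (pd α D.F y) ((∑ γ, X.2.1 γ • pd γ D.F y) + X.1 • D.ξ y) (D.ξ y)
      = ∑ γ, (D.E y α γ + D.G y α γ) * X.2.1 γ + X.1 * (2 * D.Fform y α) := by
    rw [h1, hD.two_mul_Fform hy hn]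
    congr 1
    exact Finset.sum_congr rfl fun γ _ => by
      rw [hD.E_add_G hy hn, hD.cubicForm_symm_right hy, mul_comm]
  rw [Phi, Phi, ambBase_ambPoint, ambBase_ambPoint, cubicForm_add_right, cubicForm_sum_right,
    cubicForm_smul_right, h3]
  have h4 : ∑ δ, D.cubicForm y (pd α D.F y) ((∑ γ, X.2.1 γ • pd γ D.F y) + X.1 • D.ξ y)
        (Y.2.1 δ • pd δ D.F y)
      = ∑ δ, (∑ γ, 2 * D.ALow y α γ δ * X.2.1 γ) * Y.2.1 δ
        + X.1 * (∑ δ, (D.E y α δ + D.G y α δ) * Y.2.1 δ) := by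
    rw [Finset.mul_sum, ← Finset.sum_add_distrib]
    exact Finset.sum_congr rfl fun δ _ => by rw [cubicForm_smul_right, h2]; ring
  rw [h4]
  ring

omit hD hy in
lemma tractorMetric_eq (X Y : ConfTractor n) : D.tractorMetric y X Y
    = ∑ γ, (∑ β, X.2.1 β * D.h y β γ) * Y.2.1 γ + X.1 * Y.2.2 + X.2.2 * Y.1 := by
  rw [tractorMetric, Finset.sum_comm]
  congr 2
  refine Finset.sum_congr rfl fun γ _ => ?_
  rw [Finset.sum_mul]
  exact Finset.sum_congr rfl fun β _ => by ring

lemma tractorMetric_Atilde (α : Fin n) (X Y : ConfTractor n) :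
    D.tractorMetric y (D.Atilde y α X) Y
      = ∑ δ, (D.E y α δ * X.1 + ∑ γ, D.ALow y α γ δ * X.2.1 γ) * Y.2.1 δ
        + (D.Fform y α * X.1 + ∑ γ, D.G y α γ * X.2.1 γ) * Y.1 := by
  have h1 : ∀ δ, ∑ β, ((∑ γ, D.E y α γ * D.hInv y γ β) * X.1 + ∑ γ, D.A y α γ β * X.2.1 γ)
      * D.h y β δ = D.E y α δ * X.1 + ∑ γ, D.ALow y α γ δ * X.2.1 γ := by
    intro δ
    rw [← hD.sum_sum_mul_hInv_mul_h hy (D.E y α) δ, Finset.sum_mul]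
    simp only [ALow, Finset.sum_mul]
    rw [Finset.sum_comm (f := fun γ β => D.A y α γ β * D.h y β δ * X.2.1 γ),
      ← Finset.sum_add_distrib]
    refine Finset.sum_congr rfl fun β _ => ?_
    rw [add_mul]
    congr 1
    · simp only [Finset.sum_mul]
      exact Finset.sum_congr rfl fun γ _ => by ring
    · rw [Finset.sum_mul]
      exact Finset.sum_congr rfl fun γ _ => by ring
  rw [tractorMetric_eq]
  simp only [Atilde, zero_mul, add_zero, h1]

/-- The skew part of `Ã` is given by `E - G`. -/
lemma AtildeSkew_eq (α : Fin n) (X : ConfTractor n) : D.AtildeSkew y α X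
    = (0, fun β => (∑ γ, (1 / 2) * (D.E y α γ - D.G y α γ) * D.hInv y γ β) * X.1,
      -∑ γ, (1 / 2) * (D.E y α γ - D.G y α γ) * X.2.1 γ) := by
  have hl : ∀ Y, (1 / 2) * (D.tractorMetric y (D.Atilde y α X) Y
        - D.tractorMetric y (D.Atilde y α Y) X)
      = X.1 * (∑ γ, (1 / 2) * (D.E y α γ - D.G y α γ) * Y.2.1 γ)
        - Y.1 * (∑ γ, (1 / 2) * (D.E y α γ - D.G y α γ) * X.2.1 γ) := by
    intro Y
    -- The block `A` is symmetric, and `F` occurs only in the product `σσ'`, so both drop out of the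
    -- skew part.
    have hA : ∑ δ, (∑ γ, D.ALow y α γ δ * X.2.1 γ) * Y.2.1 δ
        = ∑ δ, (∑ γ, D.ALow y α γ δ * Y.2.1 γ) * X.2.1 δ := by
      simp only [Finset.sum_mul]
      rw [Finset.sum_comm]
      exact Finset.sum_congr rfl fun γ _ => Finset.sum_congr rfl fun δ _ => by
        rw [hD.ALow_symm_right hy]; ring
    rw [hD.tractorMetric_Atilde hy, hD.tractorMetric_Atilde hy]
    simp only [add_mul, Finset.sum_add_distrib, hA]
    simp only [mul_sub, sub_mul, Finset.sum_sub_distrib, mul_assoc, ← Finset.mul_sum]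
    have h1 : ∀ X Y : ConfTractor n, ∑ δ, D.E y α δ * (X.1 * Y.2.1 δ)
        = X.1 * ∑ δ, D.E y α δ * Y.2.1 δ := by
      intro X Y
      rw [Finset.mul_sum]
      exact Finset.sum_congr rfl fun δ _ => by ring
    rw [h1, h1]
    ring
  rw [AtildeSkew]
  simp only [hl, raise]
  refine Prod.ext ?_ (Prod.ext ?_ ?_)
  · simp
  · ext β
    simp only [zero_mul, sub_zero, Pi.single_apply, mul_ite, mul_one, mul_zero,
      Finset.sum_ite_eq', Finset.mem_univ, if_true]
    rw [Finset.sum_mul]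
    exact Finset.sum_congr rfl fun γ _ => by rw [hD.hInv_symm hy]; ring
  · simp

/-- `Ã - Ã''` is the symmetric part of `Ã`. The right-hand side is the expansion of the cubic form
under `Φ`, so adding `½ g̃⁻¹ C` to the projective tractor connection adds exactly this symmetric
part. -/
lemma two_mul_tractorMetric_Atilde_sub (α : Fin n) (X Y : ConfTractor n) :
    2 * D.tractorMetric y (D.Atilde y α X - D.AtildeSkew y α X) Y
      = ∑ δ, (∑ γ, 2 * D.ALow y α γ δ * X.2.1 γ) * Y.2.1 δ
        + (∑ γ, (D.E y α γ + D.G y α γ) * X.2.1 γ) * Y.1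
        + X.1 * (∑ δ, (D.E y α δ + D.G y α δ) * Y.2.1 δ) + 2 * D.Fform y α * X.1 * Y.1 := by
  have h0 : D.tractorMetric y (D.Atilde y α X - D.AtildeSkew y α X) Y
      = D.tractorMetric y (D.Atilde y α X) Y - D.tractorMetric y (D.AtildeSkew y α X) Y := by
    simp only [tractorMetric, Prod.fst_sub, Prod.snd_sub, Pi.sub_apply, mul_sub, sub_mul,
      Finset.sum_sub_distrib]
    ring
  have h1 : ∀ δ, ∑ β, ((∑ γ, (1 / 2) * (D.E y α γ - D.G y α γ) * D.hInv y γ β) * X.1)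
      * D.h y β δ = (1 / 2) * (D.E y α δ - D.G y α δ) * X.1 := by
    intro δ
    rw [← hD.sum_sum_mul_hInv_mul_h hy (fun γ => (1 / 2) * (D.E y α γ - D.G y α γ)) δ,
      Finset.sum_mul]
    exact Finset.sum_congr rfl fun β _ => by ring
  rw [h0, hD.tractorMetric_Atilde hy, hD.AtildeSkew_eq hy, tractorMetric_eq]
  simp only [zero_mul, add_zero, h1]
  simp only [add_mul, sub_mul, mul_add, mul_sub, Finset.sum_add_distrib, Finset.sum_sub_distrib,
    mul_assoc, ← Finset.mul_sum]
  have h2 : ∀ f : Fin n → ℝ, ∑ δ, f δ * (X.1 * Y.2.1 δ) = X.1 * ∑ δ, f δ * Y.2.1 δ := by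
    intro f
    rw [Finset.mul_sum]
    exact Finset.sum_congr rfl fun δ _ => by ring
  simp only [h2]
  ring

/-- Expand `∇` of `μ^γ ∂_γF + σ ξ` by the Gauss and Weingarten formulas and compare coefficients in
the frame. The tensors `A`, `E`, `F`, `G` are the differences from the conformal tractor connection,
so `P^h` cancels. -/
lemma projConn_Phi (hn : 2 ≤ n) {X : Coord n → ConfTractor n} (hX : ContDiffOn ℝ ∞ X W)
    (α : Fin n) : D.projConn (fun z => D.Phi z (X z)) y α
      = D.Phi y (D.confConn X y α - D.Atilde y α (X y)) := by
  have hσ : DifferentiableAt ℝ (fun z => (X z).1) y := hX.fst.diffAt hD.isOpen hy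
  have hφ : DifferentiableAt ℝ (fun z => (X z).2.2) y := hX.snd.snd.diffAt hD.isOpen hy
  have hμ : ∀ γ, DifferentiableAt ℝ (fun z => (X z).2.1 γ) y := fun γ =>
    (contDiffOn_pi.1 hX.snd.fst γ).diffAt hD.isOpen hy
  have hc := hD.differentiableAt_c hy hn
  have he := hD.differentiableAt_pd_F hy
  have hξ := hD.differentiableAt_ξ hy
  have hcov : covAlong D.Γ D.F
        (fun z => (∑ γ, (X z).2.1 γ • pd γ D.F z) + (X z).1 • D.ξ z) y α
      = ∑ γ, (pd α (fun z => (X z).2.1 γ) y + ∑ β, (X y).2.1 β * D.indConn y α β γ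
          + (X y).1 * D.shape y α γ) • pd γ D.F y
        + (pd α (fun z => (X z).1) y - ∑ β, (X y).2.1 β * D.h y α β) • D.ξ y := by
    rw [covAlong_add (DifferentiableAt.fun_sum fun γ _ => (hμ γ).fun_smul (he γ))
      (hσ.fun_smul hξ), covAlong_sum _ (fun γ => (hμ γ).fun_smul (he γ)), covAlong_smul hσ hξ,
      hD.covAlong_ξ hy]
    simp only [covAlong_smul (hμ _) (he _), hD.covAlong_pd_F hy, smul_sub, Finset.smul_sum,
      smul_smul, Finset.sum_add_distrib, Finset.sum_sub_distrib, add_smul, sub_smul,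
      Finset.sum_smul]
    rw [Finset.sum_comm (f := fun x i => ((X y).2.1 x * D.indConn y α x i) • pd i D.F y)]
    abel
  simp only [Phi]
  rw [projConn_ambPoint, hcov, pd_sub α hφ (hc.fun_mul hσ), pd_mul α hc hσ]
  congr 1
  · have hP : D.projP y (pd α D.F y) ((∑ γ, (X y).2.1 γ • pd γ D.F y) + (X y).1 • D.ξ y)
        = ∑ γ, D.tanP y α γ * (X y).2.1 γ + (X y).1 * D.projP y (pd α D.F y) (D.ξ y) := by
      rw [projP_add_right, projP_sum_right, projP_smul_right]
      congr 1
      exact Finset.sum_congr rfl fun γ _ => by rw [projP_smul_right, mul_comm]; rfl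
    have hG : ∑ γ, D.G y α γ * (X y).2.1 γ = ∑ γ, D.tanP y α γ * (X y).2.1 γ
        + D.c y * (∑ γ, D.h y α γ * (X y).2.1 γ) - ∑ γ, D.P y α γ * (X y).2.1 γ := by
      rw [Finset.mul_sum, ← Finset.sum_add_distrib, ← Finset.sum_sub_distrib]
      exact Finset.sum_congr rfl fun γ _ => by rw [G, tanP]; ring
    simp only [confConn, Atilde, Prod.fst_sub, Prod.snd_sub, hP, hG, Fform]
    ring
  · have hEP : ∀ γ, (∑ q, D.P y α q * D.hInv y q γ) - ∑ q, D.E y α q * D.hInv y q γ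
        = D.shape y α γ - if α = γ then D.c y else 0 := by
      intro γ
      have h1 := hD.sum_sum_mul_h_mul_hInv hy (D.shape y α) γ
      have h2 := hD.sum_h_mul_hInv hy α γ
      rw [← h1, ← mul_one (D.c y), ← mul_zero (D.c y), ← mul_ite, ← h2, Finset.mul_sum,
        ← Finset.sum_sub_distrib, ← Finset.sum_sub_distrib]
      refine Finset.sum_congr rfl fun q _ => ?_
      rw [E_eq, shapeLow]
      ring
    have hδ : ((X y).2.2 - D.c y * (X y).1) • pd α D.F y
        = ∑ γ, (if α = γ then (X y).2.2 - D.c y * (X y).1 else 0) • pd γ D.F y := by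
      simp [ite_smul]
    rw [hδ, add_right_comm, ← Finset.sum_add_distrib]
    congr 1
    · refine Finset.sum_congr rfl fun γ _ => ?_
      rw [← add_smul]
      congr 1
      simp only [confConn, Atilde, Prod.snd_sub, Prod.fst_sub, Pi.sub_apply]
      have h1 : ∑ β, (X y).2.1 β * D.indConn y α β γ
          = ∑ β, D.connH y α β γ * (X y).2.1 β - ∑ β, D.A y α β γ * (X y).2.1 β := by
        rw [← Finset.sum_sub_distrib]
        exact Finset.sum_congr rfl fun β _ => by rw [A]; ring
      have h2 := hEP γ
      rw [h1]
      split_ifs at h2 ⊢ <;> linear_combination -(X y).1 * h2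
    · congr 1
      simp only [confConn, Atilde, Prod.fst_sub, sub_zero]
      congr 1
      exact Finset.sum_congr rfl fun β _ => mul_comm _ _

lemma differentiableAt_Phi (hn : 2 ≤ n) {X : Coord n → ConfTractor n} (hX : ContDiffOn ℝ ∞ X W) :
    DifferentiableAt ℝ (fun z => D.Phi z (X z)) y := by
  have hσ : DifferentiableAt ℝ (fun z => (X z).1) y := hX.fst.diffAt hD.isOpen hy
  have hφ : DifferentiableAt ℝ (fun z => (X z).2.2) y := hX.snd.snd.diffAt hD.isOpen hy
  have hμ : ∀ γ, DifferentiableAt ℝ (fun z => (X z).2.1 γ) y := fun γ =>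
    (contDiffOn_pi.1 hX.snd.fst γ).diffAt hD.isOpen hy
  exact differentiableAt_ambPoint (hφ.fun_sub ((hD.differentiableAt_c hy hn).fun_mul hσ))
    ((DifferentiableAt.fun_sum fun γ _ => (hμ γ).fun_smul (hD.differentiableAt_pd_F hy γ)).fun_add
      (hσ.fun_smul (hD.differentiableAt_ξ hy)))

lemma amb_ext {u v : Coord (n + 2)} (h : ∀ w, D.amb y u w = D.amb y v w) : u = v := by
  have h1 : (fun I => u I) ᵥ* preAmbient D.Γ D.ρ (D.F y)
      = (fun I => v I) ᵥ* preAmbient D.Γ D.ρ (D.F y) := by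
    refine dotProduct_eq _ _ fun w => ?_
    rw [← Matrix.dotProduct_mulVec, ← Matrix.dotProduct_mulVec]
    exact h (WithLp.toLp 2 w)
  have h2 := congrArg (fun x => x ᵥ* (preAmbient D.Γ D.ρ (D.F y))⁻¹) h1
  simp only [Matrix.vecMul_vecMul, Matrix.mul_nonsing_inv _ (hD.isUnit_det hy),
    Matrix.vecMul_one] at h2
  ext I
  exact congrFun h2 I

/-- By nondegeneracy it is enough to pair with `Φ(Y)`. There `∇̃` differs from `∇^proj` by half the
cubic form, which is the metric pairing with `Ã - Ã''`, and this turns `∇ - Ã` into `∇ - Ã''`. -/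
lemma ambientConnM_Phi (hn : 2 ≤ n) {X : Coord n → ConfTractor n} (hX : ContDiffOn ℝ ∞ X W)
    (α : Fin n) : D.ambientConnM (fun z => D.Phi z (X z)) y α
      = D.Phi y (D.confConn X y α - D.AtildeSkew y α (X y)) := by
  refine hD.amb_ext hy fun w => ?_
  obtain ⟨Y, rfl⟩ := (hD.bijective_Phi hy).2 w
  have h1 : D.confConn X y α - D.AtildeSkew y α (X y)
      = (D.confConn X y α - D.Atilde y α (X y))
        + (D.Atilde y α (X y) - D.AtildeSkew y α (X y)) := by abel
  rw [hD.amb_ambientConnM hy (hD.differentiableAt_Phi hy hn hX), hD.projConn_Phi hy hn hX, h1,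
    Phi_add, amb_add_left, hD.amb_Phi hy hn (D.Atilde y α (X y) - D.AtildeSkew y α (X y)),
    hD.cubicForm_ambBase_Phi hy hn, ← hD.two_mul_tractorMetric_Atilde_sub hy]
  ring

lemma AtildeSkew_eq_zero_iff (hn : 2 ≤ n) :
    (∀ α X, D.AtildeSkew y α X = 0) ↔ ∀ α β γ, D.ALow y α β γ = 0 := by
  rw [← hD.forall_two_mul_P_sub_eq_zero_iff hy hn]
  simp only [← E_sub_G]
  constructor
  · intro h α β
    have h1 := h α (0, Pi.single β 1, 0)
    rw [hD.AtildeSkew_eq hy] at h1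
    have h2 := congrArg (fun Z : ConfTractor n => Z.2.2) h1
    simp only [Pi.single_apply, mul_ite, mul_one, mul_zero, Finset.sum_ite_eq', Finset.mem_univ,
      if_true, Prod.snd_zero] at h2
    linarith
  · intro h α X
    rw [hD.AtildeSkew_eq hy]
    simp only [h, mul_zero, zero_mul, Finset.sum_const_zero, neg_zero]
    rfl

lemma ambientConnM_Phi_eq_iff (hn : 2 ≤ n) :
    (∀ X : Coord n → ConfTractor n, ContDiffOn ℝ ∞ X W → ∀ α : Fin n,
        D.ambientConnM (fun z => D.Phi z (X z)) y α = D.Phi y (D.confConn X y α))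
      ↔ ∀ α β γ, D.ALow y α β γ = 0 := by
  rw [← hD.AtildeSkew_eq_zero_iff hy hn]
  constructor
  · intro h α X
    -- The difference of the connections is algebraic, so constant sections already detect it,
    -- separately at each point.
    have h1 := h (fun _ => X) contDiffOn_const α
    rw [hD.ambientConnM_Phi hy hn contDiffOn_const] at h1
    simpa using (hD.bijective_Phi hy).1 h1
  · intro h X hX α
    rw [hD.ambientConnM_Phi hy hn hX, h, sub_zero]

end IsNormalPatch
end LocalData

/-! ### From the manifold to a coordinate patch. -/

section LocalDataOfManifold

variable {n : ℕ} {N : Type*} [TopologicalSpace N] [ChartedSpace (Coord (n + 1)) N]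
  {e : OpenPartialHomeomorph N (Coord (n + 1))} (he : e ∈ smoothCharts (n + 1) N)
  {τ : Density n N 1} (hτ : IsScale τ)

include he hτ

lemma contDiffOn_scaleVolume : ContDiffOn ℝ ∞ (scaleVolume τ e) e.target :=
  ((τ.contDiffOn_comp e he).pow (n + 2)).inv fun x hx => (pow_pos (hτ e he x hx) _).ne'

lemma contDiffOn_scaleFun (r : Density n N 2) : ContDiffOn ℝ ∞ (scaleFun τ r e) e.target :=
  (r.contDiffOn_comp e he).div ((τ.contDiffOn_comp e he).pow 2)
    fun x hx => (pow_pos (hτ e he x hx) _).ne'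

lemma pd_scaleVolume {x : Coord (n + 1)} (hx : x ∈ e.target) (i : Fin (n + 1)) :
    pd i (scaleVolume τ e) x
      = -((n : ℝ) + 2) * (pd i (τ.comp e) x / τ.comp e x) * scaleVolume τ e x := by
  have hτx := (hτ e he x hx).ne'
  have h1 := ((τ.contDiffOn_comp e he).diffAt e.open_target hx).hasFDerivAt
  have h0 : HasDerivAt (fun s : ℝ => (s ^ (n + 2))⁻¹)
      (-(((n + 2 : ℕ) : ℝ) * τ.comp e x ^ (n + 2 - 1)) / (τ.comp e x ^ (n + 2)) ^ 2)
      (τ.comp e x) := (hasDerivAt_pow (n + 2) (τ.comp e x)).fun_inv (pow_ne_zero _ hτx)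
  have h3 : fderiv ℝ (scaleVolume τ e) x = _ := (h0.comp_hasFDerivAt x h1).fderiv
  rw [pd, h3]
  simp only [smul_apply, smul_eq_mul, pd, scaleVolume]
  push_cast
  field_simp
  ring

variable [IsManifold 𝓘(ℝ, Coord (n + 1)) ∞ N] [T2Space N] (cov : AffineConn n N)
  [CovariantDerivative.ContMDiffCovariantDerivative cov ∞]

lemma contDiffOn_scaleConn (i j k : Fin (n + 1)) :
    ContDiffOn ℝ ∞ (fun x => scaleConn cov τ e x i j k) e.target := by
  have hf : ∀ i, ContDiffOn ℝ ∞ (fun x => scaleForm cov τ e x i) e.target := by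
    intro i
    refine (ContDiffOn.add ?_ ?_).neg
    · exact ((τ.contDiffOn_comp e he).pd e.open_target i).div (τ.contDiffOn_comp e he)
        fun x hx => (hτ e he x hx).ne'
    · exact (ContDiffOn.sum fun l _ => christoffel_contDiffOn cov he i l l).div_const _
  unfold scaleConn
  refine ((christoffel_contDiffOn cov he i j k).add ?_).add ?_
  · split_ifs
    · exact hf i
    · exact contDiffOn_const
  · split_ifs
    · exact hf j
    · exact contDiffOn_const

lemma isFlatScale (htor : cov.torsion = 0) (hflat : IsLocallyFlat cov) :
    IsFlatScale (scaleConn cov τ e) (scaleVolume τ e) e.target where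
  isOpen := e.open_target
  contDiffOn_coeff := contDiffOn_scaleConn he hτ cov
  symm x hx i j k := by
    simp only [scaleConn, christoffel_symm cov htor he hx i j k]
    ring
  contDiffOn_vol := contDiffOn_scaleVolume he hτ
  vol_pos x hx := inv_pos.2 (pow_pos (hτ e he x hx) _)
  pd_vol x hx i := by
    rw [pd_scaleVolume he hτ hx]
    congr 1
    -- The change by `p` adds `n + 1` copies of `pᵢ` from the first delta and one from the second.
    -- The factor `n + 2` is why `scaleForm` divides by it.
    have h1 : ∑ l, scaleConn cov τ e x i l l
        = ∑ l, christoffel cov e x i l l + ((n : ℝ) + 2) * scaleForm cov τ e x i := by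
      simp only [scaleConn, if_true, Finset.sum_add_distrib, Finset.sum_const, Finset.card_univ,
        Fintype.card_fin, nsmul_eq_mul, Finset.sum_ite_eq, Finset.mem_univ]
      push_cast
      ring
    have h2 : (n : ℝ) + 2 ≠ 0 := by positivity
    rw [h1, scaleForm]
    field_simp
    ring
  weyl := hflat τ hτ e he

omit [T2Space N] [CovariantDerivative.ContMDiffCovariantDerivative cov ∞] in
lemma mongeAmpere_eq_neg_one {r : Density n N 2} (hfeff : IsFefferman cov r) {x : Coord (n + 1)}
    (hx : x ∈ e.target) (h0 : r.comp e x = 0) :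
    mongeAmpere (scaleConn cov τ e) (scaleVolume τ e) (scaleFun τ r e) x = -1 := by
  -- The exponent `1` is available for every `n`, and the bound holds at the point itself, where `ρ
  -- = 0`.
  obtain ⟨C, hC⟩ := (hfeff τ hτ e he x hx h0 1 fun _ => by omega).bound
  have h1 := hC.self_of_nhds
  have h2 : scaleFun τ r e x = 0 := by rw [scaleFun, h0, zero_div]
  rw [h2, pow_one, norm_zero, mul_zero] at h1
  linarith [norm_le_zero_iff.1 h1]

omit [T2Space N] [CovariantDerivative.ContMDiffCovariantDerivative cov ∞] in
lemma pd_mongeAmpere_eq_zero (hn : 2 ≤ n) {r : Density n N 2} (hfeff : IsFefferman cov r)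
    {x : Coord (n + 1)} (hx : x ∈ e.target) (h0 : r.comp e x = 0) (i : Fin (n + 1)) :
    pd i (mongeAmpere (scaleConn cov τ e) (scaleVolume τ e) (scaleFun τ r e)) x = 0 := by
  -- For even `n` the exponent `2` is allowed because `2 ≤ n/2 + 1`, which uses `n ≥ 2`. Since `ρ`
  -- vanishes to first order, `𝒥[𝐫] + 1` is quadratically small and its differential is zero.
  have h1 := hfeff τ hτ e he x hx h0 2 fun _ => by omega
  have h2 : scaleFun τ r e x = 0 := by rw [scaleFun, h0, zero_div]
  have h3 := ((contDiffOn_scaleFun he hτ r).diffAt e.open_target hx).isBigO_sub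
  simp only [h2, sub_zero] at h3
  have h4 : HasFDerivAt (𝕜 := ℝ) _ _ x := (h1.trans ((h3.norm_right).pow 2)).hasFDerivAt (by norm_num)
  have h5 := (HasFDerivAt.sub_const (𝕜 := ℝ) (1 : ℝ) h4).fderiv
  simp only [add_sub_cancel_right] at h5
  rw [pd, h5]
  rfl

variable {M : Type*} [TopologicalSpace M] [ChartedSpace (Coord n) M] [IsManifold 𝓘(ℝ, Coord n) ∞ M]

lemma isFeffermanPatch_localData (hn : 2 ≤ n) (htor : cov.torsion = 0) (hflat : IsLocallyFlat cov)
    {ι : M → N} (hι : Manifold.IsSmoothEmbedding 𝓘(ℝ, Coord n) 𝓘(ℝ, Coord (n + 1)) ∞ ι)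
    {r : Density n N 2} (hdef : IsDefiningDensity r (Set.range ι)) (hconv : IsStrictlyConvex cov r)
    (hfeff : IsFefferman cov r) {c : OpenPartialHomeomorph M (Coord n)} (hc : c ∈ smoothCharts n M)
    (ξ : Coord n → Coord (n + 1)) :
    (localData cov r ι τ e c ξ).IsFeffermanPatch e.target (patchDomain ι e c) := by
  have hmem : ∀ y ∈ patchDomain ι e c, e (ι (c.symm y)) ∈ e.target := fun y hy =>
    e.map_source hy.2
  have h0 : ∀ y ∈ patchDomain ι e c, r.comp e (e (ι (c.symm y))) = 0 := fun y hy =>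
    (hdef.1 _).1 (Set.mem_range_self _) e he hy.2
  have hscale := isFlatScale he hτ cov htor hflat
  exact {
    scale := hscale
    contDiffOn_ρ := contDiffOn_scaleFun he hτ r
    isOpen := (hι.isImmersion.contMDiff.continuous.comp_continuousOn
      c.continuousOn_symm).isOpen_inter_preimage c.open_target e.open_source
    mem := hmem
    contDiffOn_F := fun y hy =>
      (injective_fderiv_of_isImmersion hι.isImmersion he hc hy.1 hy.2).1.contDiffWithinAt
    ρ_eq_zero := fun y hy => by
      change scaleFun τ r e (e (ι (c.symm y))) = 0
      rw [scaleFun, h0 y hy, zero_div]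
    injective := fun y hy =>
      (injective_fderiv_of_isImmersion hι.isImmersion he hc hy.1 hy.2).2
    convex := fun y hy => hconv τ hτ e he _ (hmem y hy) (h0 y hy)
    det := fun y hy => by
      have h1 := mongeAmpere_eq_neg_one he hτ cov hfeff (hmem y hy) (h0 y hy)
      rwa [mongeAmpere, div_eq_iff (pow_pos (hscale.vol_pos _ (hmem y hy)) 2).ne',
        neg_one_mul] at h1
    pd_mongeAmpere := fun y hy =>
      pd_mongeAmpere_eq_zero he hτ cov hn hfeff (hmem y hy) (h0 y hy) }

end LocalDataOfManifold

end

end ConfCodazzi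

/-! ### The theorem. -/

open ConfCodazzi

theorem proposition5p4 (n : ℕ) (hn : 2 ≤ n)
    {N : Type*} [TopologicalSpace N] [ChartedSpace (Coord (n + 1)) N]
    [IsManifold 𝓘(ℝ, Coord (n + 1)) ∞ N] [T2Space N] [SecondCountableTopology N]
    {M : Type*} [TopologicalSpace M] [ChartedSpace (Coord n) M] [IsManifold 𝓘(ℝ, Coord n) ∞ M]
    -- a locally flat projective structure, as the class of a torsion-free connection
    (cov : AffineConn n N) [CovariantDerivative.ContMDiffCovariantDerivative cov ∞]
    (htor : cov.torsion = 0) (hflat : IsLocallyFlat cov)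
    -- a strictly convex hypersurface with a Fefferman defining density
    (ι : M → N) (hι : Manifold.IsSmoothEmbedding 𝓘(ℝ, Coord n) 𝓘(ℝ, Coord (n + 1)) ∞ ι)
    (r : Density n N 2) (hdef : IsDefiningDensity r (Set.range ι))
    (hconv : IsStrictlyConvex cov r) (hfeff : IsFefferman cov r)
    -- a projective scale and charts
    (τ : Density n N 1) (hτ : IsScale τ)
    (e : OpenPartialHomeomorph N (Coord (n + 1))) (he : e ∈ smoothCharts (n + 1) N)
    (c : OpenPartialHomeomorph M (Coord n)) (hc : c ∈ smoothCharts n M) :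
    (∃ ξ, (localData cov r ι τ e c ξ).IsAffineNormal (patchDomain ι e c)) ∧
    ∀ ξ, (localData cov r ι τ e c ξ).IsAffineNormal (patchDomain ι e c) →
      let D := localData cov r ι τ e c ξ
      ∀ y ∈ patchDomain ι e c,
        -- the ambient metric is nondegenerate over `M`
        (∀ t > 0, IsUnit (ambientMetric D.Γ D.ρ (ambPoint t (D.F y))).det) ∧
        -- the restriction of its Levi-Civita connection to `M` is well defined
        (∀ v : Coord (n + 1) → Coord (n + 2), ContDiffAt ℝ ∞ v (D.F y) →
          ∀ t > 0, ∀ (a : ℝ) (α : Fin n),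
            covDeriv D.ambientConn (homField v) (ambPoint t (D.F y)) (ambPoint a (pd α D.F y))
              = homLift t (D.ambientConnM (fun z => v (D.F z)) y α)) ∧
        Function.Bijective (D.Phi y) ∧
        -- `Φ⁻¹ ∘ ∇^proj ∘ Φ = ∇ - Ã` and `Φ⁻¹ ∘ ∇̃ ∘ Φ = ∇ - Ã''`
        (∀ U : Coord n → ConfTractor n, ContDiffOn ℝ ∞ U (patchDomain ι e c) → ∀ α : Fin n,
          D.projConn (fun z => D.Phi z (U z)) y α
              = D.Phi y (D.confConn U y α - D.Atilde y α (U y)) ∧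
          D.ambientConnM (fun z => D.Phi z (U z)) y α
              = D.Phi y (D.confConn U y α - D.AtildeSkew y α (U y))) ∧
        -- `Φ⁻¹ ∘ ∇̃ ∘ Φ = ∇` if and only if `A = 0`
        ((∀ U : Coord n → ConfTractor n, ContDiffOn ℝ ∞ U (patchDomain ι e c) → ∀ α : Fin n,
            D.ambientConnM (fun z => D.Phi z (U z)) y α = D.Phi y (D.confConn U y α)) ↔
          ∀ α β γ, D.ALow y α β γ = 0) := by
  have hF : ∀ ξ, (localData cov r ι τ e c ξ).IsFeffermanPatch e.target (patchDomain ι e c) :=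
    isFeffermanPatch_localData he hτ cov hn htor hflat hι hdef hconv hfeff hc
  -- The witness is the `TN` part of `g̃⁻¹ e₀`, the solution of `dρ(ξ) = 1` and `Hess ρ (TM, ξ) =
  -- 0`. It depends only on the defining density and the scale, and it is smooth by Cramer's rule.
  refine ⟨⟨fun y => WithLp.toLp 2 fun i => (preAmbient (scaleConn cov τ e) (scaleFun τ r e)
      (e (ι (c.symm y))))⁻¹ i.succ 0, ?_⟩, fun ξ hξ => ?_⟩
  · exact LocalData.IsUnitNormal.isAffineNormal (hF _)
      ((hF _).isUnitNormal_of_inv fun y _ => rfl)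
  · intro D y hy
    have hD : D.IsNormalPatch e.target (patchDomain ι e c) :=
      ⟨hF ξ, LocalData.IsAffineNormal.isUnitNormal (hF ξ) hξ⟩
    exact ⟨fun t ht => IsFlatScale.isUnit_det_ambientMetric (hD.isUnit_det hy) ht,
      fun v hv t ht a α => hD.covDeriv_homField hy (hv.differentiableAt (by simp)) ht a α,
      hD.bijective_Phi hy,
      fun U hU α => ⟨hD.projConn_Phi hy hn hU α, hD.ambientConnM_Phi hy hn hU α⟩,
      hD.ambientConnM_Phi_eq_iff hy hn⟩
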